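/- **Model.** Let $\mathcal I,\mathcal J$ be finite sets (customer classes and service stations). For each $n\in\mathbb N=\{1,2,\dots\}$ there are arrival rates $\lambda_i^n>0$, service rates $\mu_{ij}^n\ge 0$, numbers of servers $N_j^n\in\mathbb Z_+$ and deterministic initial numbers of customers $X_i^{0,n}\in\mathbb Z_+$ ($i\in\mathcal I$, $j\in\mathcal J$). On a probability space there are random variables $\check U_i(k)$ ($i\in\mathcal I$, $k\in\mathbb N$), independent, identically distributed in $k$ for each $i$, strictly positive, with mean $1$ and finite variance, and $A_i^n(t)=\sup\{l\ge 0:\sum_{k=1}^{l}\check U_i(k)/\lambda_i^n\le t\}$. For each $n$ there are mutually independent Poisson processes $S_{ij}^n$ with rates $\mu_{ij}^n$ (the zero process if $\mu^n_{ij}=0$), independent of the arrival processes $(A_i^n)_i$. A *(preemptive) scheduling control policy (SCP)* for the $n$th system is a $\mathbb Z_+$-valued process $\Psi^n=(\Psi_{ij}^n)$ with right-continuous paths for which there are processes $X_i^n,Y_i^n,Z_j^n$ with values in $\mathbb Z_+$ such that $\Psi^n_{ij}=0$ whenever $\mu^n_{ij}=0$, and for all $t\ge 0$, $i$, $j$,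 almost surely, $$X_i^n(t)=X_i^{0,n}+A_i^n(t)-\sum_{j}S_{ij}^n\Big(\int_0^t\Psi_{ij}^n(s)\,ds\Big),\qquad Y_i^n(t)+\sum_j\Psi_{ij}^n(t)=X_i^n(t),\qquad Z_j^n(t)+\sum_i\Psi_{ij}^n(t)=N_j^n,$$ and such that for every $t$ the variable $\Psi^n(t)$ is measurable with respect to $\sigma\{X^n(s),A^n(s):s\le t\}$. Here $X_i^n$, $Y_i^n$ count the class-$i$ customers in the system and those waiting in the buffer. **Fluid model.** Let $\lambda_i>0$, $\nu_j>0$, $\mu_{ij}\ge 0$ be constants such that $\mu_{ij}^n>0$ if and only if $\mu_{ij}>0$, for all $n,i,j$. Consider the linear program: minimize $\rho\ge 0$ over $(\xi,\rho)$ subject to $\sum_j\mu_{ij}\nu_j\xi_{ij}=\lambda_i$ for all $i$, $\sum_i\xi_{ij}\le\rho$ for all $j$, $\xi_{ij}\ge 0$. **Assumptions.** 1. (Critical load) There is an optimal solution $(\xi^*,\rho^*)$ with $\sum_i\xi^*_{ij}=1$ for all $j$. Fix such a $\xi^*$ and put $x_i^*=\sum_j\xi^*_{ij}\nu_j$. 2.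 The graph with vertex set $\mathcal I\cup\mathcal J$ (disjoint union) and edges $(i,j)$ for all $i,j$ with $\mu_{ij}>0$ and $\xi^*_{ij}>0$ is a tree. 3. There is a constant $c<\infty$ such that for all $i,j,n$ $$|n^{-1}\lambda_i^n-\lambda_i|\vee|\mu_{ij}^n-\mu_{ij}|\vee|n^{-1}N_j^n-\nu_j|\vee|n^{-1}X_i^{0,n}-x_i^*|\le c\,n^{-1/2}.$$ The static fluid model is *throughput suboptimal* if there is a matrix $\xi$ with $\xi_{ij}\ge 0$, $\sum_i\xi_{ij}\le 1$ for all $j$ and $\sum_j\xi_{ij}\nu_j\le x_i^*$ for all $i$, such that $\sum_{i,j}\mu_{ij}\nu_j\xi_{ij}>\sum_i\lambda_i$. **Theorem 1.** Let Assumptions 1–3 hold. If the static fluid model is throughput suboptimal, then there is a sequence of SCPs $\Psi^n$, $n\in\mathbb N$, not depending on $T$ and $\varrho$, under which, for all $0<T<\infty$ and $\varrho>1/2$, as $n\to\infty$, $$\int_0^T 1_{\{\sum_iY_i^n(s)>0\}}\,ds\to 0\quad\text{in probability},\qquad n^{-\varrho}\sup_{0\le t\le T}\sum_i|X_i^n(t)-X_i^{0,n}|\to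 0\quad\text{in probability}.$$ -/

import Mathlib

open MeasureTheory ProbabilityTheory Filter Topology
open scoped NNReal ENNReal

namespace ManyServer

/-! ### The static fluid model -/

/-- Data of the static fluid model: arrival rates `lam i` of the classes, capacities `nu j` of the
stations, and service rates `mu i j` (`mu i j = 0` when station `j` cannot serve class `i`). -/
structure Fluid (I J : Type*) where
  lam : I → ℝ
  nu : J → ℝ
  mu : I → J → ℝ
  lam_pos : ∀ i, 0 < lam i
  nu_pos : ∀ j, 0 < nu j
  mu_nonneg : ∀ i j, 0 ≤ mu i j

section Fluid

variable {I J : Type*} [Fintype I] [Fintype J]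

/-- Feasibility of `(ξ, ρ)` for the linear program "minimize `ρ`". -/
structure Fluid.IsFeasible (F : Fluid I J) (ξ : I → J → ℝ) (ρ : ℝ) : Prop where
  rho_nonneg : 0 ≤ ρ
  balance : ∀ i, ∑ j, F.mu i j * F.nu j * ξ i j = F.lam i
  load : ∀ j, ∑ i, ξ i j ≤ ρ
  nonneg : ∀ i j, 0 ≤ ξ i j

/-- `(ξ, ρ)` is an optimal solution of the linear program. -/
def Fluid.IsOptimal (F : Fluid I J) (ξ : I → J → ℝ) (ρ : ℝ) : Prop :=
  F.IsFeasible ξ ρ ∧ ∀ ξ' ρ', F.IsFeasible ξ' ρ' → ρ ≤ ρ'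

/-- Critical load: `ξ` is part of an optimal solution of the linear program, and all its column
sums are equal to one. -/
def Fluid.IsCritical (F : Fluid I J) (ξ : I → J → ℝ) : Prop :=
  (∃ ρ, F.IsOptimal ξ ρ) ∧ ∀ j, ∑ i, ξ i j = 1

/-- The amount of class-`i` fluid in the system under the allocation `ξ`. -/
def Fluid.mass (F : Fluid I J) (ξ : I → J → ℝ) (i : I) : ℝ := ∑ j, ξ i j * F.nu j

/-- The graph of basic activities: classes and stations are the vertices, and `i`, `j` are joined
when station `j` can serve class `i` and `ξ i j > 0`. -/
def Fluid.basicGraph (F : Fluid I J) (ξ : I → J → ℝ) : SimpleGraph (I ⊕ J) :=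
  SimpleGraph.fromRel fun u v =>
    ∃ i j, u = Sum.inl i ∧ v = Sum.inr j ∧ 0 < F.mu i j ∧ 0 < ξ i j

/-- Allocation matrices. -/
def IsAllocation (ξ : I → J → ℝ) : Prop :=
  (∀ i j, 0 ≤ ξ i j) ∧ ∀ j, ∑ i, ξ i j ≤ 1

/-- Throughput optimality, relative to the critical allocation `ξs`: an allocation that holds no
more fluid of any class than `ξs` does cannot process fluid faster than it arrives in total. -/
def Fluid.ThroughputOptimal (F : Fluid I J) (ξs : I → J → ℝ) : Prop :=
  ∀ ξ : I → J → ℝ, IsAllocation ξ → (∀ i, ∑ j, ξ i j * F.nu j ≤ F.mass ξs i) →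
    ∑ i, ∑ j, F.mu i j * F.nu j * ξ i j ≤ ∑ i, F.lam i

/-- Throughput suboptimality. -/
def Fluid.ThroughputSuboptimal (F : Fluid I J) (ξs : I → J → ℝ) : Prop :=
  ¬ F.ThroughputOptimal ξs

end Fluid

/-! ### The queueing systems -/

/-- Parameters of one queueing system: arrival rates, individual service rates, numbers of servers
at the stations, and initial numbers of customers of the classes. -/
structure System (I J : Type*) where
  lam : I → ℝ
  mu : I → J → ℝ
  servers : J → ℕ
  init : I → ℕ
  lam_pos : ∀ i, 0 < lam i
  mu_nonneg : ∀ i j, 0 ≤ mu i j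

/-- Second-order convergence of the parameters and of the initial condition: all deviations from
the fluid limit are at most `c * n ^ (-1/2)`. -/
def SecondOrder {I J : Type*} [Fintype J] (F : Fluid I J) (ξ : I → J → ℝ)
    (sys : ℕ+ → System I J) : Prop :=
  ∃ c : ℝ, ∀ (i : I) (j : J) (n : ℕ+),
    |(sys n).lam i / (n : ℝ) - F.lam i| ≤ c * (n : ℝ) ^ (-(1 / 2) : ℝ) ∧
    |(sys n).mu i j - F.mu i j| ≤ c * (n : ℝ) ^ (-(1 / 2) : ℝ) ∧
    |((sys n).servers j : ℝ) / (n : ℝ) - F.nu j| ≤ c * (n : ℝ) ^ (-(1 / 2) : ℝ) ∧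
    |((sys n).init i : ℝ) / (n : ℝ) - F.mass ξ i| ≤ c * (n : ℝ) ^ (-(1 / 2) : ℝ)

section Processes

variable {I J Ω : Type*} [MeasurableSpace Ω]

/-- The basic interarrival times: `U i 0, U i 1, …` are the (unscaled) interarrival times of
class `i`; they are independent over all classes and indices, identically distributed within a
class, strictly positive, of mean one and of finite variance. -/
structure IsRenewalInput (U : I → ℕ → Ω → ℝ) (P : Measure Ω) : Prop where
  measurable : ∀ i k, Measurable (U i k)
  indep : iIndepFun (fun p : I × ℕ => U p.1 p.2) P
  identDistrib : ∀ i k, IdentDistrib (U i k) (U i 0) P P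
  pos : ∀ i k, ∀ᵐ ω ∂P, 0 < U i k ω
  sq_integrable : ∀ i, MemLp (U i 0) 2 P
  mean : ∀ i, ∫ ω, U i 0 ω ∂P = 1

/-- The number of class-`i` arrivals up to time `t` when class `i` has arrival rate `lam i`. -/
noncomputable def arrivals (U : I → ℕ → Ω → ℝ) (lam : I → ℝ) (i : I) (t : ℝ≥0) (ω : Ω) : ℕ :=
  sSup {l : ℕ | ∑ k ∈ Finset.range l, U i k ω / lam i ≤ t}

/-- `N` is a Poisson process of rate `r` (for `r = 0` it is almost surely the zero process). -/
structure IsPoissonProcess (N : ℝ≥0 → Ω → ℕ) (r : ℝ≥0) (P : Measure Ω) : Prop where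
  measurable : ∀ t, Measurable (N t)
  paths : ∀ᵐ ω ∂P, N 0 ω = 0 ∧ Monotone (fun t => N t ω) ∧
    ∀ t, ContinuousWithinAt (fun s => N s ω) (Set.Ici t) t
  indep_increments : HasIndepIncrements N P
  law : ∀ s t, s ≤ t → P.map (fun ω => N t ω - N s ω) = poissonMeasure (r * (t - s))

/-- The service processes of one system: independent Poisson processes with rates `mu i j`, which
are jointly independent of the arrival processes `A`. -/
structure IsServiceInput (S : I → J → ℝ≥0 → Ω → ℕ) (mu : I → J → ℝ)
    (A : I → ℝ≥0 → Ω → ℕ) (P : Measure Ω) : Prop where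
  poisson : ∀ i j, IsPoissonProcess (S i j) (mu i j).toNNReal P
  indep : iIndepFun (fun (p : I × J) (ω : Ω) (t : ℝ≥0) => S p.1 p.2 t ω) P
  indep_arrivals : IndepFun (fun (ω : Ω) (p : I × ℝ≥0) => A p.1 p.2 ω)
    (fun (ω : Ω) (p : (I × J) × ℝ≥0) => S p.1.1 p.1.2 p.2 ω) P

/-- The cumulative time `∫₀ᵗ ψ(s) ds`, for a path `ψ` of a process with values in `ℕ`. -/
noncomputable def busyTime (ψ : ℝ≥0 → ℕ) (t : ℝ≥0) : ℝ≥0 :=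
  Real.toNNReal (∫ s in (0 : ℝ)..t, (ψ s.toNNReal : ℝ))

/-- The sigma-algebra generated by `X i s` and `A i s`, for `s ≤ t` and all `i`. -/
@[reducible] def history (X A : I → ℝ≥0 → Ω → ℕ) (t : ℝ≥0) : MeasurableSpace Ω :=
  ⨆ (s : ℝ≥0) (_ : s ≤ t) (i : I),
    MeasurableSpace.comap (X i s) inferInstance ⊔ MeasurableSpace.comap (A i s) inferInstance

/-- `Ψ` is a (preemptive) scheduling control policy for the system `sys` with primitive processes
`A` and `S`, and `X`, `Y`, `Z` are the processes it gives rise to: `Ψ i j` counts the class-`i`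
customers in service at station `j`, `X i` the class-`i` customers in the system, `Y i` those of
them that wait, and `Z j` the idle servers of station `j`. Nonnegativity and integrality are in
the types. The balance equation for `X` holds almost surely, because the primitive processes have
their path properties only almost surely. -/
structure IsSCP [Fintype I] [Fintype J] (sys : System I J) (P : Measure Ω)
    (A : I → ℝ≥0 → Ω → ℕ) (S : I → J → ℝ≥0 → Ω → ℕ)
    (Ψ : I → J → ℝ≥0 → Ω → ℕ) (X Y : I → ℝ≥0 → Ω → ℕ) (Z : J → ℝ≥0 → Ω → ℕ) : Prop where
  right_continuous : ∀ i j ω t, ContinuousWithinAt (fun s => Ψ i j s ω) (Set.Ici t) t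
  measurable_X : ∀ i t, Measurable (X i t)
  measurable_Y : ∀ i t, Measurable (Y i t)
  measurable_Z : ∀ j t, Measurable (Z j t)
  activity : ∀ i j, sys.mu i j = 0 → ∀ t ω, Ψ i j t ω = 0
  balance : ∀ᵐ ω ∂P, ∀ i t, (X i t ω : ℤ) =
    sys.init i + A i t ω - ∑ j, (S i j (busyTime (fun s => Ψ i j s ω) t) ω : ℤ)
  customers : ∀ i t ω, Y i t ω + ∑ j, Ψ i j t ω = X i t ω
  stations : ∀ j t ω, Z j t ω + ∑ i, Ψ i j t ω = sys.servers j
  adapted : ∀ i j t, Measurable[history X A t] (Ψ i j t)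

/-- The Lebesgue measure of the set of times in `[0, T]` at which some customer waits. -/
noncomputable def queueTime [Fintype I] (Y : I → ℝ≥0 → Ω → ℕ) (T : ℝ≥0) (ω : Ω) : ℝ≥0∞ :=
  volume {s : ℝ | s ∈ Set.Icc (0 : ℝ) T ∧ 0 < ∑ i, Y i s.toNNReal ω}

/-- `sup_{t ≤ T} ∑ i, |X i t - x i|`. -/
noncomputable def supDeviation [Fintype I] (X : I → ℝ≥0 → Ω → ℕ) (x : I → ℕ) (T : ℝ≥0)
    (ω : Ω) : ℝ≥0∞ :=
  ⨆ (t : ℝ≥0) (_ : t ≤ T), ENNReal.ofReal (∑ i, |(X i t ω : ℝ) - (x i : ℝ)|)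

/-- Convergence to zero in probability of a sequence with values in `[0, ∞]`. -/
def TendstoZeroInProb (P : Measure Ω) (f : ℕ+ → Ω → ℝ≥0∞) : Prop :=
  ∀ ε : ℝ, 0 < ε → Tendsto (fun n => P {ω | ENNReal.ofReal ε ≤ f n ω}) atTop (𝓝 0)

end Processes

end ManyServer

namespace ManyServer

/-! The policy is a feedback `Ψ = f (X)` with two regimes. If there are at most as many customers as
servers, everybody is served: connectedness of the basic graph lets the rounded allocation `n ξ ν`
be corrected by an integer matrix supported on its edges, of the order of the deviation from the
critical state plus `√n`. By the fluid balance the drift of each class is then of that order too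
(`exists_full_service`). If there are more customers than servers, throughput suboptimality provides
an allocation that fits into the critical population and drains the system at total rate of order
`n` (`exists_draining`). Customers wait only in this second regime.

Overload is short because each unit of time spent in it removes order `n` customers, while the noise
and the initial surplus are only of order `√n`. This is the deterministic `path_estimate`: at an
overloaded time the total population is still at least the number of servers, so `δ n` times the
overload time so far is bounded by the noise plus the integral of the deviation. The overload
contributes to each class at most `C n` times its duration, hence a term of the same kind, and
Gronwall closes the estimate. The feedback is controlled only near the critical state, so the
estimate is run up to a first exit and continued past it by right continuity.

The probabilistic input is Kolmogorov's maximal inequality: outside an event of probability at most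
`V / R`, arrivals and services deviate from their means by order `R √n`
(`exists_measure_not_isRegularPath_le`). There the queueing time is at most `M R / √n` and the
deviation at most `M R √n` (`exists_feedback_bound`); fixing `R` large and then letting `n` grow
gives both limits, the second because `ϱ > 1/2`.

It remains that the feedback defines a policy. Between events the population is constant, so the
balance equation is solved event by event, each primitive process being a clock whose speed depends
on the state (`exists_timeChanged_count`). Bounded speeds exclude explosion, and a function of the
current population is adapted (`exists_isSCP_of_feedback`). -/

lemma Fluid.basicGraph_adj {I J : Type*} (F : Fluid I J) (ξ : I → J → ℝ) (u v : I ⊕ J)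
    (h : (F.basicGraph ξ).Adj u v) : ∃ i j, (0 < F.mu i j ∧ 0 < ξ i j) ∧
      ((u = Sum.inl i ∧ v = Sum.inr j) ∨ (u = Sum.inr j ∧ v = Sum.inl i)) := by
  rw [Fluid.basicGraph, SimpleGraph.fromRel_adj] at h
  obtain ⟨_, ⟨i, j, h1, h2, h3⟩ | ⟨i, j, h1, h2, h3⟩⟩ := h
  · exact ⟨i, j, h3, Or.inl ⟨h1, h2⟩⟩
  · exact ⟨i, j, h3, Or.inr ⟨h2, h1⟩⟩

/-! ### Matrices supported on the basic graph, and critical allocations -/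

section Algebra

variable {I J : Type*} [Fintype I] [Fintype J]

/-- Along the paths of a bipartite graph one can build matrices, supported on the edges, whose
weighted row sums and column sums are prescribed, up to the sum of one root column. -/
lemma exists_matrix_of_reachable [DecidableEq I] [DecidableEq J] {R : Type*} [CommRing R]
    (E : I → J → Prop) (w : I → J → R) (hw : ∀ i j, E i j → IsUnit (w i j))
    (G : SimpleGraph (I ⊕ J))
    (hG : ∀ u v, G.Adj u v → ∃ i j, E i j ∧
      ((u = Sum.inl i ∧ v = Sum.inr j) ∨ (u = Sum.inr j ∧ v = Sum.inl i)))
    (j₀ : J) (v : I ⊕ J) (h : G.Reachable (Sum.inr j₀) v) :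
    ∃ (D : I → J → R) (α : R), (∀ i j, ¬ E i j → D i j = 0) ∧
      (∀ i, ∑ j, w i j * D i j = if v = Sum.inl i then 1 else 0) ∧
      (∀ j, ∑ i, D i j = (if v = Sum.inr j then 1 else 0) + α * if j = j₀ then 1 else 0) := by
  rw [SimpleGraph.reachable_iff_reflTransGen] at h
  induction h with
  | refl =>
    -- At the root, `α = -1` cancels the unit column sum, so the zero matrix serves.
    refine ⟨0, -1, fun _ _ _ => rfl, fun i => by simp, fun j => ?_⟩
    by_cases hj : j = j₀
    · simp [hj]
    · have : j₀ ≠ j := fun h => hj h.symm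
      simp [hj, this]
  | tail _ hadj ih =>
    obtain ⟨D, α, h0, hr, hc⟩ := ih
    obtain ⟨i, j, hE, (⟨rfl, rfl⟩ | ⟨rfl, rfl⟩)⟩ := hG _ _ hadj
    -- Passing from class `i` to station `j`: the unit entry adds `w i j` to row `i`, and
    -- subtracting `w i j * D` removes it again, leaving the unit in column `j`.
    · refine ⟨fun i' j' => (if i' = i ∧ j' = j then 1 else 0) - w i j * D i' j', -(w i j * α),
        fun i' j' h' => ?_, fun i' => ?_, fun j' => ?_⟩
      · have : ¬ (i' = i ∧ j' = j) := by rintro ⟨rfl, rfl⟩; exact h' hE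
        simp [this, h0 i' j' h']
      · have : ∑ x, w i' x * ((if i' = i ∧ x = j then 1 else 0) - w i j * D i' x)
            = (∑ x, if i' = i ∧ x = j then w i' x else 0) - w i j * ∑ x, w i' x * D i' x := by
          rw [Finset.mul_sum, ← Finset.sum_sub_distrib]
          refine Finset.sum_congr rfl fun x _ => ?_
          split_ifs <;> ring
        rw [this, hr]
        by_cases hi : i' = i
        · simp [hi]
        · have : i ≠ i' := fun h => hi h.symm
          simp [hi, this]
      · rw [Finset.sum_sub_distrib, ← Finset.mul_sum, hc]
        by_cases hj : j' = j
        · simp [hj]; split_ifs <;> ring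
        · have : j ≠ j' := fun h => hj h.symm
          simp [hj, this]; split_ifs <;> ring
    -- Only this direction divides by a weight. With unit weights the construction therefore stays
    -- in `ℤ`.
    · obtain ⟨u, hu⟩ := hw i j hE
      refine ⟨fun i' j' => ↑u⁻¹ * ((if i' = i ∧ j' = j then 1 else 0) - D i' j'), -(↑u⁻¹ * α),
        fun i' j' h' => ?_, fun i' => ?_, fun j' => ?_⟩
      · have : ¬ (i' = i ∧ j' = j) := by rintro ⟨rfl, rfl⟩; exact h' hE
        simp [this, h0 i' j' h']
      · have : ∑ x, w i' x * (↑u⁻¹ * ((if i' = i ∧ x = j then 1 else 0) - D i' x))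
            = ↑u⁻¹ * ((∑ x, if i' = i ∧ x = j then w i' x else 0) - ∑ x, w i' x * D i' x) := by
          rw [← Finset.sum_sub_distrib, Finset.mul_sum]
          refine Finset.sum_congr rfl fun x _ => ?_
          split_ifs <;> ring
        rw [this, hr]
        by_cases hi : i' = i
        · simp [hi, ← hu]
        · have : i ≠ i' := fun h => hi h.symm
          simp [hi, this]
      · rw [← Finset.mul_sum, Finset.sum_sub_distrib, hc]
        by_cases hj : j' = j
        · simp [hj]; split_ifs <;> ring
        · have : j ≠ j' := fun h => hj h.symm
          simp [hj, this]; split_ifs <;> ring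

/-- In a connected bipartite graph, integer row and column sums with equal totals are realized by
an integer matrix supported on the edges, with linear control of its size. -/
lemma exists_int_matrix_of_connected (E : I → J → Prop) (G : SimpleGraph (I ⊕ J))
    (hG : ∀ u v, G.Adj u v → ∃ i j, E i j ∧
      ((u = Sum.inl i ∧ v = Sum.inr j) ∨ (u = Sum.inr j ∧ v = Sum.inl i)))
    (hconn : G.Connected) (j₀ : J) :
    ∃ K : ℤ, 0 ≤ K ∧ ∀ (a : I → ℤ) (b : J → ℤ), ∑ i, a i = ∑ j, b j →
      ∃ D : I → J → ℤ, (∀ i j, ¬ E i j → D i j = 0) ∧ (∀ i, ∑ j, D i j = a i) ∧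
        (∀ j, ∑ i, D i j = b j) ∧ ∀ i j, |D i j| ≤ K * (∑ i, |a i| + ∑ j, |b j|) := by
  classical
  have key := fun v => exists_matrix_of_reachable E (fun _ _ => (1 : ℤ))
    (fun _ _ _ => isUnit_one) G hG j₀ v (hconn.preconnected _ v)
  choose D α h0 hr hc using key
  have hK : ∀ v i j, |D v i j| ≤ ∑ v, ∑ i, ∑ j, |D v i j| := fun v i j =>
    calc |D v i j| ≤ ∑ j, |D v i j| :=
          Finset.single_le_sum (f := fun j => |D v i j|) (fun _ _ => abs_nonneg _)
            (Finset.mem_univ j)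
      _ ≤ ∑ i, ∑ j, |D v i j| :=
          Finset.single_le_sum (f := fun i => ∑ j, |D v i j|)
            (fun _ _ => Finset.sum_nonneg fun _ _ => abs_nonneg _) (Finset.mem_univ i)
      _ ≤ ∑ v, ∑ i, ∑ j, |D v i j| :=
          Finset.single_le_sum (f := fun v => ∑ i, ∑ j, |D v i j|)
            (fun _ _ => Finset.sum_nonneg fun _ _ => Finset.sum_nonneg fun _ _ => abs_nonneg _)
            (Finset.mem_univ v)
  refine ⟨∑ v, ∑ i, ∑ j, |D v i j|, by positivity, fun a b hab => ?_⟩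
  set K := ∑ v, ∑ i, ∑ j, |D v i j|
  set g : I ⊕ J → ℤ := Sum.elim a b with hg
  set τ : I → J → ℤ := fun i j => ∑ v, g v * D v i j with hτ
  have hrow : ∀ i, ∑ j, τ i j = a i := fun i => by
    rw [hτ, Finset.sum_comm]
    simp only [one_mul] at hr
    simp_rw [← Finset.mul_sum, hr]
    simp [hg]
  have hcol : ∀ j, ∑ i, τ i j = b j + (∑ v, g v * α v) * if j = j₀ then 1 else 0 := fun j => by
    rw [hτ, Finset.sum_comm]
    simp_rw [← Finset.mul_sum, hc, mul_add, Finset.sum_add_distrib, Finset.sum_mul]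
    congr 1
    · simp [hg]
    · exact Finset.sum_congr rfl fun v _ => by ring
  -- Counting all entries by rows and by columns, equality of the totals forces the surplus in the
  -- root column to vanish.
  have hγ : ∑ v, g v * α v = 0 := by
    have h1 : ∑ i, ∑ j, τ i j = ∑ j, ∑ i, τ i j := Finset.sum_comm
    simp_rw [hrow, hcol, Finset.sum_add_distrib, hab] at h1
    simpa using h1
  refine ⟨τ, fun i j hE => Finset.sum_eq_zero fun v _ => by rw [h0 v i j hE, mul_zero], hrow,
    fun j => by rw [hcol, hγ]; simp, fun i j => ?_⟩
  calc |τ i j| ≤ ∑ v, |g v * D v i j| := Finset.abs_sum_le_sum_abs _ _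
    _ ≤ ∑ v, K * |g v| := Finset.sum_le_sum fun v _ => by
        rw [abs_mul, mul_comm]; exact mul_le_mul_of_nonneg_right (hK v i j) (abs_nonneg _)
    _ = K * (∑ i, |a i| + ∑ j, |b j|) := by
        rw [← Finset.mul_sum, Fintype.sum_sum_type]; simp [hg]

/-- Without stations the balance equation of a class would read `0 = lam i`. -/
lemma Fluid.IsCritical.nonempty_stations {F : Fluid I J} {ξ : I → J → ℝ} (h : F.IsCritical ξ)
    (hconn : (F.basicGraph ξ).Connected) : Nonempty J := by
  obtain ⟨⟨ρ, hf, _⟩, hc⟩ := h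
  obtain ⟨i | j⟩ := hconn.nonempty
  · by_contra hJ
    rw [not_nonempty_iff] at hJ
    have := hf.balance i
    simp at this
    exact (F.lam_pos i).ne this
  · exact ⟨j⟩

lemma Fluid.IsCritical.nonempty_classes {F : Fluid I J} {ξ : I → J → ℝ} (h : F.IsCritical ξ)
    (hconn : (F.basicGraph ξ).Connected) : Nonempty I := by
  obtain ⟨j⟩ := h.nonempty_stations hconn
  by_contra hI
  rw [not_nonempty_iff] at hI
  simpa using h.2 j

/-- A critical allocation with connected basic graph does not use capacity on pairs that process
nothing. -/
lemma Fluid.IsCritical.mu_pos {F : Fluid I J} {ξ : I → J → ℝ} (h : F.IsCritical ξ)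
    (hconn : (F.basicGraph ξ).Connected) (i : I) (j : J) (hξ : 0 < ξ i j) : 0 < F.mu i j := by
  classical
  by_contra hmu
  have hmu0 : F.mu i j = 0 := le_antisymm (not_lt.1 hmu) (F.mu_nonneg i j)
  obtain ⟨⟨ρ, hf, hopt⟩, hc⟩ := h
  have hρ : 1 ≤ ρ := (hc j).symm.le.trans (hf.load j)
  have key := fun k => exists_matrix_of_reachable (R := ℝ) (fun i j => 0 < F.mu i j ∧ 0 < ξ i j)
    (fun i j => F.mu i j * F.nu j) (fun i j hE => (mul_pos hE.1 (F.nu_pos j)).ne'.isUnit)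
    (F.basicGraph ξ) (F.basicGraph_adj ξ) j (Sum.inr k) (hconn.preconnected _ _)
  choose D α h0 hr hcol using key
  -- Subtracting `ε * M` leaves the throughput of every class unchanged and lowers every column sum
  -- by `ε`, except in column `j`, where the change is `ε * (1 + γ)`.
  set M : I → J → ℝ := fun i j => ∑ k, D k i j with hM
  have hMrow : ∀ i, ∑ j, F.mu i j * F.nu j * M i j = 0 := fun i => by
    simp_rw [hM, Finset.mul_sum]
    rw [Finset.sum_comm]
    simp_rw [hr]
    simp
  set γ : ℝ := ∑ k, α k
  have hMcol : ∀ l, ∑ i, M i l = 1 + γ * if l = j then 1 else 0 := fun l => by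
    rw [hM, Finset.sum_comm]
    simp_rw [hcol, Finset.sum_add_distrib, ← Finset.sum_mul]
    simp [γ]
  have hM0 : ∀ i j, ¬ (0 < F.mu i j ∧ 0 < ξ i j) → M i j = 0 := fun i j hE =>
    Finset.sum_eq_zero fun k _ => h0 k i j hE
  have hev : ∀ᶠ ε : ℝ in 𝓝[>] 0, ε ≤ 1 ∧ 0 < ε ∧ ε * (-γ) ≤ ξ i j ∧
      ∀ i j, 0 < ξ i j → ε * M i j ≤ ξ i j := by
    have small : ∀ (b d : ℝ), 0 < d → ∀ᶠ ε : ℝ in 𝓝[>] 0, ε * b ≤ d := fun b d hd => by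
      have : Tendsto (fun ε : ℝ => ε * b) (𝓝[>] 0) (𝓝 (0 * b)) :=
        ((continuous_id.mul continuous_const).tendsto 0).mono_left nhdsWithin_le_nhds
      rw [zero_mul] at this
      exact (this.eventually_lt_const hd).mono fun _ h => h.le
    refine Filter.Eventually.and ?_ (Filter.Eventually.and self_mem_nhdsWithin
      (Filter.Eventually.and (small _ _ hξ) ?_))
    · simpa using small 1 1 one_pos
    · rw [eventually_all]; intro i
      rw [eventually_all]; intro j
      by_cases h : 0 < ξ i j
      · exact (small (M i j) (ξ i j) h).mono fun _ h' _ => h'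
      · exact Eventually.of_forall fun _ h' => absurd h' h
  obtain ⟨ε, hε1, hε0, hεγ, hεM⟩ := hev.exists
  -- The entry at `(i, j)` processes nothing, so deleting it keeps the balance and frees capacity `ξ
  -- i j` in column `j`, which pays for the surplus `-ε * γ`. All loads become at most `1 - ε`,
  -- against optimality.
  have hfeas : F.IsFeasible
      (fun i' j' => ξ i' j' - (if i' = i ∧ j' = j then ξ i j else 0) - ε * M i' j') (1 - ε) := by
    refine ⟨by linarith, fun i' => ?_, fun j' => ?_, fun i' j' => ?_⟩
    · simp_rw [mul_sub, Finset.sum_sub_distrib, hf.balance]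
      have h1 : ∀ j', F.mu i' j' * F.nu j' * (if i' = i ∧ j' = j then ξ i j else 0) = 0 := by
        intro j'
        split_ifs with h
        · rw [h.1, h.2, hmu0]; simp
        · simp
      have h2 : ∑ j', F.mu i' j' * F.nu j' * (ε * M i' j')
          = ε * ∑ j', F.mu i' j' * F.nu j' * M i' j' := by
        rw [Finset.mul_sum]; exact Finset.sum_congr rfl fun _ _ => by ring
      rw [h2, hMrow, Finset.sum_congr rfl fun j' _ => h1 j']
      simp
    · simp_rw [Finset.sum_sub_distrib, ← Finset.mul_sum, hMcol, hc]
      by_cases hj : j' = j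
      · subst hj; simp; linarith
      · simp [hj]
    · by_cases h : i' = i ∧ j' = j
      · obtain ⟨rfl, rfl⟩ := h
        rw [hM0 _ _ fun h => hmu h.1]
        simp
      · rw [if_neg h, sub_zero]
        by_cases h' : 0 < ξ i' j'
        · linarith [hεM i' j' h']
        · rw [hM0 i' j' fun h => h' h.2]
          simpa using hf.nonneg i' j'
  linarith [hopt _ _ hfeas]

end Algebra

lemma exists_pos_forall_le_of_finite {ι : Type*} [Finite ι] (f : ι → ℝ) (p : ι → Prop)
    (hf : ∀ i, p i → 0 < f i) : ∃ κ, 0 < κ ∧ ∀ i, p i → κ ≤ f i := by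
  classical
  have hev : ∀ᶠ κ : ℝ in 𝓝[>] 0, 0 < κ ∧ ∀ i, p i → κ ≤ f i := by
    refine Filter.Eventually.and self_mem_nhdsWithin ?_
    rw [eventually_all]; intro i
    by_cases h : p i
    · have h1 : ∀ᶠ κ : ℝ in 𝓝 0, κ ≤ f i := Iic_mem_nhds (hf i h)
      exact (h1.filter_mono nhdsWithin_le_nhds).mono fun κ hκ _ => hκ
    · exact Eventually.of_forall fun _ h' => absurd h' h
  exact hev.exists

/-! ### Full-service and draining allocations -/

section Control

variable {I J : Type*} [Fintype J]

/-- The parameters of `s` are close to `y ^ 2` times those of the fluid model, up to errors of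
relative order `1 / y`. -/
structure IsClose (F : Fluid I J) (ξ : I → J → ℝ) (c y : ℝ) (s : System I J) : Prop where
  lam : ∀ i, |s.lam i - y ^ 2 * F.lam i| ≤ c * y
  mu : ∀ i j, |s.mu i j - F.mu i j| * y ≤ c
  servers : ∀ j, |(s.servers j : ℝ) - y ^ 2 * F.nu j| ≤ c * y
  init : ∀ i, |(s.init i : ℝ) - y ^ 2 * F.mass ξ i| ≤ c * y

/-- With `y = √n`, multiplication by `n = y ^ 2` turns an error `c / √n` into `c * y`; the service
rates are not scaled. The sign of `c` is read off from one instance of the bounds, which requires a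
class and a station. -/
lemma SecondOrder.isClose {F : Fluid I J} {ξ : I → J → ℝ} {sys : ℕ+ → System I J}
    (h : SecondOrder F ξ sys) [Nonempty I] [Nonempty J] :
    ∃ c, 0 ≤ c ∧ ∀ n : ℕ+, IsClose F ξ c (√(n : ℝ)) (sys n) := by
  obtain ⟨c, hc⟩ := h
  have hn : ∀ n : ℕ+, 0 < √((n : ℕ) : ℝ) := fun n => Real.sqrt_pos.2 (by exact_mod_cast n.pos)
  have hr : ∀ n : ℕ+, ((n : ℕ) : ℝ) ^ (-(1 / 2) : ℝ) = (√((n : ℕ) : ℝ))⁻¹ := fun n => by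
    rw [Real.rpow_neg (by positivity), ← Real.sqrt_eq_rpow]
  have hsq : ∀ n : ℕ+, √((n : ℕ) : ℝ) ^ 2 = ((n : ℕ) : ℝ) := fun n =>
    Real.sq_sqrt (by positivity)
  have scale : ∀ (n : ℕ+) (a b : ℝ), |a / ((n : ℕ) : ℝ) - b| ≤ c * ((n : ℕ) : ℝ) ^ (-(1 / 2) : ℝ) →
      |a - √((n : ℕ) : ℝ) ^ 2 * b| ≤ c * √((n : ℕ) : ℝ) := by
    intro n a b hab
    rw [hr] at hab
    have hsqn := hsq n
    set y := √((n : ℕ) : ℝ)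
    rw [← hsqn] at hab
    have hy : 0 < y := hn n
    have : a - y ^ 2 * b = y ^ 2 * (a / y ^ 2 - b) := by field_simp
    rw [this, abs_mul, abs_of_pos (by positivity)]
    calc y ^ 2 * |a / y ^ 2 - b| ≤ y ^ 2 * (c * y⁻¹) := by gcongr
      _ = c * y := by field_simp
  have hmu : ∀ (n : ℕ+) i j, |(sys n).mu i j - F.mu i j| * √((n : ℕ) : ℝ) ≤ c := by
    intro n i j
    have := (hc i j n).2.1
    rw [hr] at this
    calc _ ≤ c * (√((n : ℕ) : ℝ))⁻¹ * √((n : ℕ) : ℝ) := by have := (hn n).le; gcongr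
      _ = c := by rw [inv_mul_cancel_right₀ (hn n).ne']
  refine ⟨c, ?_, fun n => ⟨fun i => ?_, hmu n, fun j => ?_, fun i => ?_⟩⟩
  · refine le_trans ?_ (hmu 1 (Classical.arbitrary I) (Classical.arbitrary J))
    positivity
  · exact scale n _ _ (hc i (Classical.arbitrary J) n).1
  · exact scale n _ _ (hc (Classical.arbitrary I) j n).2.2.1
  · exact scale n _ _ (hc i (Classical.arbitrary J) n).2.2.2

variable [Fintype I]

lemma Fluid.sum_mass {F : Fluid I J} {ξ : I → J → ℝ} (h : F.IsCritical ξ) :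
    ∑ i, F.mass ξ i = ∑ j, F.nu j := by
  unfold Fluid.mass
  rw [Finset.sum_comm]
  simp_rw [← Finset.sum_mul, h.2, one_mul]

/-- A class without mass would have `ξ i j = 0` for all `j`, hence no throughput to balance its
positive arrival rate. -/
lemma Fluid.mass_pos {F : Fluid I J} {ξ : I → J → ℝ} (h : F.IsCritical ξ) (i : I) :
    0 < F.mass ξ i := by
  obtain ⟨⟨ρ, hf, -⟩, -⟩ := h
  have h0 : ∀ j, 0 ≤ ξ i j * F.nu j := fun j => mul_nonneg (hf.nonneg i j) (F.nu_pos j).le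
  refine (Finset.sum_nonneg fun j _ => h0 j).lt_of_ne' fun h => ?_
  rw [Finset.sum_eq_zero_iff_of_nonneg fun j _ => h0 j] at h
  refine (F.lam_pos i).ne' ?_
  rw [← hf.balance i]
  refine Finset.sum_eq_zero fun j hj => ?_
  rw [mul_assoc, mul_comm (F.nu j), h j hj, mul_zero]

/-- When there are no more customers than servers, all customers can be served by an allocation
close to the critical one. -/
lemma Fluid.IsCritical.exists_full_service {F : Fluid I J} {ξ : I → J → ℝ} (hcrit : F.IsCritical ξ)
    (hconn : (F.basicGraph ξ).Connected) {c : ℝ} (hc : 0 ≤ c) :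
    ∃ C η : ℝ, 0 < η ∧ 0 ≤ C ∧ ∀ᶠ y : ℝ in atTop, ∀ s : System I J, IsClose F ξ c y s →
      ∀ x : I → ℕ, ∑ i, |(x i : ℝ) - y ^ 2 * F.mass ξ i| ≤ η * y ^ 2 →
      ∑ i, x i ≤ ∑ j, s.servers j →
      ∃ ψ : I → J → ℕ, (∀ i j, F.mu i j = 0 → ψ i j = 0) ∧ (∀ i, ∑ j, ψ i j = x i) ∧
        (∀ j, ∑ i, ψ i j ≤ s.servers j) ∧
        ∀ i, |s.lam i - ∑ j, s.mu i j * ψ i j|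
          ≤ C * (∑ i, |(x i : ℝ) - y ^ 2 * F.mass ξ i| + y) := by
  classical
  obtain ⟨j₀⟩ := hcrit.nonempty_stations hconn
  obtain ⟨K, hK0, hK⟩ := exists_int_matrix_of_connected (fun i j => 0 < F.mu i j ∧ 0 < ξ i j)
    (F.basicGraph ξ) (F.basicGraph_adj ξ) hconn j₀
  obtain ⟨κ, hκ0, hκ⟩ := exists_pos_forall_le_of_finite (fun p : I × J => ξ p.1 p.2 * F.nu p.2)
    (fun p => 0 < ξ p.1 p.2) (fun p hp => mul_pos hp (F.nu_pos p.2))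
  have hξ0 : ∀ i j, 0 ≤ ξ i j := by
    obtain ⟨⟨ρ, hf, -⟩, -⟩ := hcrit
    exact hf.nonneg
  have hE : ∀ i j, ¬ (0 < F.mu i j ∧ 0 < ξ i j) → ξ i j = 0 := fun i j h => by
    by_contra hne
    have hp := (hξ0 i j).lt_of_ne' hne
    exact h ⟨hcrit.mu_pos hconn i j hp, hp⟩
  have hK0' : (0 : ℝ) ≤ K := by exact_mod_cast hK0
  set nI : ℝ := (Fintype.card I : ℝ) with hnI
  set nJ : ℝ := (Fintype.card J : ℝ) with hnJ
  have hnI0 : 0 ≤ nI := Nat.cast_nonneg _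
  have hnJ0 : 0 ≤ nJ := Nat.cast_nonneg _
  -- This bounds the total size of the prescribed sums `a` and `b` relative to `h + y`. The
  -- deviation `h` enters twice, through the rows and through the number `Z` of idle servers.
  set q : ℝ := 2 + 2 * nJ * c + 2 * nI * nJ with hq
  have hq0 : 0 < q := by positivity
  set q₂ : ℝ := 1 + K * q with hq₂
  have hq₂0 : 0 < q₂ := by positivity
  -- The fluid allocation is at least `κ * y ^ 2` on the edges. The choice of `η` lets `h` consume
  -- at most half of this, the other half being left for the error of order `y`.
  refine ⟨c + (∑ j, c * (F.nu j + c)) + ∑ i, ∑ j, F.mu i j * q₂, κ / (2 * q₂), by positivity,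
    ?_, ?_⟩
  · have h1 : ∀ j, 0 ≤ c * (F.nu j + c) := fun j => by have := (F.nu_pos j).le; positivity
    have h2 : ∀ i j, 0 ≤ F.mu i j * q₂ := fun i j => by have := F.mu_nonneg i j; positivity
    have := Finset.sum_nonneg fun j (_ : j ∈ Finset.univ) => h1 j
    have := Finset.sum_nonneg fun i (_ : i ∈ Finset.univ) =>
      Finset.sum_nonneg fun j (_ : j ∈ Finset.univ) => h2 i j
    positivity
  filter_upwards [eventually_ge_atTop (1 : ℝ), eventually_ge_atTop (2 * q₂ / κ)] with y hy1 hyκ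
  intro s hs x hx hle
  have hy0 : 0 < y := by linarith
  set h := ∑ i, |(x i : ℝ) - y ^ 2 * F.mass ξ i| with hh
  have hh0 : 0 ≤ h := Finset.sum_nonneg fun _ _ => abs_nonneg _
  set B : I → J → ℤ := fun i j => ⌊y ^ 2 * (ξ i j * F.nu j)⌋ with hB
  have hBabs : ∀ i j, |y ^ 2 * (ξ i j * F.nu j) - B i j| ≤ 1 := fun i j => by
    rw [abs_le]
    constructor
    · linarith [Int.floor_le (y ^ 2 * (ξ i j * F.nu j))]
    · linarith [Int.lt_floor_add_one (y ^ 2 * (ξ i j * F.nu j))]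
  set Z : ℤ := ∑ j, (s.servers j : ℤ) - ∑ i, (x i : ℤ) with hZ
  have hZ0 : 0 ≤ Z := by
    rw [hZ, sub_nonneg]; exact_mod_cast hle
  have hZle : (Z : ℝ) ≤ h + nJ * (c * y) := by
    have h1 : ∑ j, (s.servers j : ℝ) ≤ ∑ j, (y ^ 2 * F.nu j + c * y) :=
      Finset.sum_le_sum fun j _ => by linarith [(abs_le.1 (hs.servers j)).2]
    have h2 : ∑ i, (y ^ 2 * F.mass ξ i - |(x i : ℝ) - y ^ 2 * F.mass ξ i|) ≤ ∑ i, (x i : ℝ) :=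
      Finset.sum_le_sum fun i _ => by linarith [neg_abs_le ((x i : ℝ) - y ^ 2 * F.mass ξ i)]
    rw [Finset.sum_add_distrib, ← Finset.mul_sum] at h1
    rw [Finset.sum_sub_distrib, ← Finset.mul_sum, Fluid.sum_mass hcrit] at h2
    simp only [Finset.sum_const, Finset.card_univ, nsmul_eq_mul] at h1
    rw [hZ]; push_cast
    linarith
  set a : I → ℤ := fun i => (x i : ℤ) - ∑ j, B i j with ha
  -- All idle servers are placed at `j₀`, which makes the row and column totals agree.
  set b : J → ℤ := fun j => (s.servers j : ℤ) - (if j = j₀ then Z else 0) - ∑ i, B i j with hb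
  have hab : ∑ i, a i = ∑ j, b j := by
    simp only [ha, hb, Finset.sum_sub_distrib]
    rw [Finset.sum_comm]
    simp [hZ]
  obtain ⟨D, hD0, hDr, hDc, hDb⟩ := hK a b hab
  have hasum : ∑ i, |(a i : ℝ)| ≤ h + nI * nJ := by
    have : ∀ i, |(a i : ℝ)| ≤ |(x i : ℝ) - y ^ 2 * F.mass ξ i| + nJ := fun i => by
      have h1 : (a i : ℝ) = ((x i : ℝ) - y ^ 2 * F.mass ξ i)
          + ∑ j, (y ^ 2 * (ξ i j * F.nu j) - B i j) := by
        simp only [ha, Fluid.mass, Finset.sum_sub_distrib, Finset.mul_sum]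
        push_cast; ring
      rw [h1]
      refine (abs_add_le _ _).trans (add_le_add le_rfl ?_)
      refine (Finset.abs_sum_le_sum_abs _ _).trans
        ((Finset.sum_le_sum fun j _ => hBabs i j).trans ?_)
      simp [hnJ]
    refine (Finset.sum_le_sum fun i _ => this i).trans ?_
    rw [Finset.sum_add_distrib]
    simp [hnI, hh]
  have hbsum : ∑ j, |(b j : ℝ)| ≤ nJ * (c * y) + nI * nJ + Z := by
    have : ∀ j, |(b j : ℝ)| ≤ (c * y + nI) + if j = j₀ then (Z : ℝ) else 0 := fun j => by
      have h1 : (b j : ℝ) = ((s.servers j : ℝ) - y ^ 2 * F.nu j)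
          + (∑ i, (y ^ 2 * (ξ i j * F.nu j) - B i j)) - if j = j₀ then (Z : ℝ) else 0 := by
        rw [Finset.sum_sub_distrib, ← Finset.mul_sum, ← Finset.sum_mul, hcrit.2]
        simp only [hb]
        push_cast; ring
      have h2 : |∑ i, (y ^ 2 * (ξ i j * F.nu j) - B i j)| ≤ nI := by
        refine (Finset.abs_sum_le_sum_abs _ _).trans
          ((Finset.sum_le_sum fun i _ => hBabs i j).trans ?_)
        simp [hnI]
      have h3 : |if j = j₀ then (Z : ℝ) else 0| = if j = j₀ then (Z : ℝ) else 0 :=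
        abs_of_nonneg (by split_ifs; exacts [by exact_mod_cast hZ0, le_rfl])
      rw [h1]
      refine (abs_sub _ _).trans (add_le_add ((abs_add_le _ _).trans (add_le_add ?_ h2)) h3.le)
      exact hs.servers j
    refine (Finset.sum_le_sum fun j _ => this j).trans ?_
    rw [Finset.sum_add_distrib]
    simp only [Finset.sum_const, Finset.card_univ, nsmul_eq_mul, Finset.sum_ite_eq',
      Finset.mem_univ, if_true]
    rw [← hnJ]
    linarith [mul_comm nI nJ]
  have hDabs : ∀ i j, |(D i j : ℝ)| ≤ K * (q * (h + y)) := fun i j => by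
    have h1 : |(D i j : ℝ)| ≤ K * (∑ i, |(a i : ℝ)| + ∑ j, |(b j : ℝ)|) := by
      exact_mod_cast hDb i j
    refine h1.trans (mul_le_mul_of_nonneg_left ?_ hK0')
    have h2 : 2 * nI * nJ ≤ 2 * nI * nJ * (h + y) :=
      le_mul_of_one_le_right (by positivity) (by linarith)
    have h3 : 2 * nJ * c * y ≤ 2 * nJ * c * (h + y) := by gcongr; linarith
    rw [hq]; linarith
  have hψabs : ∀ i j, |((B i j + D i j : ℤ) : ℝ) - y ^ 2 * (ξ i j * F.nu j)| ≤ q₂ * (h + y) := by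
    intro i j
    have h1 := hBabs i j
    have h2 := hDabs i j
    have h3 : ((B i j + D i j : ℤ) : ℝ) - y ^ 2 * (ξ i j * F.nu j)
        = D i j - (y ^ 2 * (ξ i j * F.nu j) - B i j) := by push_cast; ring
    rw [h3, hq₂]
    refine (abs_sub _ _).trans ?_
    linarith
  have hψ0 : ∀ i j, 0 ≤ B i j + D i j := fun i j => by
    by_cases hij : 0 < F.mu i j ∧ 0 < ξ i j
    · have h1 := (abs_le.1 (hψabs i j)).1
      have h2 : κ * y ^ 2 ≤ y ^ 2 * (ξ i j * F.nu j) := by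
        rw [mul_comm]; gcongr; exact hκ (i, j) hij.2
      have h3 : q₂ * h ≤ κ * y ^ 2 / 2 := by
        calc q₂ * h ≤ q₂ * (κ / (2 * q₂) * y ^ 2) := by gcongr
          _ = κ * y ^ 2 / 2 := by field_simp
      have h4 : q₂ * y ≤ κ * y ^ 2 / 2 := by
        rw [div_le_iff₀ hκ0] at hyκ
        nlinarith
      have : (0 : ℝ) ≤ ((B i j + D i j : ℤ) : ℝ) := by linarith
      exact_mod_cast this
    · rw [hD0 i j hij]
      simp [hB, hE i j hij]
  have hψc : ∀ i j, (((B i j + D i j).toNat : ℕ) : ℤ) = B i j + D i j := fun i j =>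
    Int.toNat_of_nonneg (hψ0 i j)
  have hψr : ∀ i j, (((B i j + D i j).toNat : ℕ) : ℝ) = ((B i j + D i j : ℤ) : ℝ) := fun i j => by
    exact_mod_cast congrArg (Int.cast : ℤ → ℝ) (hψc i j)
  have hcol : ∀ j, ∑ i, (B i j + D i j).toNat ≤ s.servers j := fun j => by
    zify
    simp_rw [hψc, Finset.sum_add_distrib, hDc, hb]
    split_ifs <;> linarith
  refine ⟨fun i j => (B i j + D i j).toNat, fun i j hmu => ?_, fun i => ?_, hcol, fun i => ?_⟩
  · have hij : ¬ (0 < F.mu i j ∧ 0 < ξ i j) := fun h => h.1.ne' hmu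
    simp [hB, hE i j hij, hD0 i j hij]
  · zify
    simp_rw [hψc, Finset.sum_add_distrib, hDr, ha]
    ring
  · have hle : ∀ j, (((B i j + D i j).toNat : ℕ) : ℝ) ≤ (F.nu j + c) * y ^ 2 := fun j => by
      have h1 : ((B i j + D i j).toNat : ℝ) ≤ s.servers j := by
        exact_mod_cast (Finset.single_le_sum (f := fun i => (B i j + D i j).toNat)
          (fun _ _ => Nat.zero_le _) (Finset.mem_univ i)).trans (hcol j)
      have h2 := (abs_le.1 (hs.servers j)).2
      nlinarith [mul_nonneg hc (mul_nonneg hy0.le (sub_nonneg.2 hy1))]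
    obtain ⟨⟨ρ, hf, -⟩, -⟩ := hcrit
    -- The terms of order `y ^ 2` cancel by the fluid balance. What remains are the errors of the
    -- arrival rate, of the service rates and of the allocation.
    have hdec : s.lam i - ∑ j, s.mu i j * ((B i j + D i j).toNat : ℝ)
        = (s.lam i - y ^ 2 * F.lam i)
          + ∑ j, -((s.mu i j - F.mu i j) * ((B i j + D i j).toNat : ℝ))
          + ∑ j, -(F.mu i j * (((B i j + D i j : ℤ) : ℝ) - y ^ 2 * (ξ i j * F.nu j))) := by
      rw [← hf.balance i, Finset.mul_sum, add_assoc, ← Finset.sum_add_distrib, sub_add,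
        ← Finset.sum_sub_distrib, sub_right_inj]
      refine Finset.sum_congr rfl fun j _ => ?_
      rw [hψr]; ring
    rw [hdec]
    have h1 := hs.lam i
    have h2 : |∑ j, -((s.mu i j - F.mu i j) * ((B i j + D i j).toNat : ℝ))|
        ≤ (∑ j, c * (F.nu j + c)) * y := by
      refine (Finset.abs_sum_le_sum_abs _ _).trans ?_
      rw [Finset.sum_mul]
      refine Finset.sum_le_sum fun j _ => ?_
      rw [abs_neg, abs_mul, Nat.abs_cast]
      have hν := F.nu_pos j
      calc |s.mu i j - F.mu i j| * ((B i j + D i j).toNat : ℝ)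
          ≤ |s.mu i j - F.mu i j| * ((F.nu j + c) * y ^ 2) :=
            mul_le_mul_of_nonneg_left (hle j) (abs_nonneg _)
        _ = (|s.mu i j - F.mu i j| * y) * ((F.nu j + c) * y) := by ring
        _ ≤ c * ((F.nu j + c) * y) :=
            mul_le_mul_of_nonneg_right (hs.mu i j) (by positivity)
        _ = _ := by ring
    have h3 : |∑ j, -(F.mu i j * (((B i j + D i j : ℤ) : ℝ) - y ^ 2 * (ξ i j * F.nu j)))|
        ≤ (∑ i, ∑ j, F.mu i j * q₂) * (h + y) := by
      refine (Finset.abs_sum_le_sum_abs _ _).trans ?_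
      have h4 : ∑ j, F.mu i j * q₂ ≤ ∑ i, ∑ j, F.mu i j * q₂ :=
        Finset.single_le_sum (f := fun i => ∑ j, F.mu i j * q₂)
          (fun i _ => Finset.sum_nonneg fun j _ => mul_nonneg (F.mu_nonneg i j) hq₂0.le)
          (Finset.mem_univ i)
      refine le_trans ?_ (mul_le_mul_of_nonneg_right h4 (by positivity))
      rw [Finset.sum_mul]
      refine Finset.sum_le_sum fun j _ => ?_
      rw [abs_neg, abs_mul, abs_of_nonneg (F.mu_nonneg i j), mul_assoc]
      exact mul_le_mul_of_nonneg_left (hψabs i j) (F.mu_nonneg i j)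
    have h5 : 0 ≤ ∑ j, c * (F.nu j + c) := Finset.sum_nonneg fun j _ => by
      have := (F.nu_pos j).le; positivity
    calc _ ≤ c * y + (∑ j, c * (F.nu j + c)) * y + (∑ i, ∑ j, F.mu i j * q₂) * (h + y) :=
          (abs_add_le _ _).trans (add_le_add ((abs_add_le _ _).trans (add_le_add h1 h2)) h3)
      _ ≤ _ := by nlinarith [mul_nonneg hc hh0, mul_nonneg h5 hh0]

/-- If the fluid model is throughput suboptimal, there is an allocation that is feasible whenever
the numbers of customers are close to the critical ones, and that drains the system at a rate of
the order of its size. -/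
lemma Fluid.IsCritical.exists_draining {F : Fluid I J} {ξ : I → J → ℝ} (hcrit : F.IsCritical ξ)
    (hsub : F.ThroughputSuboptimal ξ) {c : ℝ} (hc : 0 ≤ c) :
    ∃ C δ η : ℝ, 0 < η ∧ 0 < δ ∧ 0 ≤ C ∧ ∀ᶠ y : ℝ in atTop, ∀ s : System I J,
      IsClose F ξ c y s → ∃ ψ : I → J → ℕ, (∀ i j, F.mu i j = 0 → ψ i j = 0) ∧
        (∀ x : I → ℕ, ∑ i, |(x i : ℝ) - y ^ 2 * F.mass ξ i| ≤ η * y ^ 2 →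
          ∀ i, ∑ j, ψ i j ≤ x i) ∧
        (∀ j, ∑ i, ψ i j ≤ s.servers j) ∧
        (∀ i, |s.lam i - ∑ j, s.mu i j * ψ i j| ≤ C * y ^ 2) ∧
        ∑ i, (s.lam i - ∑ j, s.mu i j * ψ i j) ≤ -δ * y ^ 2 := by
  classical
  rw [Fluid.ThroughputSuboptimal, Fluid.ThroughputOptimal] at hsub
  push Not at hsub
  obtain ⟨ξ', ⟨hξ0, hξ1⟩, hmass, hgain⟩ := hsub
  set Λ := ∑ i, F.lam i with hΛ
  have hΛ0 : 0 ≤ Λ := Finset.sum_nonneg fun i _ => (F.lam_pos i).le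
  set V := ∑ i, ∑ j, F.mu i j * F.nu j * ξ' i j with hV
  set g := V - Λ with hg
  have hg0 : 0 < g := sub_pos.2 hgain
  have hV0 : 0 < V := by linarith
  -- Shrinking the better allocation by `1 - θ` keeps half of its excess throughput `g`, and creates
  -- slack proportional to `θ` in every class and at every station.
  set θ := g / (2 * V) with hθ
  have hθ0 : 0 < θ := by positivity
  have hθV : θ * V = g / 2 := by rw [hθ]; field_simp
  have hθ1 : θ ≤ 1 := by
    rw [hθ, div_le_one (by positivity)]; linarith
  set Φ : I → J → ℝ := fun i j => if F.mu i j = 0 then 0 else (1 - θ) * (ξ' i j * F.nu j) with hΦ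
  have hw0 : ∀ i j, 0 ≤ (1 - θ) * (ξ' i j * F.nu j) := fun i j =>
    mul_nonneg (by linarith) (mul_nonneg (hξ0 i j) (F.nu_pos j).le)
  have hΦ0 : ∀ i j, 0 ≤ Φ i j := fun i j => by
    simp only [hΦ]; split_ifs; exacts [le_rfl, hw0 i j]
  have hΦle : ∀ i j, Φ i j ≤ (1 - θ) * (ξ' i j * F.nu j) := fun i j => by
    simp only [hΦ]; split_ifs; exacts [hw0 i j, le_rfl]
  have hΦV : ∑ i, ∑ j, F.mu i j * Φ i j = (1 - θ) * V := by
    rw [hV, Finset.mul_sum]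
    refine Finset.sum_congr rfl fun i _ => ?_
    rw [Finset.mul_sum]
    refine Finset.sum_congr rfl fun j _ => ?_
    simp only [hΦ]; split_ifs with h
    · simp [h]
    · ring
  have hΦrow : ∀ i, ∑ j, Φ i j ≤ (1 - θ) * F.mass ξ i := fun i =>
    (Finset.sum_le_sum fun j _ => hΦle i j).trans (by
      rw [← Finset.mul_sum]; exact mul_le_mul_of_nonneg_left (hmass i) (by linarith))
  have hΦcol : ∀ j, ∑ i, Φ i j ≤ (1 - θ) * F.nu j := fun j =>
    (Finset.sum_le_sum fun i _ => hΦle i j).trans (by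
      rw [← Finset.mul_sum, ← Finset.sum_mul]
      refine mul_le_mul_of_nonneg_left ?_ (by linarith)
      exact mul_le_of_le_one_left (F.nu_pos j).le (hξ1 j))
  obtain ⟨m, hm0, hm⟩ := exists_pos_forall_le_of_finite (F.mass ξ) (fun _ => True)
    (fun i _ => Fluid.mass_pos hcrit i)
  obtain ⟨ν₀, hν₀, hν⟩ := exists_pos_forall_le_of_finite F.nu (fun _ => True)
    (fun j _ => F.nu_pos j)
  set φs := ∑ i, ∑ j, Φ i j with hφs
  set μs := ∑ i, ∑ j, F.mu i j with hμs
  have hφs0 : 0 ≤ φs := Finset.sum_nonneg fun i _ => Finset.sum_nonneg fun j _ => hΦ0 i j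
  have hμs0 : 0 ≤ μs := Finset.sum_nonneg fun i _ => Finset.sum_nonneg fun j _ => F.mu_nonneg i j
  set q : ℝ := Fintype.card I * c + μs + c * φs with hq
  -- Of the remaining excess `g / 2`, half is reserved for rounding and parameter errors. `θ * m` is
  -- a lower bound for the slack of each class, so a population within this distance still
  -- accommodates the allocation.
  refine ⟨Λ + c + (μs + c) * φs, g / 4, θ * m, by positivity, by positivity, by positivity, ?_⟩
  filter_upwards [eventually_ge_atTop (1 : ℝ), eventually_ge_atTop (c / (θ * ν₀)),
    eventually_ge_atTop (4 * q / g)] with y hy1 hyθ hyq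
  intro s hs
  have hy0 : 0 < y := by linarith
  have hy2 : y ≤ y ^ 2 := by nlinarith
  have hfl : ∀ i j, (⌊y ^ 2 * Φ i j⌋₊ : ℝ) ≤ y ^ 2 * Φ i j := fun i j =>
    Nat.floor_le (mul_nonneg (sq_nonneg y) (hΦ0 i j))
  have hmu' : ∀ i j, |s.mu i j - F.mu i j| ≤ c := fun i j =>
    (le_mul_of_one_le_right (abs_nonneg _) hy1).trans (hs.mu i j)
  refine ⟨fun i j => ⌊y ^ 2 * Φ i j⌋₊, fun i j h => by simp [hΦ, h], fun x hx i => ?_,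
    fun j => ?_, fun i => ?_, ?_⟩
  · have h1 : ∑ j, (⌊y ^ 2 * Φ i j⌋₊ : ℝ) ≤ y ^ 2 * ((1 - θ) * F.mass ξ i) :=
      (Finset.sum_le_sum fun j _ => hfl i j).trans (by
        rw [← Finset.mul_sum]; exact mul_le_mul_of_nonneg_left (hΦrow i) (sq_nonneg y))
    have h2 : |(x i : ℝ) - y ^ 2 * F.mass ξ i| ≤ θ * m * y ^ 2 :=
      (Finset.single_le_sum (f := fun i => |(x i : ℝ) - y ^ 2 * F.mass ξ i|)
        (fun _ _ => abs_nonneg _) (Finset.mem_univ i)).trans hx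
    have h3 := (abs_le.1 h2).1
    have h4 : θ * m * y ^ 2 ≤ θ * F.mass ξ i * y ^ 2 := by
      gcongr; exact hm i trivial
    have : ∑ j, (⌊y ^ 2 * Φ i j⌋₊ : ℝ) ≤ x i := by linarith
    exact_mod_cast this
  · have h1 : ∑ i, (⌊y ^ 2 * Φ i j⌋₊ : ℝ) ≤ y ^ 2 * ((1 - θ) * F.nu j) :=
      (Finset.sum_le_sum fun i _ => hfl i j).trans (by
        rw [← Finset.mul_sum]; exact mul_le_mul_of_nonneg_left (hΦcol j) (sq_nonneg y))
    have h3 := (abs_le.1 (hs.servers j)).1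
    have h4 : c * y ≤ θ * F.nu j * y ^ 2 := by
      rw [div_le_iff₀ (by positivity)] at hyθ
      have : y * (θ * ν₀) ≤ y * (θ * F.nu j) := by gcongr; exact hν j trivial
      nlinarith
    have : ∑ i, (⌊y ^ 2 * Φ i j⌋₊ : ℝ) ≤ s.servers j := by linarith
    exact_mod_cast this
  · refine (abs_sub _ _).trans ?_
    have h1 : |s.lam i| ≤ (Λ + c) * y ^ 2 := by
      have h2 := (abs_le.1 (hs.lam i)).2
      have h3 : F.lam i ≤ Λ := Finset.single_le_sum (f := F.lam)
        (fun i _ => (F.lam_pos i).le) (Finset.mem_univ i)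
      rw [abs_of_pos (s.lam_pos i)]
      nlinarith [mul_le_mul_of_nonneg_left hy2 hc, sq_nonneg y]
    have h2 : |∑ j, s.mu i j * (⌊y ^ 2 * Φ i j⌋₊ : ℝ)| ≤ (μs + c) * φs * y ^ 2 := by
      refine (Finset.abs_sum_le_sum_abs _ _).trans ?_
      have h3 : ∑ j, Φ i j ≤ φs := Finset.single_le_sum (f := fun i => ∑ j, Φ i j)
        (fun i _ => Finset.sum_nonneg fun j _ => hΦ0 i j) (Finset.mem_univ i)
      refine le_trans ?_ (mul_le_mul_of_nonneg_right
        (mul_le_mul_of_nonneg_left h3 (by positivity)) (sq_nonneg y))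
      rw [Finset.mul_sum, Finset.sum_mul]
      refine Finset.sum_le_sum fun j _ => ?_
      have h4 : s.mu i j ≤ μs + c := by
        have h5 := (abs_le.1 (hmu' i j)).2
        have h6 : F.mu i j ≤ ∑ j, F.mu i j := Finset.single_le_sum (f := fun j => F.mu i j)
          (fun j _ => F.mu_nonneg i j) (Finset.mem_univ j)
        have h7 : ∑ j, F.mu i j ≤ μs := Finset.single_le_sum (f := fun i => ∑ j, F.mu i j)
          (fun i _ => Finset.sum_nonneg fun j _ => F.mu_nonneg i j) (Finset.mem_univ i)
        linarith
      rw [abs_mul, abs_of_nonneg (s.mu_nonneg i j), Nat.abs_cast]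
      calc s.mu i j * (⌊y ^ 2 * Φ i j⌋₊ : ℝ) ≤ (μs + c) * (y ^ 2 * Φ i j) :=
            mul_le_mul h4 (hfl i j) (Nat.cast_nonneg _) (by positivity)
        _ = _ := by ring
    calc _ ≤ (Λ + c) * y ^ 2 + (μs + c) * φs * y ^ 2 := add_le_add h1 h2
      _ = _ := by ring
  · have h1 : ∑ i, s.lam i ≤ y ^ 2 * Λ + Fintype.card I * (c * y) := by
      have : ∑ i, s.lam i ≤ ∑ i, (y ^ 2 * F.lam i + c * y) :=
        Finset.sum_le_sum fun i _ => by linarith [(abs_le.1 (hs.lam i)).2]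
      rw [Finset.sum_add_distrib, ← Finset.mul_sum] at this
      simpa using this
    have h2 : ∀ i j, y ^ 2 * (F.mu i j * Φ i j) - F.mu i j - c * y * Φ i j
        ≤ s.mu i j * (⌊y ^ 2 * Φ i j⌋₊ : ℝ) := fun i j => by
      have h3 : F.mu i j * (y ^ 2 * Φ i j - 1) ≤ F.mu i j * (⌊y ^ 2 * Φ i j⌋₊ : ℝ) :=
        mul_le_mul_of_nonneg_left (by linarith [Nat.lt_floor_add_one (y ^ 2 * Φ i j)])
          (F.mu_nonneg i j)
      have h4 : |s.mu i j - F.mu i j| * (⌊y ^ 2 * Φ i j⌋₊ : ℝ) ≤ c * y * Φ i j := by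
        calc _ ≤ |s.mu i j - F.mu i j| * (y ^ 2 * Φ i j) :=
              mul_le_mul_of_nonneg_left (hfl i j) (abs_nonneg _)
          _ = (|s.mu i j - F.mu i j| * y) * (y * Φ i j) := by ring
          _ ≤ c * (y * Φ i j) :=
              mul_le_mul_of_nonneg_right (hs.mu i j) (mul_nonneg hy0.le (hΦ0 i j))
          _ = _ := by ring
      have h5 : -(|s.mu i j - F.mu i j| * (⌊y ^ 2 * Φ i j⌋₊ : ℝ))
          ≤ (s.mu i j - F.mu i j) * (⌊y ^ 2 * Φ i j⌋₊ : ℝ) := by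
        rw [← neg_mul]
        exact mul_le_mul_of_nonneg_right (neg_abs_le _) (Nat.cast_nonneg _)
      linarith
    have h3 : y ^ 2 * ((1 - θ) * V) - μs - c * y * φs
        ≤ ∑ i, ∑ j, s.mu i j * (⌊y ^ 2 * Φ i j⌋₊ : ℝ) := by
      refine le_trans (le_of_eq ?_)
        (Finset.sum_le_sum fun i _ => Finset.sum_le_sum fun j _ => h2 i j)
      simp_rw [Finset.sum_sub_distrib, ← Finset.mul_sum]
      rw [hΦV]
    rw [Finset.sum_sub_distrib]
    rw [div_le_iff₀ hg0] at hyq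
    have h4 : q * y ≤ g / 4 * y ^ 2 := by nlinarith
    have h5 : μs ≤ μs * y := le_mul_of_one_le_right hμs0 hy1
    have h6 : (1 - θ) * V = Λ + g / 2 := by rw [sub_mul, hθV, hg]; ring
    rw [h6] at h3
    rw [hq] at h4
    linarith

end Control

/-! ### The feedback function -/

/-- A feedback control that serves everybody when there are no more customers than servers, and
drains the system otherwise, as long as the state is close to the critical one. -/
lemma Fluid.IsCritical.exists_feedback {I J : Type*} [Fintype I] [Fintype J] {F : Fluid I J}
    {ξ : I → J → ℝ} (hcrit : F.IsCritical ξ) (hconn : (F.basicGraph ξ).Connected)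
    (hsub : F.ThroughputSuboptimal ξ) {c : ℝ} (hc : 0 ≤ c) (sys : ℕ+ → System I J)
    (hact : ∀ n i j, 0 < (sys n).mu i j ↔ 0 < F.mu i j)
    (hclose : ∀ n : ℕ+, IsClose F ξ c (√(n : ℝ)) (sys n)) :
    ∃ C δ η : ℝ, 0 ≤ C ∧ 0 < δ ∧ 0 < η ∧ ∃ f : ℕ+ → (I → ℕ) → I → J → ℕ,
      (∀ n x i j, (sys n).mu i j = 0 → f n x i j = 0) ∧ (∀ n x i, ∑ j, f n x i j ≤ x i) ∧
      (∀ n x j, ∑ i, f n x i j ≤ (sys n).servers j) ∧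
      ∀ᶠ n : ℕ+ in atTop, ∀ x : I → ℕ,
        ∑ i, |(x i : ℝ) - (n : ℝ) * F.mass ξ i| ≤ η * n →
        (∑ i, x i ≤ ∑ j, (sys n).servers j → (∀ i, ∑ j, f n x i j = x i) ∧
          ∀ i, |(sys n).lam i - ∑ j, (sys n).mu i j * f n x i j|
            ≤ C * (∑ i, |(x i : ℝ) - (n : ℝ) * F.mass ξ i| + √(n : ℝ))) ∧
        (∑ j, (sys n).servers j < ∑ i, x i →
          (∀ i, |(sys n).lam i - ∑ j, (sys n).mu i j * f n x i j| ≤ C * n) ∧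
          ∑ i, ((sys n).lam i - ∑ j, (sys n).mu i j * f n x i j) ≤ -δ * n) := by
  classical
  obtain ⟨C₁, η₁, hη₁, hC₁, h₁⟩ := hcrit.exists_full_service hconn hc
  obtain ⟨C₂, δ, η₂, hη₂, hδ, hC₂, h₂⟩ := hcrit.exists_draining hsub hc
  have hmu : ∀ n i j, (sys n).mu i j = 0 → F.mu i j = 0 := fun n i j h => by
    by_contra hne
    exact ((hact n i j).2 ((F.mu_nonneg i j).lt_of_ne' hne)).ne' h
  have hlim : Tendsto (fun n : ℕ+ => √(n : ℝ)) atTop atTop :=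
    Real.tendsto_sqrt_atTop.comp (tendsto_natCast_atTop_atTop.comp tendsto_PNat_val_atTop_atTop)
  obtain ⟨G, hGmem, hG⟩ := eventually_iff_exists_mem.1
    ((hlim.eventually h₁).and (hlim.eventually h₂))
  set good : ℕ+ → (I → ℕ) → (I → J → ℕ) → Prop := fun n x ψ =>
    ∑ i, |(x i : ℝ) - (n : ℝ) * F.mass ξ i| ≤ min η₁ η₂ * n →
        (∑ i, x i ≤ ∑ j, (sys n).servers j → (∀ i, ∑ j, ψ i j = x i) ∧
          ∀ i, |(sys n).lam i - ∑ j, (sys n).mu i j * ψ i j|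
            ≤ max C₁ C₂ * (∑ i, |(x i : ℝ) - (n : ℝ) * F.mass ξ i| + √(n : ℝ))) ∧
        (∑ j, (sys n).servers j < ∑ i, x i →
          (∀ i, |(sys n).lam i - ∑ j, (sys n).mu i j * ψ i j| ≤ max C₁ C₂ * n) ∧
          ∑ i, ((sys n).lam i - ∑ j, (sys n).mu i j * ψ i j) ≤ -δ * n) with hgood
  have key : ∀ n x, ∃ ψ : I → J → ℕ, ((∀ i j, (sys n).mu i j = 0 → ψ i j = 0) ∧
      (∀ i, ∑ j, ψ i j ≤ x i) ∧ (∀ j, ∑ i, ψ i j ≤ (sys n).servers j)) ∧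
      (n ∈ G → good n x ψ) := by
    intro n x
    have hsq : (√((n : ℕ) : ℝ)) ^ 2 = ((n : ℕ) : ℝ) := Real.sq_sqrt (by positivity)
    by_cases hx : ∑ i, |(x i : ℝ) - (n : ℝ) * F.mass ξ i| ≤ min η₁ η₂ * n
    · have hx1 : ∑ i, |(x i : ℝ) - (n : ℝ) * F.mass ξ i| ≤ η₁ * n :=
        hx.trans (mul_le_mul_of_nonneg_right (min_le_left _ _) (by positivity))
      have hx2 : ∑ i, |(x i : ℝ) - (n : ℝ) * F.mass ξ i| ≤ η₂ * n :=
        hx.trans (mul_le_mul_of_nonneg_right (min_le_right _ _) (by positivity))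
      by_cases hnG : n ∈ G
      · have hP := hG n hnG
        rw [hsq] at hP
        rcases le_or_gt (∑ i, x i) (∑ j, (sys n).servers j) with hle | hlt
        · obtain ⟨ψ, h0, hr, hcol, hd⟩ := hP.1 (sys n) (hclose n) x hx1 hle
          refine ⟨ψ, ⟨fun i j h => h0 i j (hmu n i j h), fun i => (hr i).le, hcol⟩, fun _ _ =>
            ⟨fun _ => ⟨hr, fun i => (hd i).trans ?_⟩, fun h => absurd h hle.not_gt⟩⟩
          exact mul_le_mul_of_nonneg_right (le_max_left _ _)
            (add_nonneg (Finset.sum_nonneg fun _ _ => abs_nonneg _) (Real.sqrt_nonneg _))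
        · obtain ⟨ψ, h0, hr, hcol, hd, hd'⟩ := hP.2 (sys n) (hclose n)
          refine ⟨ψ, ⟨fun i j h => h0 i j (hmu n i j h), hr x hx2, hcol⟩, fun _ _ =>
            ⟨fun h => absurd h hlt.not_ge, fun _ => ⟨fun i => (hd i).trans ?_, hd'⟩⟩⟩
          exact mul_le_mul_of_nonneg_right (le_max_right _ _) (by positivity)
      -- Outside `G`, and likewise far from the critical state, only admissibility is needed; the
      -- zero control is admissible.
      · exact ⟨0, ⟨by simp, by simp, by simp⟩, fun h => absurd h hnG⟩
    · exact ⟨0, ⟨by simp, by simp, by simp⟩, fun _ h => absurd h hx⟩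
  choose f hf hfg using key
  refine ⟨max C₁ C₂, δ, min η₁ η₂, hC₁.trans (le_max_left _ _), hδ, lt_min hη₁ hη₂, f,
    fun n x => (hf n x).1, fun n x => (hf n x).2.1, fun n x => (hf n x).2.2, ?_⟩
  filter_upwards [hGmem] with n hn x
  exact hfg n x hn

/-! ### Deterministic path estimates -/

/-- A Gronwall inequality for bounded, possibly discontinuous functions. -/
lemma le_of_le_add_integral {h : ℝ → ℝ} {a b M t : ℝ} (hb : 0 < b) (ht : 0 ≤ t)
    (hint : IntervalIntegrable h volume 0 t) (hM : ∀ s ∈ Set.Ico 0 t, h s ≤ M) (ha : 0 ≤ a)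
    (hM0 : 0 ≤ M) (hle : ∀ u ∈ Set.Icc 0 t, h u ≤ a + b * ∫ s in (0 : ℝ)..u, h s) :
    ∀ u ∈ Set.Icc 0 t, h u ≤ 2 * a * Real.exp (2 * b * u) := by
  -- With the rate `2 * b` in the exponent, the integral term halves a bound `Q`, so iterating `Q ↦
  -- a + Q / 2` leads to `2 * a`. A bound on `[0, t)` already yields one at `t` itself, which
  -- matters when `t` is a first exit time.
  have step : ∀ Q, 0 ≤ Q → (∀ s ∈ Set.Ico 0 t, h s ≤ Q * Real.exp (2 * b * s)) →
      ∀ u ∈ Set.Icc 0 t, h u ≤ (a + Q / 2) * Real.exp (2 * b * u) := by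
    intro Q hQ hs u hu
    have h1 : ∫ s in (0 : ℝ)..u, h s ≤ ∫ s in (0 : ℝ)..u, Q * Real.exp (2 * b * s) := by
      refine intervalIntegral.integral_mono_on_of_le_Ioo hu.1
        (hint.mono_set ?_) (Continuous.intervalIntegrable (by fun_prop) _ _) fun s hs' => ?_
      · rw [Set.uIcc_of_le hu.1, Set.uIcc_of_le ht]; exact Set.Icc_subset_Icc le_rfl hu.2
      · exact hs s ⟨hs'.1.le, hs'.2.trans_le hu.2⟩
    have h2 : ∫ s in (0 : ℝ)..u, Q * Real.exp (2 * b * s)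
        = Q / (2 * b) * (Real.exp (2 * b * u) - 1) := by
      rw [intervalIntegral.integral_const_mul, intervalIntegral.integral_comp_mul_left
        (fun x => Real.exp x) (by positivity), integral_exp]
      simp only [mul_zero, Real.exp_zero, smul_eq_mul]
      field_simp
    have h3 := hle u hu
    have h4 : 1 ≤ Real.exp (2 * b * u) := Real.one_le_exp (by have := hu.1; positivity)
    have h5 : b * ∫ s in (0 : ℝ)..u, h s ≤ Q / 2 * (Real.exp (2 * b * u) - 1) := by
      calc _ ≤ b * (Q / (2 * b) * (Real.exp (2 * b * u) - 1)) :=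
            mul_le_mul_of_nonneg_left (h1.trans h2.le) hb.le
        _ = _ := by field_simp
    nlinarith
  have iter : ∀ k : ℕ, ∀ s ∈ Set.Ico 0 t,
      h s ≤ (2 * a + M / 2 ^ k) * Real.exp (2 * b * s) := by
    intro k
    induction k with
    | zero =>
      intro s hs
      have h4 : 1 ≤ Real.exp (2 * b * s) := Real.one_le_exp (by have := hs.1; positivity)
      have := hM s hs
      simp only [pow_zero, div_one]
      nlinarith
    | succ k ih =>
      intro s hs
      refine (step _ (by positivity) ih s ⟨hs.1, hs.2.le⟩).trans (le_of_eq ?_)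
      rw [pow_succ]; ring
  intro u hu
  have h1 : ∀ k : ℕ, h u ≤ (2 * a + M / 2 * (1 / 2) ^ k) * Real.exp (2 * b * u) := fun k => by
    refine (step _ (by positivity) (iter k) u hu).trans (le_of_eq ?_)
    rw [one_div, inv_pow]; ring
  have h2 : Tendsto (fun k : ℕ => (2 * a + M / 2 * (1 / 2 : ℝ) ^ k) * Real.exp (2 * b * u)) atTop
      (𝓝 ((2 * a + M / 2 * 0) * Real.exp (2 * b * u))) :=
    ((tendsto_const_nhds.add (tendsto_const_nhds.mul
      (tendsto_pow_atTop_nhds_zero_of_lt_one (by norm_num) (by norm_num)))).mul_const _)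
  have h3 := ge_of_tendsto' h2 h1
  simpa using h3

/-- If the time spent in `O` up to the points of `O` is controlled, then so is the time spent in
`O` up to any time. -/
lemma integral_indicator_le_of_mem {O : Set ℝ} (hO : MeasurableSet O) {u G : ℝ} (hu : 0 ≤ u)
    (hG : 0 ≤ G) (h : ∀ s ∈ O ∩ Set.Icc 0 u, ∫ r in (0 : ℝ)..s, O.indicator 1 r ≤ G) :
    ∫ r in (0 : ℝ)..u, O.indicator (1 : ℝ → ℝ) r ≤ G := by
  have hint : ∀ a b, IntervalIntegrable (O.indicator (1 : ℝ → ℝ)) volume a b := fun a b => by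
    rw [intervalIntegrable_iff]
    exact (integrableOn_const (C := (1 : ℝ)) (by simp)).indicator hO
  rcases (O ∩ Set.Icc 0 u).eq_empty_or_nonempty with hE | hne
  · have : ∫ r in (0 : ℝ)..u, O.indicator (1 : ℝ → ℝ) r = ∫ r in (0 : ℝ)..u, 0 := by
      refine intervalIntegral.integral_congr fun r hr => ?_
      rw [Set.uIcc_of_le hu] at hr
      exact Set.indicator_of_notMem (fun h => by
        have : r ∈ O ∩ Set.Icc 0 u := ⟨h, hr⟩
        rw [hE] at this; exact this) _
    rw [this]; simpa using hG
  · have hbdd : BddAbove (O ∩ Set.Icc 0 u) := ⟨u, fun r hr => hr.2.2⟩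
    -- No time is spent in `O` between `t` and `u`, and points of `O` come within `ε` of `t`.
    set t := sSup (O ∩ Set.Icc 0 u) with ht
    have htu : t ≤ u := csSup_le hne fun r hr => hr.2.2
    refine le_of_forall_pos_le_add fun ε hε => ?_
    obtain ⟨s, hs, hst⟩ := exists_lt_of_lt_csSup hne (show t - ε < t by linarith)
    have hst' : s ≤ t := le_csSup hbdd hs
    rw [← intervalIntegral.integral_add_adjacent_intervals (hint 0 s) (hint s u),
      ← intervalIntegral.integral_add_adjacent_intervals (hint s t) (hint t u)]
    have h1 : ∫ r in s..t, O.indicator (1 : ℝ → ℝ) r ≤ ∫ r in s..t, (1 : ℝ) :=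
      intervalIntegral.integral_mono_on hst' (hint s t) intervalIntegrable_const fun r _ =>
        Set.indicator_le_self' (fun _ _ => zero_le_one) r
    have h2 : ∫ r in t..u, O.indicator (1 : ℝ → ℝ) r = 0 := by
      refine intervalIntegral.integral_zero_ae (Eventually.of_forall fun r hr => ?_)
      rw [Set.uIoc_of_le htu] at hr
      refine Set.indicator_of_notMem (fun h => ?_) _
      exact absurd (le_csSup hbdd ⟨h, (hs.2.1.trans (hst'.trans hr.1.le)), hr.2⟩) hr.1.not_ge
    rw [intervalIntegral.integral_const, smul_eq_mul, mul_one] at h1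
    have := h s hs
    linarith

/-- The deterministic estimate behind the draining policy: a path whose drift is Lipschitz outside
the set `O`, and which is pushed strongly below the level `m` on `O`, stays close to `xs` and
spends little time in `O`, if its noise `e` is small. -/
lemma path_estimate (I : Type*) [Fintype I] {C δ T : ℝ} (hC : 0 ≤ C) (hδ : 0 < δ) (hT : 0 ≤ T) :
    ∃ K, 0 < K ∧ ∀ (x e D : I → ℝ → ℝ) (x0 xs : I → ℝ) (m E n B : ℝ) (O : Set ℝ),
      0 ≤ E → 0 < n → MeasurableSet O → K * E ≤ B →
      ∑ i, |x0 i - xs i| ≤ E → ∑ i, x0 i - m ≤ E →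
      (∀ i, ∀ t ∈ Set.Icc 0 T, |e i t| ≤ E) →
      (∀ i, ∀ t ∈ Set.Icc 0 T, x i t = x0 i + e i t + ∫ s in (0 : ℝ)..t, D i s) →
      (∀ i, IntervalIntegrable (D i) volume 0 T) →
      IntervalIntegrable (fun t => ∑ i, |x i t - xs i|) volume 0 T →
      (∀ t ∈ Set.Ico 0 T, ∑ i, |x i t - xs i| ≤ B →
        ∀ᶠ s in 𝓝[>] t, ∑ i, |x i s - xs i| ≤ B) →
      (∀ t ∈ Set.Icc 0 T, ∑ i, |x i t - xs i| ≤ B → t ∉ O →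
        ∀ i, |D i t| ≤ C * (∑ i, |x i t - xs i| + E)) →
      (∀ t ∈ Set.Icc 0 T, ∑ i, |x i t - xs i| ≤ B → t ∈ O →
        (∀ i, |D i t| ≤ C * n) ∧ ∑ i, D i t ≤ -δ * n) →
      (∀ t ∈ Set.Icc 0 T, t ∈ O → m ≤ ∑ i, x i t) →
      (∀ t ∈ Set.Icc 0 T, ∑ i, |x i t - xs i| ≤ K * E) ∧
        volume (O ∩ Set.Icc 0 T) ≤ ENNReal.ofReal (K * E / n) := by
  set k : ℝ := (Fintype.card I : ℝ) with hk
  have hk0 : 0 ≤ k := Nat.cast_nonneg _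
  -- The three terms account for the initial error, the noise of the `k` classes, and the error `E`
  -- in the drift bound off `O`.
  set p : ℝ := 1 + k + k * C * T with hp
  have hp0 : 0 < p := by positivity
  -- The second term is the effect of the time in `O` on the deviation: drift `C * n` in `k`
  -- classes, for a duration controlled through the draining rate `δ * n`.
  set r : ℝ := 1 + k * C / δ with hr
  have hr0 : 0 < r := by positivity
  set b : ℝ := r * (k * C) + 1 with hb
  have hb0 : 0 < b := by positivity
  set K₁ : ℝ := 2 * (r * p) * Real.exp (2 * b * T) with hK₁
  have hK₁0 : 0 < K₁ := by positivity
  set K₂ : ℝ := (p + k * C * (T * K₁)) / δ with hK₂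
  have hK₂0 : 0 ≤ K₂ := by positivity
  refine ⟨K₁ + K₂, by positivity, ?_⟩
  intro x e D x0 xs m E n B O hE hn hO hKB hx0 hm he hx hD hh hright hoff hon hOm
  set h : ℝ → ℝ := fun t => ∑ i, |x i t - xs i| with hhdef
  have hh0 : ∀ t, 0 ≤ h t := fun t => Finset.sum_nonneg fun _ _ => abs_nonneg _
  have hB0 : 0 ≤ B := le_trans (by positivity) hKB
  have hO_int : ∀ a b, IntervalIntegrable (O.indicator (1 : ℝ → ℝ)) volume a b := fun a b => by
    rw [intervalIntegrable_iff]
    exact (integrableOn_const (C := (1 : ℝ)) (by simp)).indicator hO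
  have sub : ∀ {f : ℝ → ℝ} {u}, u ∈ Set.Icc 0 T → IntervalIntegrable f volume 0 T →
      IntervalIntegrable f volume 0 u := fun {f u} hu hf => hf.mono_set (by
    rw [Set.uIcc_of_le hu.1, Set.uIcc_of_le hT]; exact Set.Icc_subset_Icc le_rfl hu.2)
  -- The a priori bound `B` is assumed only strictly before `t`, while the conclusion includes `t`.
  have core : ∀ t ∈ Set.Icc 0 T, (∀ s ∈ Set.Ico 0 t, h s ≤ B) →
      (∀ u ∈ Set.Icc 0 t, h u ≤ K₁ * E) ∧
      n * ∫ s in (0 : ℝ)..t, O.indicator (1 : ℝ → ℝ) s ≤ K₂ * E := by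
    intro t ht hB
    set H : ℝ → ℝ := fun u => ∫ s in (0 : ℝ)..u, h s with hH
    set L : ℝ → ℝ := fun u => ∫ s in (0 : ℝ)..u, O.indicator (1 : ℝ → ℝ) s with hL
    have hH0 : ∀ u, 0 ≤ u → 0 ≤ H u := fun u hu =>
      intervalIntegral.integral_nonneg hu fun s _ => hh0 s
    have hHmono : ∀ s u, 0 ≤ s → s ≤ u → u ≤ t → H s ≤ H u := fun s u h0 hsu hut =>
      intervalIntegral.integral_mono_interval le_rfl h0 hsu
        (Eventually.of_forall hh0) (sub ⟨h0.trans hsu, hut.trans ht.2⟩ hh)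
    have huT : ∀ u ∈ Set.Icc 0 t, u ∈ Set.Icc 0 T := fun u hu => ⟨hu.1, hu.2.trans ht.2⟩
    -- A common form for the drift majorants: `c = k`, `d = -(δ * n)` for the total population, and
    -- `c = 1`, `d = C * n` for a single class. Keeping the first term on `O` as well only weakens
    -- the bound.
    have hI : ∀ u ∈ Set.Icc 0 t, ∀ c d : ℝ,
        IntervalIntegrable (fun s => C * (h s + E) * c + O.indicator 1 s * d) volume 0 u ∧
        ∫ s in (0 : ℝ)..u, (C * (h s + E) * c + O.indicator 1 s * d)
          = C * (H u + u * E) * c + L u * d := by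
      intro u hu c d
      have i1 := sub (huT u hu) hh
      have i2 : IntervalIntegrable (fun s => C * (h s + E) * c) volume 0 u :=
        (((i1.add intervalIntegrable_const).const_mul C).mul_const c)
      have i3 : IntervalIntegrable (fun s => O.indicator 1 s * d) volume 0 u :=
        (hO_int 0 u).mul_const d
      refine ⟨i2.add i3, ?_⟩
      rw [intervalIntegral.integral_add i2 i3, intervalIntegral.integral_mul_const,
        intervalIntegral.integral_mul_const, intervalIntegral.integral_const_mul,
        intervalIntegral.integral_add i1 intervalIntegrable_const, intervalIntegral.integral_const]
      simp [hH, hL]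
    have htot : ∀ u ∈ Set.Icc 0 t, ∑ i, x i u - m ≤ p * E + k * C * H u - δ * n * L u := by
      intro u hu
      have h1 : ∑ i, x i u = ∑ i, x0 i + ∑ i, e i u + ∫ s in (0 : ℝ)..u, ∑ i, D i s := by
        rw [intervalIntegral.integral_finsetSum fun i _ => sub (huT u hu) (hD i),
          ← Finset.sum_add_distrib, ← Finset.sum_add_distrib]
        exact Finset.sum_congr rfl fun i _ => hx i u (huT u hu)
      have h2 : ∑ i, e i u ≤ k * E := by
        refine (Finset.sum_le_sum fun i _ => (le_abs_self _).trans (he i u (huT u hu))).trans ?_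
        simp [hk]
      have h3 : ∫ s in (0 : ℝ)..u, ∑ i, D i s
          ≤ C * (H u + u * E) * k + L u * (-(δ * n)) := by
        have hsum : IntervalIntegrable (fun s => ∑ i, D i s) volume 0 u := by
          have := IntervalIntegrable.sum Finset.univ fun i _ => sub (huT u hu) (hD i)
          rwa [show ∑ i, D i = fun s => ∑ i, D i s from funext fun s => by simp] at this
        rw [← (hI u hu k (-(δ * n))).2]
        refine intervalIntegral.integral_mono_on_of_le_Ioo hu.1
          hsum (hI u hu _ _).1
          fun s hs => ?_
        have hsT : s ∈ Set.Icc 0 T := ⟨hs.1.le, hs.2.le.trans (hu.2.trans ht.2)⟩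
        have hsB := hB s ⟨hs.1.le, hs.2.trans_le hu.2⟩
        have hpos : 0 ≤ C * (h s + E) * k := by have := hh0 s; positivity
        by_cases hsO : s ∈ O
        · rw [Set.indicator_of_mem hsO]
          have := (hon s hsT hsB hsO).2
          simp only [Pi.one_apply]
          linarith
        · rw [Set.indicator_of_notMem hsO, zero_mul, add_zero]
          have : ∑ i, D i s ≤ ∑ i : I, C * (h s + E) := Finset.sum_le_sum fun i _ =>
            (le_abs_self _).trans (hoff s hsT hsB hsO i)
          refine le_trans (by simp) (this.trans (le_of_eq ?_))
          simp [hk]; ring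
      have h4 : C * (u * E) * k ≤ C * (T * E) * k := by
        have := hu.2.trans ht.2; gcongr
      rw [hp]
      linarith
    have hpE : 0 ≤ p * E := by positivity
    have hLle : ∀ u ∈ Set.Icc 0 t, δ * n * L u ≤ p * E + k * C * H u := by
      intro u hu
      have hG0 : 0 ≤ p * E + k * C * H u := by have := hH0 u hu.1; positivity
      have : L u ≤ (p * E + k * C * H u) / (δ * n) := by
        -- At points of `O` the total population is at least `m`, so `htot` bounds the time spent in
        -- `O`. This extends to all times because that time does not grow off `O`.
        refine integral_indicator_le_of_mem hO hu.1 (by positivity) fun s hs => ?_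
        rw [le_div_iff₀' (by positivity)]
        have hst : s ∈ Set.Icc 0 t := ⟨hs.2.1, hs.2.2.trans hu.2⟩
        have h1 := htot s hst
        have h2 := hOm s (huT s hst) hs.1
        have h3 : k * C * H s ≤ k * C * H u :=
          mul_le_mul_of_nonneg_left (hHmono s u hs.2.1 hs.2.2 hu.2) (by positivity)
        show δ * n * L s ≤ _
        linarith
      rwa [le_div_iff₀' (by positivity)] at this
    have hgr : ∀ u ∈ Set.Icc 0 t, h u ≤ r * p * E + b * H u := by
      intro u hu
      have h1 : ∀ i, |x i u - xs i| ≤ |x0 i - xs i| + E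
          + (C * (H u + u * E) * 1 + L u * (C * n)) := by
        intro i
        rw [hx i u (huT u hu)]
        have h2 : |∫ s in (0 : ℝ)..u, D i s| ≤ C * (H u + u * E) * 1 + L u * (C * n) := by
          refine (intervalIntegral.abs_integral_le_integral_abs hu.1).trans ?_
          rw [← (hI u hu 1 (C * n)).2]
          refine intervalIntegral.integral_mono_on_of_le_Ioo hu.1
            (sub (huT u hu) (hD i)).abs (hI u hu _ _).1 fun s hs => ?_
          have hsT : s ∈ Set.Icc 0 T := ⟨hs.1.le, hs.2.le.trans (hu.2.trans ht.2)⟩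
          have hsB := hB s ⟨hs.1.le, hs.2.trans_le hu.2⟩
          have hpos : 0 ≤ C * (h s + E) := by have := hh0 s; positivity
          by_cases hsO : s ∈ O
          · rw [Set.indicator_of_mem hsO]
            have := (hon s hsT hsB hsO).1 i
            simp only [Pi.one_apply]
            linarith
          · rw [Set.indicator_of_notMem hsO, zero_mul, add_zero, mul_one]
            exact hoff s hsT hsB hsO i
        have h3 : x0 i + e i u + (∫ s in (0 : ℝ)..u, D i s) - xs i
            = (x0 i - xs i) + e i u + ∫ s in (0 : ℝ)..u, D i s := by ring
        rw [h3]
        exact (abs_add_le _ _).trans (add_le_add ((abs_add_le _ _).trans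
          (add_le_add le_rfl (he i u (huT u hu)))) h2)
      have h2 : h u ≤ E + k * E + k * (C * (H u + u * E) + L u * (C * n)) := by
        refine (Finset.sum_le_sum fun i _ => h1 i).trans ?_
        rw [Finset.sum_add_distrib, Finset.sum_add_distrib]
        simp only [Finset.sum_const, Finset.card_univ, nsmul_eq_mul, mul_one, ← hk]
        linarith
      have h4 : C * (u * E) * k ≤ C * (T * E) * k := by
        have := hu.2.trans ht.2; gcongr
      have h5 := hLle u hu
      have h6 : k * C * (n * L u) ≤ (r - 1) * (p * E + k * C * H u) := by
        have : k * C * (n * L u) = k * C / δ * (δ * n * L u) := by field_simp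
        rw [this, hr, add_sub_cancel_left]
        exact mul_le_mul_of_nonneg_left h5 (by positivity)
      have h7 := hH0 u hu.1
      have h8 : E + k * E + k * (C * (H u + T * E)) = p * E + k * C * H u := by rw [hp]; ring
      rw [hb]
      linarith
    have hbound : ∀ u ∈ Set.Icc 0 t, h u ≤ K₁ * E := by
      intro u hu
      refine (le_of_le_add_integral hb0 ht.1 (sub ht hh) hB (by positivity) hB0 hgr u hu).trans ?_
      have h1 : Real.exp (2 * b * u) ≤ Real.exp (2 * b * T) := by
        have := hu.2.trans ht.2; gcongr
      calc 2 * (r * p * E) * Real.exp (2 * b * u) ≤ 2 * (r * p * E) * Real.exp (2 * b * T) := by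
            gcongr
        _ = K₁ * E := by rw [hK₁]; ring
    refine ⟨hbound, ?_⟩
    have h1 : H t ≤ T * (K₁ * E) := by
      have h2 : H t ≤ ∫ s in (0 : ℝ)..t, K₁ * E :=
        intervalIntegral.integral_mono_on ht.1 (sub ht hh) intervalIntegrable_const hbound
      rw [intervalIntegral.integral_const, smul_eq_mul, sub_zero] at h2
      exact h2.trans (mul_le_mul_of_nonneg_right ht.2 (by positivity))
    have h2 := hLle t ⟨ht.1, le_rfl⟩
    have h3 : k * C * H t ≤ k * C * (T * (K₁ * E)) := by gcongr
    rw [hK₂, div_mul_eq_mul_div, le_div_iff₀ hδ]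
    linarith
  have hK₁E : K₁ * E ≤ B := le_trans (by gcongr; linarith) hKB
  -- At the infimum `t` of the times with `h > B`, `core` still gives `h t ≤ K₁ * E ≤ B`, and
  -- `hright` preserves the bound shortly after `t`, so `t` could not be the infimum.
  have hall : ∀ t ∈ Set.Icc 0 T, h t ≤ B := by
    by_contra hcon
    push Not at hcon
    set V := {t | t ∈ Set.Icc 0 T ∧ B < h t} with hV
    have hVne : V.Nonempty := by
      obtain ⟨t, ht, hlt⟩ := hcon
      exact ⟨t, ht, hlt⟩
    have hVb : BddBelow V := ⟨0, fun t ht => ht.1.1⟩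
    set t := sInf V with ht
    have ht0 : 0 ≤ t := le_csInf hVne fun s hs => hs.1.1
    have htT : t ≤ T := (csInf_le hVb hVne.some_mem).trans hVne.some_mem.1.2
    have hlt : ∀ s ∈ Set.Ico 0 t, h s ≤ B := fun s hs => by
      by_contra hs'
      exact absurd (csInf_le hVb (show s ∈ V from ⟨⟨hs.1, hs.2.le.trans htT⟩, not_le.1 hs'⟩))
        hs.2.not_ge
    have htB : h t ≤ B := ((core t ⟨ht0, htT⟩ hlt).1 t ⟨ht0, le_rfl⟩).trans hK₁E
    have hgt : ∀ v ∈ V, t < v := fun v hv => (csInf_le hVb hv).lt_of_ne fun heq => by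
      rw [← heq] at hv; exact hv.2.not_ge htB
    have htT' : t < T := (hgt _ hVne.some_mem).trans_le hVne.some_mem.1.2
    obtain ⟨u, hu, hsub⟩ := (mem_nhdsGT_iff_exists_Ioo_subset).1 (hright t ⟨ht0, htT'⟩ htB)
    obtain ⟨v, hv, hvu⟩ := exists_lt_of_csInf_lt hVne hu
    exact hv.2.not_ge (hsub ⟨hgt v hv, hvu⟩)
  obtain ⟨h1, h2⟩ := core T ⟨hT, le_rfl⟩ fun s hs => hall s ⟨hs.1, hs.2.le⟩
  refine ⟨fun t ht => (h1 t ht).trans (by gcongr; linarith), ?_⟩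
  have h3 : ∫ s in (0 : ℝ)..T, O.indicator (1 : ℝ → ℝ) s = volume.real (O ∩ Set.Ioc 0 T) := by
    rw [intervalIntegral.integral_of_le hT, integral_indicator_one hO]
    simp [Measure.real, Measure.restrict_apply hO]
  have h4 : volume (O ∩ Set.Icc 0 T) ≤ volume (O ∩ Set.Ioc 0 T) := by
    refine (measure_mono (t := {0} ∪ (O ∩ Set.Ioc 0 T)) fun s hs => ?_).trans
      ((measure_union_le _ _).trans (by simp))
    rcases hs.2.1.eq_or_lt with h | h
    · exact Or.inl h.symm
    · exact Or.inr ⟨hs.1, h, hs.2.2⟩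
  refine h4.trans ?_
  have hfin : volume (O ∩ Set.Ioc 0 T) ≠ ⊤ :=
    ne_top_of_le_ne_top (by simp) (measure_mono Set.inter_subset_right)
  rw [← ENNReal.ofReal_toReal hfin]
  refine ENNReal.ofReal_le_ofReal ?_
  rw [le_div_iff₀' hn]
  rw [h3] at h2
  refine h2.trans (by gcongr; linarith)

/-! ### Counting processes with state dependent speeds -/

section Clocks

variable {K : Type*}

/-- State of a system of clocks after some number of events: internal times of the clocks,
numbers of events, and physical time. -/
abbrev ClockState (K : Type*) := (K → ℝ≥0∞) × (K → ℕ) × ℝ≥0∞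

/-- The physical time until the next event, if clock `κ` runs at speed `r n κ` and rings at
the internal times `σ κ 0, σ κ 1, …`. -/
noncomputable def clockGap (r : (K → ℕ) → K → ℕ) (σ : K → ℕ → ℝ≥0∞) (s : ClockState K) : ℝ≥0∞ :=
  ⨅ κ, (σ κ (s.2.1 κ) - s.1 κ) / (r s.2.1 κ : ℝ≥0∞)

/-- The state after the next event. -/
noncomputable def clockStep (r : (K → ℕ) → K → ℕ) (σ : K → ℕ → ℝ≥0∞) (s : ClockState K) :
    ClockState K :=
  (fun κ => s.1 κ + r s.2.1 κ * clockGap r σ s,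
    fun κ => if σ κ (s.2.1 κ) ≤ s.1 κ + r s.2.1 κ * clockGap r σ s then s.2.1 κ + 1 else s.2.1 κ,
    s.2.2 + clockGap r σ s)

/-- The state after `k` events. -/
noncomputable def clockIter (r : (K → ℕ) → K → ℕ) (σ : K → ℕ → ℝ≥0∞) : ℕ → ClockState K
  | 0 => (0, 0, 0)
  | k + 1 => clockStep r σ (clockIter r σ k)

/-- The conditions on the ringing times of the clocks: they are positive, strictly increasing, and
their counting functions are `N`. -/
structure IsClockSystem (σ : K → ℕ → ℝ≥0∞) (N : K → ℝ≥0 → ℕ) : Prop where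
  count : ∀ κ m (u : ℝ≥0), σ κ m ≤ u ↔ m < N κ u
  pos : ∀ κ, 0 < σ κ 0
  strict : ∀ κ m, σ κ m ≠ ⊤ → σ κ m < σ κ (m + 1)

/-- A state in which every clock has recorded exactly the rings up to its internal time. -/
structure ClockState.IsConsistent (σ : K → ℕ → ℝ≥0∞) (s : ClockState K) : Prop where
  lt : ∀ κ, s.1 κ < σ κ (s.2.1 κ)
  le : ∀ κ, ∀ m < s.2.1 κ, σ κ m ≤ s.1 κ

variable {r : (K → ℕ) → K → ℕ} {σ : K → ℕ → ℝ≥0∞} {N : K → ℝ≥0 → ℕ}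

lemma IsClockSystem.count_eq (h : IsClockSystem σ N) {s : ClockState K} (hs : s.IsConsistent σ)
    (κ : K) (u : ℝ≥0) (hu : s.1 κ ≤ u) (hu' : (u : ℝ≥0∞) < σ κ (s.2.1 κ)) :
    N κ u = s.2.1 κ := by
  apply le_antisymm
  · by_contra hlt
    exact hu'.not_ge ((h.count κ _ u).2 (not_le.1 hlt))
  · by_contra hlt
    rw [not_le] at hlt
    have := (h.count κ (N κ u) u).1 ((hs.le κ _ hlt).trans hu)
    exact lt_irrefl _ this

/-- The gap is the least waiting time, so no clock passes its next ring; a clock of speed zero does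
not move. -/
lemma ClockState.IsConsistent.clock_add_le {s : ClockState K} (hs : s.IsConsistent σ) (κ : K) :
    s.1 κ + r s.2.1 κ * clockGap r σ s ≤ σ κ (s.2.1 κ) := by
  by_cases hr : r s.2.1 κ = 0
  · simpa [hr] using (hs.lt κ).le
  · have h1 : clockGap r σ s ≤ (σ κ (s.2.1 κ) - s.1 κ) / (r s.2.1 κ : ℝ≥0∞) := iInf_le _ κ
    rw [ENNReal.le_div_iff_mul_le (Or.inl (by exact_mod_cast hr))
      (Or.inl (ENNReal.natCast_ne_top _)), mul_comm] at h1
    calc _ ≤ s.1 κ + (σ κ (s.2.1 κ) - s.1 κ) := by gcongr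
      _ = _ := add_tsub_cancel_of_le (hs.lt κ).le

lemma ClockState.IsConsistent.clock_add_lt {s : ClockState K} (hs : s.IsConsistent σ) (κ : K)
    {d : ℝ≥0∞} (hd : d < clockGap r σ s) :
    s.1 κ + r s.2.1 κ * d < σ κ (s.2.1 κ) := by
  by_cases hr : r s.2.1 κ = 0
  · simpa [hr] using hs.lt κ
  · have h1 : d < (σ κ (s.2.1 κ) - s.1 κ) / (r s.2.1 κ : ℝ≥0∞) := hd.trans_le (iInf_le _ κ)
    rw [ENNReal.lt_div_iff_mul_lt (Or.inl (by exact_mod_cast hr))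
      (Or.inl (ENNReal.natCast_ne_top _)), mul_comm] at h1
    calc _ < s.1 κ + (σ κ (s.2.1 κ) - s.1 κ) :=
          ENNReal.add_lt_add_left (hs.lt κ).ne_top h1
      _ = _ := add_tsub_cancel_of_le (hs.lt κ).le

lemma ClockState.IsConsistent.speed_pos {s : ClockState K} (hs : s.IsConsistent σ) {κ : K}
    (hκ : σ κ (s.2.1 κ) ≤ s.1 κ + r s.2.1 κ * clockGap r σ s) : 0 < r s.2.1 κ := by
  by_contra hr
  have hr0 : r s.2.1 κ = 0 := by omega
  rw [hr0] at hκ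
  simp only [Nat.cast_zero, zero_mul, add_zero] at hκ
  exact (hs.lt κ).not_ge hκ

/-- A clock counted in this step sits exactly at its ringing time, and `strict` puts its following
ring later. Hence one event per clock suffices, while simultaneous rings of different clocks are all
recorded. An infinite gap means that nothing rings any more, and such states are excluded. -/
lemma IsClockSystem.isConsistent_step (h : IsClockSystem σ N) {s : ClockState K}
    (hs : s.IsConsistent σ) (hfin : clockGap r σ s ≠ ⊤) :
    (clockStep r σ s).IsConsistent σ := by
  have hb : ∀ κ, s.1 κ + r s.2.1 κ * clockGap r σ s ≠ ⊤ := fun κ =>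
    ENNReal.add_ne_top.2 ⟨(hs.lt κ).ne_top, ENNReal.mul_ne_top (ENNReal.natCast_ne_top _) hfin⟩
  constructor
  · intro κ
    simp only [clockStep]
    split_ifs with hκ
    · have heq := le_antisymm (hs.clock_add_le (r := r) κ) hκ
      rw [heq]
      exact h.strict κ _ (heq ▸ hb κ)
    · exact not_le.1 hκ
  · intro κ m hm
    simp only [clockStep] at hm ⊢
    have hle : m < s.2.1 κ → σ κ m ≤ s.1 κ + r s.2.1 κ * clockGap r σ s := fun hm =>
      (hs.le κ m hm).trans le_self_add
    split_ifs at hm with hκ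
    · rcases Nat.lt_succ_iff_lt_or_eq.1 hm with hm | rfl
      · exact hle hm
      · exact hκ
    · exact hle hm

lemma IsClockSystem.isConsistent_iter (h : IsClockSystem σ N) (k : ℕ)
    (hk : (clockIter r σ k).2.2 ≠ ⊤) : (clockIter r σ k).IsConsistent σ := by
  induction k with
  | zero => exact ⟨h.pos, fun κ m hm => absurd hm (Nat.not_lt_zero m)⟩
  | succ k ih =>
    have hk' := ENNReal.add_ne_top.1 hk
    exact h.isConsistent_step (ih hk'.1) hk'.2

lemma clockIter_le {R : ℕ} (hR : ∀ n κ, r n κ ≤ R) (k : ℕ) (κ : K) :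
    (clockIter r σ k).1 κ ≤ R * (clockIter r σ k).2.2 := by
  induction k with
  | zero => simp [clockIter]
  | succ k ih =>
    simp only [clockIter, clockStep, mul_add]
    gcongr
    exact_mod_cast hR _ κ

lemma clockIter_time_mono : Monotone fun k => (clockIter r σ k).2.2 :=
  monotone_nat_of_le_succ fun _ => le_self_add

lemma exists_clock_interval
    (hex : ∀ t : ℝ≥0, ∃ k, (t : ℝ≥0∞) < (clockIter r σ (k + 1)).2.2) (t : ℝ≥0) : ∃ k, (clockIter r σ k).2.2 ≤ t ∧
    (t : ℝ≥0∞) < (clockIter r σ (k + 1)).2.2 := by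
  refine ⟨Nat.find (hex t), ?_, Nat.find_spec (hex t)⟩
  rcases hk : Nat.find (hex t) with _ | k
  · simp [clockIter]
  · have := Nat.find_min (hex t) (show k < Nat.find (hex t) by omega)
    exact not_lt.1 this

/-- The numbers of events recorded at the physical time `t`. -/
noncomputable def clockCount (r : (K → ℕ) → K → ℕ) (σ : K → ℕ → ℝ≥0∞)
    (hex : ∀ t : ℝ≥0, ∃ k, (t : ℝ≥0∞) < (clockIter r σ (k + 1)).2.2) (t : ℝ≥0) : K → ℕ :=
  (clockIter r σ (Nat.find (hex t))).2.1

variable (hex : ∀ t : ℝ≥0, ∃ k, (t : ℝ≥0∞) < (clockIter r σ (k + 1)).2.2)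

lemma clockCount_eq (t : ℝ≥0) (k : ℕ) (h1 : (clockIter r σ k).2.2 ≤ t)
    (h2 : (t : ℝ≥0∞) < (clockIter r σ (k + 1)).2.2) :
    clockCount r σ hex t = (clockIter r σ k).2.1 := by
  classical
  have : Nat.find (hex t) = k := by
    rw [Nat.find_eq_iff]
    refine ⟨h2, fun m hm hlt => ?_⟩
    exact (hlt.trans_le ((clockIter_time_mono (by omega : m + 1 ≤ k)).trans h1)).false
  rw [clockCount, ← this]

lemma measurable_clockCount : Measurable (clockCount r σ hex) := by
  classical
  exact Measurable.find (f := fun k (_ : ℝ≥0) => (clockIter r σ k).2.1)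
    (p := fun k (t : ℝ≥0) => (t : ℝ≥0∞) < (clockIter r σ (k + 1)).2.2)
    (fun _ => measurable_const) (fun k => measurableSet_lt (by fun_prop) measurable_const) hex

lemma clockCount_rightContinuous (t : ℝ≥0) :
    ContinuousWithinAt (clockCount r σ hex) (Set.Ici t) t := by
  obtain ⟨k, h1, h2⟩ := exists_clock_interval hex t
  have hev : ∀ᶠ s : ℝ≥0 in 𝓝[≥] t, clockCount r σ hex s = (clockIter r σ k).2.1 := by
    have : ∀ᶠ s : ℝ≥0 in 𝓝 t, (s : ℝ≥0∞) < (clockIter r σ (k + 1)).2.2 :=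
      (ENNReal.continuous_coe.tendsto t).eventually_lt_const h2
    filter_upwards [this.filter_mono nhdsWithin_le_nhds, self_mem_nhdsWithin] with s hs hts
    exact clockCount_eq hex s k (h1.trans (by exact_mod_cast hts)) hs
  exact (continuousWithinAt_const (b := (clockIter r σ k).2.1)).congr_of_eventuallyEq hev
    (clockCount_eq hex t k h1 h2)

/-- A finite infimum over finitely many clocks is attained. The minimizing clock has positive speed,
since division of a positive waiting time by zero gives `⊤`. -/
lemma ClockState.IsConsistent.exists_ring [Finite K] {s : ClockState K} (hs : s.IsConsistent σ)
    (hfin : clockGap r σ s ≠ ⊤) : ∃ κ, σ κ (s.2.1 κ) ≤ s.1 κ + r s.2.1 κ * clockGap r σ s := by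
  have hne : Nonempty K := by
    by_contra hK
    rw [not_nonempty_iff] at hK
    exact hfin (iInf_of_empty _)
  obtain ⟨κ, hκ⟩ := exists_eq_ciInf_of_finite
    (f := fun κ => (σ κ (s.2.1 κ) - s.1 κ) / (r s.2.1 κ : ℝ≥0∞))
  change _ = clockGap r σ s at hκ
  refine ⟨κ, ?_⟩
  have hr : (r s.2.1 κ : ℝ≥0∞) ≠ 0 := fun hr => by
    simp only [hr] at hκ
    rw [ENNReal.div_zero (tsub_pos_of_lt (hs.lt κ)).ne'] at hκ
    exact hfin hκ.symm
  rw [← hκ, ENNReal.mul_div_cancel hr (ENNReal.natCast_ne_top _),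
    add_tsub_cancel_of_le (hs.lt κ).le]

/-- Several clocks may advance in one step, so the invariant has to survive any simultaneous
increments by one of clocks with positive speed. -/
lemma IsClockSystem.clockCount_invariant (h : IsClockSystem σ N) (p : (K → ℕ) → Prop)
    (h0 : p 0) (hstep : ∀ n n' : K → ℕ, p n →
      (∀ κ, n' κ = n κ ∨ (n' κ = n κ + 1 ∧ 0 < r n κ)) → p n') (t : ℝ≥0) :
    p (clockCount r σ hex t) := by
  obtain ⟨k, h1, h2⟩ := exists_clock_interval hex t
  rw [clockCount_eq hex t k h1 h2]
  have : ∀ k, (clockIter r σ k).2.2 ≠ ⊤ → p (clockIter r σ k).2.1 := by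
    intro k
    induction k with
    | zero => exact fun _ => h0
    | succ k ih =>
      intro hk
      have hk' := ENNReal.add_ne_top.1 hk
      refine hstep _ _ (ih hk'.1) fun κ => ?_
      simp only [clockIter, clockStep]
      split_ifs with hκ
      · exact Or.inr ⟨rfl, (h.isConsistent_iter k hk'.1).speed_pos hκ⟩
      · exact Or.inl rfl
  exact this k (ne_top_of_le_ne_top ENNReal.coe_ne_top h1)

variable [Fintype K]

lemma IsClockSystem.le_sum_iter (h : IsClockSystem σ N) (k : ℕ)
    (hk : (clockIter r σ k).2.2 ≠ ⊤) : k ≤ ∑ κ, (clockIter r σ k).2.1 κ := by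
  induction k with
  | zero => exact Nat.zero_le _
  | succ k ih =>
    have hk' := ENNReal.add_ne_top.1 hk
    have hs := h.isConsistent_iter k hk'.1
    obtain ⟨κ₀, hκ₀⟩ := hs.exists_ring hk'.2
    refine Nat.succ_le_of_lt ((ih hk'.1).trans_lt (Finset.sum_lt_sum (fun κ _ => ?_)
      ⟨κ₀, Finset.mem_univ _, ?_⟩))
    · simp only [clockIter, clockStep]; split_ifs <;> omega
    · simp only [clockIter, clockStep, if_pos hκ₀]; omega

/-- No explosion: up to physical time `t` the internal times stay below `R * t`, which bounds the
total number of rings, whereas `k` steps record at least `k` of them. -/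
lemma IsClockSystem.exists_lt_time (h : IsClockSystem σ N) {R : ℕ} (hR : ∀ n κ, r n κ ≤ R)
    (t : ℝ≥0) : ∃ k, (t : ℝ≥0∞) < (clockIter r σ (k + 1)).2.2 := by
  by_contra hcon
  push Not at hcon
  set k := ∑ κ, N κ (R * t) + 1
  have hfin : (clockIter r σ (k + 1)).2.2 ≠ ⊤ := ne_top_of_le_ne_top ENNReal.coe_ne_top (hcon k)
  have hs := h.isConsistent_iter (k + 1) hfin
  have h1 := h.le_sum_iter (k + 1) hfin
  have h2 : ∀ κ, (clockIter r σ (k + 1)).2.1 κ ≤ N κ (R * t) := fun κ => by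
    have hb := (clockIter_le hR (σ := σ) (k + 1) κ).trans (mul_le_mul_right (hcon k) _)
    by_contra hlt
    have h3 := (hs.le κ _ (not_le.1 hlt)).trans hb
    have h4 := (h.count κ (N κ (R * t)) (R * t)).1 (by exact_mod_cast h3)
    exact lt_irrefl _ h4
  have h3 := Finset.sum_le_sum fun κ (_ : κ ∈ Finset.univ) => h2 κ
  omega

lemma intervalIntegrable_comp_of_bounded {C : ℝ≥0 → K → ℕ} (hC : Measurable C)
    (g : (K → ℕ) → ℝ) {B : ℝ} (hB : ∀ n, |g n| ≤ B) (a b : ℝ) :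
    IntervalIntegrable (fun s : ℝ => g (C s.toNNReal)) volume a b := by
  rw [intervalIntegrable_iff]
  refine Measure.integrableOn_of_bounded (M := B) (by simp) ?_ ?_
  · exact ((measurable_of_countable g).comp (hC.comp measurable_real_toNNReal)).aestronglyMeasurable
  · exact Eventually.of_forall fun s => hB _

/-- The speed is constant between events, so its integral is the internal time of the clock. The
right endpoint is allowed in `h2` so that the induction can join the pieces at event times. -/
lemma IsClockSystem.integral_clockCount (h : IsClockSystem σ N) {R : ℕ}
    (hR : ∀ n κ, r n κ ≤ R) (κ : K) (k : ℕ) (t : ℝ≥0) (h1 : (clockIter r σ k).2.2 ≤ t)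
    (h2 : (t : ℝ≥0∞) ≤ (clockIter r σ (k + 1)).2.2) :
    ∫ s in (0 : ℝ)..t, (r (clockCount r σ hex s.toNNReal) κ : ℝ)
      = ((clockIter r σ k).1 κ).toReal
        + r (clockIter r σ k).2.1 κ * (t - (clockIter r σ k).2.2.toReal) := by
  have hint : ∀ a b, IntervalIntegrable
      (fun s : ℝ => (r (clockCount r σ hex s.toNNReal) κ : ℝ)) volume a b := fun a b =>
    intervalIntegrable_comp_of_bounded (measurable_clockCount hex) (fun n => (r n κ : ℝ)) (B := R)
      (fun n => by rw [Nat.abs_cast]; exact_mod_cast hR n κ) a b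
  have piece : ∀ (k : ℕ) (t : ℝ≥0), (clockIter r σ k).2.2 ≤ t →
      (t : ℝ≥0∞) ≤ (clockIter r σ (k + 1)).2.2 →
      ∫ s in (clockIter r σ k).2.2.toReal..t, (r (clockCount r σ hex s.toNNReal) κ : ℝ)
        = r (clockIter r σ k).2.1 κ * (t - (clockIter r σ k).2.2.toReal) := by
    intro k t h1 h2
    have hfin := ne_top_of_le_ne_top ENNReal.coe_ne_top h1
    have hle : (clockIter r σ k).2.2.toReal ≤ t := ENNReal.toReal_le_coe_of_le_coe h1
    have : ∫ s in (clockIter r σ k).2.2.toReal..t, (r (clockCount r σ hex s.toNNReal) κ : ℝ)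
        = ∫ s in (clockIter r σ k).2.2.toReal..t, (r (clockIter r σ k).2.1 κ : ℝ) := by
      refine intervalIntegral.integral_congr_Ioo_of_le hle fun s hs => ?_
      have hs0 : 0 ≤ s := ENNReal.toReal_nonneg.trans hs.1.le
      have e1 : (clockIter r σ k).2.2 ≤ (s.toNNReal : ℝ≥0∞) :=
        (ENNReal.le_ofReal_iff_toReal_le hfin hs0).2 hs.1.le
      have e2 : (s.toNNReal : ℝ≥0∞) < t := by
        rw [ENNReal.coe_lt_coe, Real.toNNReal_lt_iff_lt_coe hs0]; exact hs.2
      simp only [clockCount_eq hex s.toNNReal k e1 (e2.trans_le h2)]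
    rw [this, intervalIntegral.integral_const, smul_eq_mul, mul_comm]
  induction k generalizing t with
  | zero =>
    have := piece 0 t h1 h2
    simpa [clockIter] using this
  | succ k ih =>
    have hfin := ne_top_of_le_ne_top ENNReal.coe_ne_top h1
    have hfin' := ENNReal.add_ne_top.1 hfin
    have hb := (h.isConsistent_iter k hfin'.1).lt κ
    have e := ih (clockIter r σ (k + 1)).2.2.toNNReal
      (by rw [ENNReal.coe_toNNReal hfin]; exact le_self_add)
      (by rw [ENNReal.coe_toNNReal hfin])
    have e' : ((clockIter r σ (k + 1)).2.2.toNNReal : ℝ) = (clockIter r σ (k + 1)).2.2.toReal := rfl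
    rw [e'] at e
    rw [← intervalIntegral.integral_add_adjacent_intervals (hint 0 _)
      (hint (clockIter r σ (k + 1)).2.2.toReal t), e, piece (k + 1) t h1 h2]
    congr 1
    simp only [clockIter, clockStep]
    rw [ENNReal.toReal_add hfin'.1 hfin'.2, ENNReal.toReal_add hb.ne_top
      (ENNReal.mul_ne_top (ENNReal.natCast_ne_top _) hfin'.2), ENNReal.toReal_mul,
      ENNReal.toReal_natCast]
    ring

/-- The internal time reached at `t` lies between the last recorded ring and the next one, and there
the counting function equals the recorded count. -/
lemma IsClockSystem.clockCount_eq_count (h : IsClockSystem σ N) {R : ℕ}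
    (hR : ∀ n κ, r n κ ≤ R) (κ : K) (t : ℝ≥0) :
    clockCount r σ hex t κ = N κ (busyTime (fun s => r (clockCount r σ hex s) κ) t) := by
  obtain ⟨k, h1, h2⟩ := exists_clock_interval hex t
  have hfin := ne_top_of_le_ne_top ENNReal.coe_ne_top h1
  have hs := h.isConsistent_iter k hfin
  rw [busyTime, h.integral_clockCount hex hR κ k t h1 h2.le, clockCount_eq hex t k h1 h2]
  have hsub : (t : ℝ) - (clockIter r σ k).2.2.toReal
      = ((t : ℝ≥0∞) - (clockIter r σ k).2.2).toReal := by
    rw [ENNReal.toReal_sub_of_le h1 ENNReal.coe_ne_top]; rfl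
  have hcoe : ((Real.toNNReal (((clockIter r σ k).1 κ).toReal
        + r (clockIter r σ k).2.1 κ * (t - (clockIter r σ k).2.2.toReal)) : ℝ≥0) : ℝ≥0∞)
      = (clockIter r σ k).1 κ
        + r (clockIter r σ k).2.1 κ * ((t : ℝ≥0∞) - (clockIter r σ k).2.2) := by
    have hne : (r (clockIter r σ k).2.1 κ : ℝ≥0∞) * ((t : ℝ≥0∞) - (clockIter r σ k).2.2) ≠ ⊤ :=
      ENNReal.mul_ne_top (ENNReal.natCast_ne_top _) (ENNReal.sub_ne_top ENNReal.coe_ne_top)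
    rw [hsub, ← ENNReal.toReal_natCast, ← ENNReal.toReal_mul,
      ← ENNReal.toReal_add (hs.lt κ).ne_top hne]
    exact ENNReal.ofReal_toReal (ENNReal.add_ne_top.2 ⟨(hs.lt κ).ne_top, hne⟩)
  refine (h.count_eq hs κ _ ?_ ?_).symm
  · rw [hcoe]; exact le_self_add
  · rw [hcoe]
    refine hs.clock_add_lt κ (ENNReal.sub_lt_of_lt_add h1 ?_)
    rw [add_comm]; exact h2

lemma measurable_clockIter {Ω : Type*} [MeasurableSpace Ω] {σ : K → ℕ → Ω → ℝ≥0∞}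
    (hσ : ∀ κ m, Measurable (σ κ m)) (k : ℕ) :
    Measurable fun ω => clockIter r (fun κ m => σ κ m ω) k := by
  induction k with
  | zero => exact measurable_const
  | succ k ih =>
    set s := fun ω => clockIter r (fun κ m => σ κ m ω) k
    have hn : Measurable fun ω => (s ω).2.1 := ih.snd.fst
    have hnκ : ∀ κ, Measurable fun ω => (s ω).2.1 κ := fun κ => (measurable_pi_apply κ).comp hn
    have hb : ∀ κ, Measurable fun ω => (s ω).1 κ := fun κ => (measurable_pi_apply κ).comp ih.fst
    have hr : ∀ κ, Measurable fun ω => (r (s ω).2.1 κ : ℝ≥0∞) := fun κ =>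
      (measurable_of_countable fun n => (r n κ : ℝ≥0∞)).comp hn
    have hl : ∀ κ, Measurable fun ω => σ κ ((s ω).2.1 κ) ω := fun κ =>
      (measurable_from_prod_countable_right (f := fun p : ℕ × Ω => σ κ p.1 p.2)
        fun m => hσ κ m).comp ((hnκ κ).prodMk measurable_id)
    have hgap : Measurable fun ω => clockGap r (fun κ m => σ κ m ω) (s ω) :=
      Measurable.iInf fun κ => ((hl κ).sub (hb κ)).div (hr κ)
    have hb' : ∀ κ, Measurable fun ω =>
        (s ω).1 κ + r (s ω).2.1 κ * clockGap r (fun κ m => σ κ m ω) (s ω) := fun κ =>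
      (hb κ).add ((hr κ).mul hgap)
    refine Measurable.prodMk (measurable_pi_lambda _ hb') (Measurable.prodMk
      (measurable_pi_lambda _ fun κ => ?_) (ih.snd.snd.add hgap))
    exact Measurable.ite (measurableSet_le (hl κ) (hb' κ)) ((hnκ κ).add_const 1) (hnκ κ)

/-- Existence of a counting process with state dependent speeds, driven by given clocks. -/
theorem exists_timeChanged_count {Ω : Type*} [MeasurableSpace Ω] {r : (K → ℕ) → K → ℕ} {R : ℕ}
    (hR : ∀ n κ, r n κ ≤ R) {N : K → ℝ≥0 → Ω → ℕ} {σ : K → ℕ → Ω → ℝ≥0∞}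
    (hσ : ∀ κ m, Measurable (σ κ m))
    (hN : ∀ ω, IsClockSystem (fun κ m => σ κ m ω) (fun κ u => N κ u ω))
    {p : (K → ℕ) → Prop} (h0 : p 0) (hstep : ∀ n n' : K → ℕ, p n →
      (∀ κ, n' κ = n κ ∨ (n' κ = n κ + 1 ∧ 0 < r n κ)) → p n') :
    ∃ C : ℝ≥0 → Ω → K → ℕ, (∀ t, Measurable (C t)) ∧ (∀ ω, Measurable fun t => C t ω) ∧
      (∀ ω t, ContinuousWithinAt (fun s => C s ω) (Set.Ici t) t) ∧
      (∀ ω t κ, C t ω κ = N κ (busyTime (fun s => r (C s ω) κ) t) ω) ∧ ∀ ω t, p (C t ω) := by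
  classical
  have hex : ∀ ω (t : ℝ≥0), ∃ k, (t : ℝ≥0∞) < (clockIter r (fun κ m => σ κ m ω) (k + 1)).2.2 :=
    fun ω => (hN ω).exists_lt_time hR
  refine ⟨fun t ω => clockCount r (fun κ m => σ κ m ω) (hex ω) t, fun t => ?_, fun ω => ?_,
    fun ω t => clockCount_rightContinuous (hex ω) t,
    fun ω t κ => (hN ω).clockCount_eq_count (hex ω) hR κ t,
    fun ω t => (hN ω).clockCount_invariant (hex ω) p h0 hstep t⟩
  · exact Measurable.find (f := fun k ω => (clockIter r (fun κ m => σ κ m ω) k).2.1)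
      (p := fun k ω => (t : ℝ≥0∞) < (clockIter r (fun κ m => σ κ m ω) (k + 1)).2.2)
      (fun k => (measurable_clockIter hσ k).snd.fst)
      (fun k => measurableSet_lt measurable_const (measurable_clockIter hσ (k + 1)).snd.snd)
      (fun ω => hex ω t)
  · exact measurable_clockCount (hex ω)

end Clocks

/-! ### Kolmogorov's maximal inequality -/

section Probability

variable {Ω : Type*} [MeasurableSpace Ω] {P : Measure Ω} [IsProbabilityMeasure P]

/-- In the square of the next partial sum the cross term integrates to zero over events of the past,
since the new centred summand is independent of it; the remaining new term is a square. -/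
lemma submartingale_sq_partialSum {X : ℕ → Ω → ℝ} (hX : ∀ k, Measurable (X k))
    (hindep : iIndepFun X P) (hL : ∀ k, MemLp (X k) 2 P) (hmean : ∀ k, ∫ ω, X k ω ∂P = 0) :
    Submartingale (fun n ω => (∑ k ∈ Finset.range (n + 1), X k ω) ^ 2)
      (Filtration.natural X fun k => (hX k).stronglyMeasurable) P := by
  set 𝒢 := Filtration.natural X fun k => (hX k).stronglyMeasurable
  have hXm : ∀ k n, k ≤ n → StronglyMeasurable[𝒢 n] (X k) := fun k n hkn =>
    (Filtration.stronglyAdapted_natural (fun k => (hX k).stronglyMeasurable) k).mono (𝒢.mono hkn)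
  have hS : ∀ n, StronglyMeasurable[𝒢 n] fun ω => ∑ k ∈ Finset.range (n + 1), X k ω := fun n =>
    Finset.stronglyMeasurable_fun_sum _ fun k hk =>
      hXm k n (Nat.lt_succ_iff.1 (Finset.mem_range.1 hk))
  have hSL : ∀ n, MemLp (fun ω => ∑ k ∈ Finset.range (n + 1), X k ω) 2 P := fun n =>
    memLp_finsetSum _ fun k _ => hL k
  refine submartingale_of_setIntegral_le_succ (fun n => (hS n).pow 2)
    (fun n => (hSL n).integrable_sq) fun n s hs => ?_
  set Z : Ω → ℝ := s.indicator fun ω => ∑ k ∈ Finset.range (n + 1), X k ω with hZ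
  have hsm : MeasurableSet s := 𝒢.le n s hs
  have hind : IndepFun Z (X (n + 1)) P := by
    rw [IndepFun_iff_Indep]
    refine indep_of_indep_of_le_left ?_ (((hS n).indicator hs).measurable.comap_le)
    exact (hindep.indep_comap_natural_of_lt (fun k => (hX k).stronglyMeasurable)
      (Nat.lt_succ_self n)).symm
  have hZL : MemLp Z 2 P := (hSL n).indicator hsm
  have hzero : ∫ ω, Z ω * X (n + 1) ω ∂P = 0 := by
    rw [hind.integral_fun_mul_eq_mul_integral hZL.aestronglyMeasurable
      (hL _).aestronglyMeasurable, hmean, mul_zero]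
  have hZX : Integrable (fun ω => Z ω * X (n + 1) ω) P := hZL.integrable_mul (hL _)
  rw [← integral_indicator hsm, ← integral_indicator hsm]
  have h1 : ∫ ω, (s.indicator (fun ω => (∑ k ∈ Finset.range (n + 1), X k ω) ^ 2) ω
      + 2 * (Z ω * X (n + 1) ω)) ∂P
      = ∫ ω, s.indicator (fun ω => (∑ k ∈ Finset.range (n + 1), X k ω) ^ 2) ω ∂P := by
    rw [integral_add ((hSL n).integrable_sq.indicator hsm) (hZX.const_mul 2),
      integral_const_mul, hzero, mul_zero, add_zero]
  rw [← h1]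
  refine integral_mono (((hSL n).integrable_sq.indicator hsm).add (hZX.const_mul 2))
    ((hSL (n + 1)).integrable_sq.indicator hsm) fun ω => ?_
  by_cases hω : ω ∈ s
  · simp only [hZ, Set.indicator_of_mem hω]
    rw [Finset.sum_range_succ _ (n + 1)]
    nlinarith [sq_nonneg (X (n + 1) ω)]
  · simp [hZ, Set.indicator_of_notMem hω]

/-- Kolmogorov's maximal inequality. -/
lemma kolmogorov_maximal {X : ℕ → Ω → ℝ} (hX : ∀ k, Measurable (X k))
    (hindep : iIndepFun X P) (hL : ∀ k, MemLp (X k) 2 P) (hmean : ∀ k, ∫ ω, X k ω ∂P = 0)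
    {v : ℝ} (hv : ∀ k, ∫ ω, X k ω ^ 2 ∂P ≤ v) (n : ℕ) {a : ℝ} (ha : 0 < a) :
    P {ω | ∃ k ≤ n, a ≤ |∑ j ∈ Finset.range k, X j ω|} ≤ ENNReal.ofReal (n * v / a ^ 2) := by
  rcases n with _ | n
  · have : {ω | ∃ k ≤ 0, a ≤ |∑ j ∈ Finset.range k, X j ω|} = ∅ := by
      ext ω
      simp [ha]
    rw [this]; simp
  have hSL : MemLp (fun ω => ∑ k ∈ Finset.range (n + 1), X k ω) 2 P :=
    memLp_finsetSum _ fun k _ => hL k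
  have hvar : ∫ ω, (∑ k ∈ Finset.range (n + 1), X k ω) ^ 2 ∂P ≤ ((n + 1 : ℕ) : ℝ) * v := by
    have h1 := IndepFun.variance_sum (X := X) (s := Finset.range (n + 1)) (fun k _ => hL k)
      fun i _ j _ hij => hindep.indepFun hij
    rw [variance_of_integral_eq_zero] at h1
    · simp only [Finset.sum_apply] at h1
      rw [h1]
      refine (Finset.sum_le_sum (g := fun _ => v) fun k _ => ?_).trans (by simp)
      rw [variance_of_integral_eq_zero (hL k).aemeasurable (hmean k)]
      exact hv k
    · exact (Finset.aemeasurable_sum _ fun k _ => (hX k).aemeasurable)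
    · simp only [Finset.sum_apply]
      rw [integral_finsetSum _ fun k _ => (hL k).integrable one_le_two]
      exact Finset.sum_eq_zero fun k _ => hmean k
  have hmax := maximal_ineq (submartingale_sq_partialSum hX hindep hL hmean)
    (fun _ _ => sq_nonneg _) (ε := (a ^ 2).toNNReal) n
  rw [Real.coe_toNNReal _ (sq_nonneg a)] at hmax
  set A := {ω | a ^ 2 ≤ (Finset.range (n + 1)).sup'
    Finset.nonempty_range_add_one fun k => (∑ j ∈ Finset.range (k + 1), X j ω) ^ 2} with hA
  have hsub : {ω | ∃ k ≤ n + 1, a ≤ |∑ j ∈ Finset.range k, X j ω|} ⊆ A := by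
    rintro ω ⟨k, hk, hka⟩
    rcases k with _ | k
    · simp at hka; linarith
    · simp only [hA, Set.mem_ofPred_eq, Finset.le_sup'_iff, Finset.mem_range]
      refine ⟨k, by omega, ?_⟩
      rw [← sq_abs (∑ j ∈ Finset.range (k + 1), X j ω)]
      gcongr
  refine (measure_mono hsub).trans ?_
  have h2 : ENNReal.ofReal (∫ ω in A, (∑ k ∈ Finset.range (n + 1), X k ω) ^ 2 ∂P)
      ≤ ENNReal.ofReal (((n + 1 : ℕ) : ℝ) * v) :=
    ENNReal.ofReal_le_ofReal ((setIntegral_le_integral hSL.integrable_sq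
      (Eventually.of_forall fun ω => sq_nonneg _)).trans hvar)
  have h3 := hmax.trans h2
  rw [ENNReal.ofReal_div_of_pos (by positivity), ENNReal.le_div_iff_mul_le
    (Or.inl (by simpa using ha.ne')) (Or.inl ENNReal.ofReal_ne_top), mul_comm]
  exact h3

end Probability

/-! ### Poisson processes: moments, fluctuations, unit jumps -/

section Poisson

lemma hasSum_poisson_first (r : ℝ≥0) :
    HasSum (fun k : ℕ => Real.exp (-r) * r ^ k / (k.factorial) * (k : ℝ)) r := by
  rw [← hasSum_nat_add_iff' 1]
  have h := (hasSum_one_poissonMeasure r).mul_left (r : ℝ)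
  simp only [Finset.range_one, Finset.sum_singleton, Nat.cast_zero, mul_zero, sub_zero]
  rw [mul_one] at h
  refine h.congr_fun fun k => ?_
  rw [Nat.factorial_succ]; push_cast
  have := Nat.factorial_ne_zero k
  field_simp
  ring

lemma hasSum_poisson_second (r : ℝ≥0) :
    HasSum (fun k : ℕ => Real.exp (-r) * r ^ k / (k.factorial) * (k : ℝ) ^ 2) (r ^ 2 + r) := by
  rw [← hasSum_nat_add_iff' 1]
  have h := ((hasSum_poisson_first r).add (hasSum_one_poissonMeasure r)).mul_left (r : ℝ)
  simp only [Finset.range_one, Finset.sum_singleton, Nat.cast_zero, ne_eq, OfNat.ofNat_ne_zero,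
    not_false_eq_true, zero_pow, mul_zero, sub_zero]
  have e : (r : ℝ) * (r + 1) = r ^ 2 + r := by ring
  rw [e] at h
  refine h.congr_fun fun k => ?_
  rw [Nat.factorial_succ]; push_cast
  have := Nat.factorial_ne_zero k
  field_simp
  ring

end Poisson

section Poisson

lemma memLp_poisson (r : ℝ≥0) : MemLp (fun k : ℕ => (k : ℝ)) 2 (poissonMeasure r) := by
  rw [memLp_two_iff_integrable_sq (by fun_prop), integrable_poissonMeasure_iff]
  simpa using (hasSum_poisson_second r).summable

lemma integral_poisson (r : ℝ≥0) : ∫ k, (k : ℝ) ∂(poissonMeasure r) = r := by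
  rw [integral_poissonMeasure]
  simpa using (hasSum_poisson_first r).tsum_eq

lemma integral_sq_poisson (r : ℝ≥0) :
    ∫ k, (k : ℝ) ^ 2 ∂(poissonMeasure r) = (r : ℝ) ^ 2 + r := by
  rw [integral_poissonMeasure]
  simpa using (hasSum_poisson_second r).tsum_eq

lemma integral_sub_sq_poisson (r : ℝ≥0) :
    ∫ k, ((k : ℝ) - r) ^ 2 ∂(poissonMeasure r) = r := by
  have h1 : Integrable (fun k : ℕ => (k : ℝ)) (poissonMeasure r) :=
    (memLp_poisson r).integrable one_le_two
  have h2 : Integrable (fun k : ℕ => (k : ℝ) ^ 2) (poissonMeasure r) :=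
    (memLp_poisson r).integrable_sq
  have e : ∀ k : ℕ, ((k : ℝ) - r) ^ 2 = (k : ℝ) ^ 2 + (-(2 * r) * k + r ^ 2) := fun k => by ring
  have h3 : Integrable (fun k : ℕ => -(2 * r : ℝ) * k) (poissonMeasure r) := h1.const_mul _
  have h4 : Integrable (fun k : ℕ => -(2 * r : ℝ) * k + (r : ℝ) ^ 2) (poissonMeasure r) :=
    h3.add (integrable_const _)
  simp_rw [e]
  rw [integral_add h2 h4, integral_add h3 (integrable_const _),
    integral_const_mul, integral_poisson, integral_sq_poisson]
  simp
  ring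

/-- The second factorial moment is `r ^ 2`, and `k ^ 2 - k ≥ 1` once `k ≥ 2`, so Markov's inequality
applies. -/
lemma poisson_two_le (r : ℝ≥0) : poissonMeasure r {k | 2 ≤ k} ≤ ENNReal.ofReal (r ^ 2) := by
  have h1 : Integrable (fun k : ℕ => (k : ℝ)) (poissonMeasure r) :=
    (memLp_poisson r).integrable one_le_two
  have h2 : Integrable (fun k : ℕ => (k : ℝ) ^ 2) (poissonMeasure r) :=
    (memLp_poisson r).integrable_sq
  have hnn : ∀ k : ℕ, (0 : ℝ) ≤ (k : ℝ) ^ 2 - k := fun k => by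
    have : (k : ℝ) ≤ (k : ℝ) ^ 2 := by exact_mod_cast Nat.le_self_pow two_ne_zero k
    linarith
  have h3 : (1 : ℝ) * (poissonMeasure r).real {k : ℕ | (1 : ℝ) ≤ (k : ℝ) ^ 2 - k}
      ≤ ∫ k : ℕ, ((k : ℝ) ^ 2 - k) ∂(poissonMeasure r) :=
    mul_meas_ge_le_integral_of_nonneg (Eventually.of_forall hnn) (h2.sub h1) 1
  rw [integral_sub h2 h1, integral_poisson, integral_sq_poisson, one_mul, add_sub_cancel_right] at h3
  have hsub : {k : ℕ | 2 ≤ k} ⊆ {k : ℕ | (1 : ℝ) ≤ (k : ℝ) ^ 2 - k} := fun k hk => by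
    have h2k : (2 : ℝ) ≤ k := by exact_mod_cast (show 2 ≤ k from hk)
    show (1 : ℝ) ≤ (k : ℝ) ^ 2 - k
    nlinarith
  refine (measure_mono hsub).trans ?_
  rw [← ENNReal.ofReal_toReal (measure_ne_top (poissonMeasure r)
    {k : ℕ | (1 : ℝ) ≤ (k : ℝ) ^ 2 - k})]
  exact ENNReal.ofReal_le_ofReal h3

variable {Ω : Type*} [MeasurableSpace Ω] {P : Measure Ω} {N : ℝ≥0 → Ω → ℕ} {r : ℝ≥0}

lemma IsPoissonProcess.measurable_sub (h : IsPoissonProcess N r P) (s t : ℝ≥0) :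
    Measurable fun ω => N t ω - N s ω :=
  (measurable_of_countable fun p : ℕ × ℕ => p.1 - p.2).comp
    ((h.measurable t).prodMk (h.measurable s))

/-- Fluctuations of a Poisson process over a compact interval. -/
lemma IsPoissonProcess.fluctuation_le [IsProbabilityMeasure P] (h : IsPoissonProcess N r P) (L : ℕ) {a : ℝ} (ha : 0 < a) :
    P {ω | ¬ ∀ u : ℝ≥0, (u : ℝ) + 1 ≤ L → |(N u ω : ℝ) - r * u| ≤ a + r}
      ≤ ENNReal.ofReal (L * r / a ^ 2) := by
  set D : ℕ → Ω → ℕ := fun k ω => N ((k + 1 : ℕ) : ℝ≥0) ω - N (k : ℝ≥0) ω with hD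
  set X : ℕ → Ω → ℝ := fun k ω => (D k ω : ℝ) - r with hXdef
  have hDm : ∀ k, Measurable (D k) := fun k => h.measurable_sub _ _
  have hlaw : ∀ k, P.map (D k) = poissonMeasure r := fun k => by
    have := h.law (k : ℝ≥0) ((k + 1 : ℕ) : ℝ≥0) (by exact_mod_cast Nat.le_succ k)
    rw [hD]; simp only [this]
    congr 1
    push_cast
    rw [add_tsub_cancel_left, mul_one]
  have hX : ∀ k, Measurable (X k) := fun k =>
    ((measurable_of_countable fun m : ℕ => (m : ℝ) - r).comp (hDm k))
  have hindep : iIndepFun X P := by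
    have := h.indep_increments.nat (t := fun k : ℕ => (k : ℝ≥0)) Nat.mono_cast
    exact this.comp (fun _ m => (m : ℝ) - r) fun _ => measurable_of_countable _
  have hL : ∀ k, MemLp (X k) 2 P := fun k => by
    have h1 : MemLp (fun m : ℕ => (m : ℝ) - r) 2 (P.map (D k)) := by
      rw [hlaw k]; exact (memLp_poisson r).sub (memLp_const _)
    exact (memLp_map_measure_iff (by fun_prop) (hDm k).aemeasurable).1 h1
  have hmean : ∀ k, ∫ ω, X k ω ∂P = 0 := fun k => by
    have := integral_map (μ := P) (hDm k).aemeasurable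
      (f := fun m : ℕ => (m : ℝ) - r) (by fun_prop)
    rw [hlaw k, integral_sub ((memLp_poisson r).integrable one_le_two) (integrable_const _),
      integral_poisson] at this
    simp only [integral_const, probReal_univ, one_smul, sub_self] at this
    exact this.symm
  have hv : ∀ k, ∫ ω, X k ω ^ 2 ∂P ≤ r := fun k => by
    have := integral_map (μ := P) (hDm k).aemeasurable
      (f := fun m : ℕ => ((m : ℝ) - r) ^ 2) (by fun_prop)
    rw [hlaw k, integral_sub_sq_poisson] at this
    exact this.symm.le
  refine le_trans ?_ (kolmogorov_maximal hX hindep hL hmean hv L ha)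
  refine measure_mono_ae ?_
  filter_upwards [h.paths] with ω ⟨h0, hmono, _⟩ hω
  by_contra hcon
  refine hω fun u hu => ?_
  have hsum : ∀ k : ℕ, ∑ j ∈ Finset.range k, X j ω = N (k : ℝ≥0) ω - r * k := fun k => by
    induction k with
    | zero => simp [h0]
    | succ k ih =>
      rw [Finset.sum_range_succ, ih]
      simp only [hXdef, hD]
      rw [Nat.cast_sub (hmono (by exact_mod_cast Nat.le_succ k))]
      push_cast; ring
  have hk : ∀ k : ℕ, k ≤ L → |(N (k : ℝ≥0) ω : ℝ) - r * k| < a := fun k hk => by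
    rw [← hsum]
    by_contra hlt
    exact hcon ⟨k, hk, not_lt.1 hlt⟩
  -- Monotonicity traps `N u` between its values at two consecutive integers. This costs one further
  -- `r` and requires `⌊u⌋₊ + 1 ≤ L`.
  have hfl : ((⌊u⌋₊ : ℝ≥0) : ℝ) ≤ u := by exact_mod_cast Nat.floor_le zero_le
  have hfl' : (u : ℝ) ≤ (⌊u⌋₊ : ℝ) + 1 := by exact_mod_cast (Nat.lt_floor_add_one u).le
  have hle : ⌊u⌋₊ + 1 ≤ L := by
    have h1 : ((⌊u⌋₊ + 1 : ℕ) : ℝ) ≤ L := by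
      push_cast; refine le_trans ?_ hu; simpa using hfl
    exact_mod_cast h1
  have h1 := abs_lt.1 (hk ⌊u⌋₊ (by omega))
  have h2 := abs_lt.1 (hk (⌊u⌋₊ + 1) hle)
  have m1 : (N (⌊u⌋₊ : ℝ≥0) ω : ℝ) ≤ N u ω := by
    exact_mod_cast hmono (Nat.floor_le zero_le)
  have m2 : (N u ω : ℝ) ≤ N ((⌊u⌋₊ + 1 : ℕ) : ℝ≥0) ω := by
    exact_mod_cast hmono (by exact_mod_cast (Nat.lt_floor_add_one u).le)
  have hr : (0 : ℝ) ≤ r := r.2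
  have e1 : (r : ℝ) * ⌊u⌋₊ ≤ r * u := mul_le_mul_of_nonneg_left (by simpa using hfl) hr
  have e2 : (r : ℝ) * u ≤ r * (⌊u⌋₊ + 1) := mul_le_mul_of_nonneg_left hfl' hr
  push_cast at h2 m2
  rw [abs_le]
  constructor <;> linarith [h1.1, h2.2]

lemma exists_eq_of_increments_le_one {g : ℕ → ℕ} (h0 : g 0 = 0) {n : ℕ}
    (h : ∀ k < n, g (k + 1) ≤ g k + 1) (m : ℕ) (hm : m ≤ g n) : ∃ k ≤ n, g k = m := by
  induction n with
  | zero => exact ⟨0, le_rfl, by omega⟩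
  | succ n ih =>
    by_cases hle : m ≤ g n
    · obtain ⟨k, hk, hkm⟩ := ih (fun k hk => h k (by omega)) hle
      exact ⟨k, by omega, hkm⟩
    · exact ⟨n + 1, le_rfl, by have := h n (by omega); omega⟩

/-- Almost all paths of a Poisson process have unit jumps, and therefore attain all values. -/
lemma IsPoissonProcess.ae_attains (h : IsPoissonProcess N r P) :
    ∀ᵐ ω ∂P, ∀ u m, m ≤ N u ω → ∃ v, N v ω = m := by
  set g : ℕ → ℕ → Ω → ℕ := fun n k ω => N ((k : ℝ≥0) / (n + 1 : ℕ)) ω with hg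
  have hstep : ∀ (M : ℕ), ∀ᵐ ω ∂P, ∃ n : ℕ, ∀ k < M * (n + 1), g n (k + 1) ω - g n k ω < 2 := by
    intro M
    -- On a mesh of width `1 / (n + 1)` over `[0, M]` there are `M * (n + 1)` increments, each at
    -- least two with probability at most `(r / (n + 1)) ^ 2`. The union bound tends to zero.
    have hB : ∀ n : ℕ, P {ω | ¬ ∃ n : ℕ, ∀ k < M * (n + 1), g n (k + 1) ω - g n k ω < 2}
        ≤ ENNReal.ofReal (M * (r : ℝ) ^ 2 / ((n : ℝ) + 1)) := by
      intro n
      have hsub : {ω | ¬ ∃ n : ℕ, ∀ k < M * (n + 1), g n (k + 1) ω - g n k ω < 2}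
          ⊆ ⋃ k ∈ Finset.range (M * (n + 1)), {ω | 2 ≤ g n (k + 1) ω - g n k ω} := by
        intro ω hω
        have hω' : ¬ ∃ n : ℕ, ∀ k < M * (n + 1), g n (k + 1) ω - g n k ω < 2 := hω
        push Not at hω'
        obtain ⟨k, hk, hk2⟩ := hω' n
        exact Set.mem_biUnion (Finset.mem_coe.2 (Finset.mem_range.2 hk)) hk2
      refine (measure_mono hsub).trans ((measure_biUnion_finset_le _ _).trans ?_)
      have hone : ∀ k, P {ω | 2 ≤ g n (k + 1) ω - g n k ω}
          ≤ ENNReal.ofReal ((r : ℝ) ^ 2 / ((n : ℝ) + 1) ^ 2) := by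
        intro k
        have hle : (k : ℝ≥0) / (n + 1 : ℕ) ≤ ((k + 1 : ℕ) : ℝ≥0) / (n + 1 : ℕ) := by
          gcongr; exact_mod_cast Nat.le_succ k
        have hlaw := h.law _ _ hle
        have hdiff : ((k + 1 : ℕ) : ℝ≥0) / (n + 1 : ℕ) - (k : ℝ≥0) / (n + 1 : ℕ)
            = 1 / (n + 1 : ℕ) := by
          rw [← NNReal.sub_div]; congr 1; push_cast; exact add_tsub_cancel_left _ _
        rw [hdiff] at hlaw
        have := poisson_two_le (r * (1 / (n + 1 : ℕ)))
        rw [← hlaw, Measure.map_apply (h.measurable_sub _ _) (Set.to_countable _).measurableSet]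
          at this
        refine this.trans (le_of_eq ?_)
        congr 1
        push_cast
        field_simp
      refine (Finset.sum_le_sum fun k _ => hone k).trans (le_of_eq ?_)
      rw [Finset.sum_const, Finset.card_range, nsmul_eq_mul, ← ENNReal.ofReal_natCast,
        ← ENNReal.ofReal_mul (by positivity)]
      congr 1
      push_cast
      field_simp
    have hlim : Tendsto (fun n : ℕ => ENNReal.ofReal (M * (r : ℝ) ^ 2 / ((n : ℝ) + 1))) atTop
        (𝓝 0) := by
      rw [← ENNReal.ofReal_zero]
      exact ENNReal.tendsto_ofReal (tendsto_const_nhds.div_atTop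
        (tendsto_atTop_add_const_right _ _ tendsto_natCast_atTop_atTop))
    rw [ae_iff]
    exact le_antisymm (ge_of_tendsto' hlim hB) zero_le
  filter_upwards [ae_all_iff.2 hstep, h.paths] with ω hω ⟨h0, hmono, _⟩ u m hm
  obtain ⟨M, hM⟩ := exists_nat_ge u
  obtain ⟨n, hn⟩ := hω M
  obtain ⟨k, -, hk⟩ := exists_eq_of_increments_le_one (g := fun k => g n k ω) (n := M * (n + 1))
    (by simp [hg, h0]) (fun k hk => by have := hn k hk; omega) m (hm.trans (hmono (hM.trans
      (le_of_eq (by push_cast; field_simp)))))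
  exact ⟨_, hk⟩

/-- The ringing times of a counting path. -/
noncomputable def ringTime (N : ℝ≥0 → ℕ) (m : ℕ) : ℝ≥0∞ := ⨅ (u : ℝ≥0) (_ : m < N u), (u : ℝ≥0∞)

/-- An integer valued right-continuous path is constant on some interval to the right of `u`. If `m`
is not yet exceeded at `u`, it is therefore not exceeded immediately afterwards, and the infimum
lies beyond `u`. -/
lemma ringTime_le_iff {N : ℝ≥0 → ℕ} (hmono : Monotone N)
    (hcont : ∀ t, ContinuousWithinAt N (Set.Ici t) t) (m : ℕ) (u : ℝ≥0) :
    ringTime N m ≤ u ↔ m < N u := by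
  refine ⟨fun hle => ?_, fun hlt => iInf₂_le u hlt⟩
  by_contra hNu
  rw [not_lt] at hNu
  have hev : ∀ᶠ s in 𝓝[≥] u, N s = N u := by
    have := (hcont u).eventually (show ∀ᶠ k in 𝓝 (N u), k = N u by simp)
    exact this
  obtain ⟨v, huv, hv⟩ := (mem_nhdsGE_iff_exists_Ico_subset).1 hev
  have : (v : ℝ≥0∞) ≤ ringTime N m := by
    refine le_iInf₂ fun w hw => ?_
    by_contra hwv
    rw [not_le, ENNReal.coe_lt_coe] at hwv
    rcases lt_or_ge w u with hwu | hwu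
    · exact (hw.trans_le ((hmono hwu.le).trans hNu)).false
    · have : N w = N u := hv ⟨hwu, hwv⟩
      omega
  exact (this.trans hle).not_gt (by exact_mod_cast huv)

/-- A path attaining all values cannot jump by two, so consecutive rings never coincide. -/
lemma ringTime_strict {N : ℝ≥0 → ℕ} (hmono : Monotone N)
    (hcont : ∀ t, ContinuousWithinAt N (Set.Ici t) t)
    (hatt : ∀ u m, m ≤ N u → ∃ v, N v = m) (m : ℕ) (hm : ringTime N m ≠ ⊤) :
    ringTime N m < ringTime N (m + 1) := by
  lift ringTime N m to ℝ≥0 using hm with u hu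
  have hle : ¬ (ringTime N (m + 1) ≤ u) := by
    rw [ringTime_le_iff hmono hcont]
    intro hlt
    obtain ⟨v, hv⟩ := hatt u (m + 1) hlt.le
    have h1 : ringTime N m ≤ v := (ringTime_le_iff hmono hcont m v).2 (by omega)
    rw [← hu] at h1
    have := hmono (ENNReal.coe_le_coe.1 h1)
    omega
  exact not_le.1 hle

lemma measurable_ringTime {N : ℝ≥0 → Ω → ℕ} {G : Set Ω} [∀ ω, Decidable (ω ∈ G)]
    (hG : MeasurableSet G)
    (hN : ∀ t, Measurable (N t)) (hmono : ∀ ω ∈ G, Monotone fun t => N t ω)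
    (hcont : ∀ ω ∈ G, ∀ t, ContinuousWithinAt (fun s => N s ω) (Set.Ici t) t) (m : ℕ) :
    Measurable (G.piecewise (fun ω => ringTime (fun t => N t ω) m) fun _ => ⊤) := by
  refine measurable_of_Iic fun a => ?_
  rcases eq_or_ne a ⊤ with rfl | ha
  · simp
  · lift a to ℝ≥0 using ha
    have : G.piecewise (fun ω => ringTime (fun t => N t ω) m) (fun _ => ⊤) ⁻¹' Set.Iic (a : ℝ≥0∞)
        = G ∩ {ω | m < N a ω} := by
      ext ω
      by_cases hω : ω ∈ G
      · simp [hω, ringTime_le_iff (hmono ω hω) (hcont ω hω)]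
      · simp [hω]
    rw [this]
    exact hG.inter (measurableSet_lt measurable_const (hN a))

end Poisson

/-! ### Renewal arrivals -/

section Arrivals

variable {I Ω : Type*}

/-- The property of the interarrival times which makes the arrival process a counting process. -/
def IsRenewalPath (U : I → ℕ → Ω → ℝ) (ω : Ω) : Prop :=
  (∀ i k, 0 < U i k ω) ∧ ∀ i, Tendsto (fun l => ∑ k ∈ Finset.range l, U i k ω) atTop atTop

lemma IsRenewalPath.monotone {U : I → ℕ → Ω → ℝ} {ω : Ω} (h : IsRenewalPath U ω) (i : I) :
    StrictMono fun l => ∑ k ∈ Finset.range l, U i k ω :=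
  strictMono_nat_of_lt_succ fun l => by
    rw [Finset.sum_range_succ]; linarith [h.1 i l]

/-- Divergence of the partial sums keeps the set under `sSup` bounded, so that the supremum is
attained instead of being the default value zero. -/
lemma IsRenewalPath.le_arrivals_iff {U : I → ℕ → Ω → ℝ} {ω : Ω} (h : IsRenewalPath U ω)
    {lam : I → ℝ} {i : I} (hlam : 0 < lam i) (t : ℝ≥0) (m : ℕ) :
    m ≤ arrivals U lam i t ω ↔ ∑ k ∈ Finset.range m, U i k ω ≤ lam i * t := by
  have hset : {l : ℕ | ∑ k ∈ Finset.range l, U i k ω / lam i ≤ t}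
      = {l : ℕ | ∑ k ∈ Finset.range l, U i k ω ≤ lam i * t} := by
    ext l
    rw [Set.mem_ofPred_eq, Set.mem_ofPred_eq, ← Finset.sum_div, div_le_iff₀' hlam]
  rw [arrivals, hset]
  have hbdd : BddAbove {l : ℕ | ∑ k ∈ Finset.range l, U i k ω ≤ lam i * t} := by
    obtain ⟨L, hL⟩ := ((h.2 i).eventually_gt_atTop (lam i * t)).exists
    refine ⟨L, fun l hl => ?_⟩
    by_contra hlt
    have := (h.monotone i) (not_le.1 hlt)
    exact (hL.trans this).not_ge hl
  refine ⟨fun hm => ?_, fun hm => le_csSup hbdd hm⟩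
  have hne : {l : ℕ | ∑ k ∈ Finset.range l, U i k ω ≤ lam i * t}.Nonempty :=
    ⟨0, by simp only [Set.mem_ofPred_eq, Finset.range_zero, Finset.sum_empty]; positivity⟩
  exact ((h.monotone i).monotone hm).trans (Nat.sSup_mem hne hbdd)

variable [MeasurableSpace Ω] {P : Measure Ω} {U : I → ℕ → Ω → ℝ}

lemma IsRenewalInput.indep_class (hU : IsRenewalInput U P) (i : I) : iIndepFun (U i) P :=
  hU.indep.precomp (g := fun k : ℕ => (i, k)) fun _ _ h => (Prod.mk.inj h).2

/-- By the strong law the partial sums grow linearly, the mean interarrival time being one. -/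
lemma IsRenewalInput.ae_isRenewalPath [Finite I] [IsProbabilityMeasure P]
    (hU : IsRenewalInput U P) :
    ∀ᵐ ω ∂P, IsRenewalPath U ω := by
  have h1 : ∀ᵐ ω ∂P, ∀ i k, 0 < U i k ω :=
    ae_all_iff.2 fun i => ae_all_iff.2 fun k => hU.pos i k
  have h2 : ∀ᵐ ω ∂P, ∀ i, Tendsto (fun l : ℕ => (∑ k ∈ Finset.range l, U i k ω) / l) atTop
      (𝓝 1) := ae_all_iff.2 fun i => by
    rw [← hU.mean i]
    exact strong_law_ae_real (U i) ((hU.sq_integrable i).integrable one_le_two)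
      (fun k l hkl => (hU.indep_class i).indepFun hkl) (hU.identDistrib i)
  filter_upwards [h1, h2] with ω hω1 hω2
  refine ⟨hω1, fun i => ?_⟩
  have h3 := (hω2 i).pos_mul_atTop one_pos (tendsto_natCast_atTop_atTop (R := ℝ))
  refine h3.congr' ?_
  filter_upwards [eventually_gt_atTop 0] with l hl
  field_simp

/-- Inversion of the renewal process: `lam i * t` lies between the partial sums of orders `A` and `A
+ 1`, each within `a` of its index. The condition on `L` ensures `A < L`, where these bounds hold.
-/
lemma IsRenewalInput.fluctuation_le [Finite I] [IsProbabilityMeasure P]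
    (hU : IsRenewalInput U P) (i : I) {lam : I → ℝ}
    (hlam : 0 < lam i) (L : ℕ) {a : ℝ} (ha : 0 < a) :
    P {ω | ¬ ∀ t : ℝ≥0, lam i * t + a ≤ L → |(arrivals U lam i t ω : ℝ) - lam i * t| ≤ a + 1}
      ≤ ENNReal.ofReal (L * variance (U i 0) P / a ^ 2) := by
  set X : ℕ → Ω → ℝ := fun k ω => U i k ω - 1 with hXdef
  have hX : ∀ k, Measurable (X k) := fun k => (hU.measurable i k).sub_const 1
  have hindep : iIndepFun X P :=
    (hU.indep_class i).comp (fun _ x => x - 1) fun _ => measurable_id.sub_const 1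
  have hUL : ∀ k, MemLp (U i k) 2 P := fun k =>
    ((hU.identDistrib i k).memLp_iff).2 (hU.sq_integrable i)
  have hL : ∀ k, MemLp (X k) 2 P := fun k => (hUL k).sub (memLp_const 1)
  have hmeanU : ∀ k, ∫ ω, U i k ω ∂P = 1 := fun k =>
    (hU.identDistrib i k).integral_eq.trans (hU.mean i)
  have hmean : ∀ k, ∫ ω, X k ω ∂P = 0 := fun k => by
    simp only [hXdef]
    rw [integral_sub ((hUL k).integrable one_le_two) (integrable_const _), hmeanU]
    simp
  have hv : ∀ k, ∫ ω, X k ω ^ 2 ∂P ≤ variance (U i 0) P := fun k => by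
    rw [← (hU.identDistrib i k).variance_eq, variance_eq_integral (hUL k).aemeasurable, hmeanU]
  refine le_trans ?_ (kolmogorov_maximal hX hindep hL hmean hv L ha)
  refine measure_mono_ae ?_
  filter_upwards [hU.ae_isRenewalPath] with ω hpath hω
  by_contra hcon
  refine hω fun t ht => ?_
  have hk : ∀ k : ℕ, k ≤ L → |∑ j ∈ Finset.range k, U i j ω - k| < a := fun k hk => by
    have : ∑ j ∈ Finset.range k, U i j ω - k = ∑ j ∈ Finset.range k, X j ω := by
      simp [hXdef]
    rw [this]
    by_contra hlt
    exact hcon ⟨k, hk, not_lt.1 hlt⟩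
  set A := arrivals U lam i t ω with hA
  have hle := (hpath.le_arrivals_iff hlam t A).1 le_rfl
  have hgt : lam i * t < ∑ k ∈ Finset.range (A + 1), U i k ω := by
    by_contra h
    have := (hpath.le_arrivals_iff hlam t (A + 1)).2 (not_lt.1 h)
    omega
  have hAL : A < L := by
    by_contra h
    have h1 := (hpath.monotone i).monotone (not_lt.1 h)
    have h2 := (abs_lt.1 (hk L le_rfl)).1
    linarith
  have h1 := (abs_lt.1 (hk A hAL.le)).1
  have h2 := (abs_lt.1 (hk (A + 1) hAL)).2
  push_cast at h2
  rw [abs_le]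
  constructor <;> linarith

end Arrivals

/-! ### Feedback functions define policies -/

section Existence

variable {I J Ω : Type*} [Fintype J] [MeasurableSpace Ω]

lemma busyTime_one (t : ℝ≥0) : busyTime (fun _ => 1) t = t := by
  simp [busyTime]

/-- The numbers of customers in the system, as a function of the numbers of arrivals and service
completions. -/
def population (init : I → ℕ) (n : I ⊕ I × J → ℕ) (i : I) : ℕ :=
  init i + n (Sum.inl i) - ∑ j, n (Sum.inr (i, j))

/-- The speeds of the arrival and service clocks under the feedback `f`. -/
def clockSpeed (init : I → ℕ) (f : (I → ℕ) → I → J → ℕ) (n : I ⊕ I × J → ℕ) : I ⊕ I × J → ℕ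
  | Sum.inl _ => 1
  | Sum.inr p => f (population init n) p.1 p.2

/-- Services completing in one step number at most the customers in service, hence at most the
population. So the truncated subtraction in `population` is always exact. -/
lemma population_step {init : I → ℕ} {f : (I → ℕ) → I → J → ℕ}
    (hrow : ∀ x i, ∑ j, f x i j ≤ x i) {n n' : I ⊕ I × J → ℕ}
    (hn : ∀ i, ∑ j, n (Sum.inr (i, j)) ≤ init i + n (Sum.inl i))
    (hstep : ∀ κ, n' κ = n κ ∨ (n' κ = n κ + 1 ∧ 0 < clockSpeed init f n κ)) (i : I) :
    ∑ j, n' (Sum.inr (i, j)) ≤ init i + n' (Sum.inl i) := by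
  have h1 : ∑ j, n' (Sum.inr (i, j))
      ≤ ∑ j, (n (Sum.inr (i, j)) + f (population init n) i j) :=
    Finset.sum_le_sum fun j _ => by
      rcases hstep (Sum.inr (i, j)) with h | ⟨h, hpos⟩
      · omega
      · simp only [clockSpeed] at hpos; omega
  rw [Finset.sum_add_distrib] at h1
  have h2 := hrow (population init n) i
  have h3 : population init n i = init i + n (Sum.inl i) - ∑ j, n (Sum.inr (i, j)) := rfl
  have h4 := hn i
  have h5 : n (Sum.inl i) ≤ n' (Sum.inl i) := by
    rcases hstep (Sum.inl i) with h | ⟨h, -⟩ <;> omega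
  omega

/-- Every admissible feedback function defines a scheduling control policy. -/
theorem exists_isSCP_of_feedback [Fintype I] (P : Measure Ω) [IsProbabilityMeasure P] (sys : System I J)
    {U : I → ℕ → Ω → ℝ} (hU : IsRenewalInput U P) {S : I → J → ℝ≥0 → Ω → ℕ} {rate : I → J → ℝ≥0}
    (hS : ∀ i j, IsPoissonProcess (S i j) (rate i j) P) {f : (I → ℕ) → I → J → ℕ}
    (hmu : ∀ x i j, sys.mu i j = 0 → f x i j = 0) (hrow : ∀ x i, ∑ j, f x i j ≤ x i)
    (hcol : ∀ x j, ∑ i, f x i j ≤ sys.servers j) :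
    ∃ (X : ℝ≥0 → Ω → I → ℕ) (Y : I → ℝ≥0 → Ω → ℕ) (Z : J → ℝ≥0 → Ω → ℕ),
      IsSCP sys P (arrivals U sys.lam) S (fun i j t ω => f (X t ω) i j) (fun i t ω => X t ω i) Y Z ∧
      (∀ ω, Measurable fun t => X t ω) ∧
      ∀ ω t, ContinuousWithinAt (fun s => X s ω) (Set.Ici t) t := by
  classical
  set good : Ω → Prop := fun ω => IsRenewalPath U ω ∧ ∀ i j,
    (S i j 0 ω = 0 ∧ Monotone (fun t => S i j t ω) ∧
      ∀ t, ContinuousWithinAt (fun s => S i j s ω) (Set.Ici t) t) ∧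
    ∀ u m, m ≤ S i j u ω → ∃ v, S i j v ω = m with hgood
  have hae : ∀ᵐ ω ∂P, good ω := hU.ae_isRenewalPath.and
    (ae_all_iff.2 fun i => ae_all_iff.2 fun j => (hS i j).paths.and (hS i j).ae_attains)
  -- Path properties hold only almost surely, while the construction is wanted for every `ω`. On a
  -- measurable null set containing the bad paths, all clocks are replaced by ones that never ring.
  obtain ⟨B, hBsub, hBm, hB0⟩ := exists_measurable_superset_of_null (ae_iff.1 hae)
  set G := Bᶜ with hG
  have hGm : MeasurableSet G := hBm.compl
  have hGgood : ∀ ω ∈ G, good ω := fun ω hω => by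
    by_contra h
    exact hω (hBsub h)
  have hGae : ∀ᵐ ω ∂P, ω ∈ G := by
    rw [ae_iff]; simpa [hG] using hB0
  -- Rings are indexed from zero, so ring `m` of an arrival clock occurs after `m + 1` interarrival
  -- times.
  set σ : I ⊕ I × J → ℕ → Ω → ℝ≥0∞ := fun κ m => G.piecewise
    (match κ with
      | Sum.inl i => fun ω => ENNReal.ofReal ((∑ k ∈ Finset.range (m + 1), U i k ω) / sys.lam i)
      | Sum.inr p => fun ω => ringTime (fun t => S p.1 p.2 t ω) m) (fun _ => ⊤) with hσ
  set N : I ⊕ I × J → ℝ≥0 → Ω → ℕ := fun κ t => G.piecewise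
    (match κ with
      | Sum.inl i => arrivals U sys.lam i t
      | Sum.inr p => S p.1 p.2 t) (fun _ => 0) with hN
  have hσm : ∀ κ m, Measurable (σ κ m) := by
    rintro (i | p) m
    · refine Measurable.piecewise hGm ?_ measurable_const
      exact ((Finset.measurable_sum _ fun k _ => hU.measurable i k).div_const _).ennreal_ofReal
    · exact measurable_ringTime hGm (hS p.1 p.2).measurable
        (fun ω hω => ((hGgood ω hω).2 p.1 p.2).1.2.1)
        (fun ω hω => ((hGgood ω hω).2 p.1 p.2).1.2.2) m
  have hclock : ∀ ω, IsClockSystem (fun κ m => σ κ m ω) (fun κ u => N κ u ω) := by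
    intro ω
    by_cases hω : ω ∈ G
    · obtain ⟨hren, hser⟩ := hGgood ω hω
      refine ⟨?_, ?_, ?_⟩
      · rintro (i | p) m u
        · simp only [hσ, hN, Set.piecewise_eq_of_mem _ _ _ hω]
          rw [← Nat.succ_le_iff, hren.le_arrivals_iff (sys.lam_pos i), ENNReal.ofReal,
            ENNReal.coe_le_coe, Real.toNNReal_le_iff_le_coe, div_le_iff₀' (sys.lam_pos i)]
        · simp only [hσ, hN, Set.piecewise_eq_of_mem _ _ _ hω]
          exact ringTime_le_iff (hser p.1 p.2).1.2.1 (hser p.1 p.2).1.2.2 m u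
      · rintro (i | p)
        · simp only [hσ, Set.piecewise_eq_of_mem _ _ _ hω]
          rw [ENNReal.ofReal_pos]
          exact div_pos (by simpa using hren.1 i 0) (sys.lam_pos i)
        · simp only [hσ, Set.piecewise_eq_of_mem _ _ _ hω]
          by_contra hle
          have := (ringTime_le_iff (hser p.1 p.2).1.2.1 (hser p.1 p.2).1.2.2 0 0).1
            (by simpa using hle)
          rw [(hser p.1 p.2).1.1] at this
          exact lt_irrefl _ this
      · rintro (i | p) m hm
        · simp only [hσ, Set.piecewise_eq_of_mem _ _ _ hω]
          rw [ENNReal.ofReal_lt_ofReal_iff']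
          have h1 : ∑ k ∈ Finset.range (m + 1), U i k ω < ∑ k ∈ Finset.range (m + 2), U i k ω :=
            hren.monotone i (by omega : m + 1 < m + 2)
          refine ⟨div_lt_div_of_pos_right h1 (sys.lam_pos i), div_pos ?_ (sys.lam_pos i)⟩
          exact Finset.sum_pos (fun k _ => hren.1 i k) (by simp)
        · simp only [hσ, Set.piecewise_eq_of_mem _ _ _ hω] at hm ⊢
          exact ringTime_strict (hser p.1 p.2).1.2.1 (hser p.1 p.2).1.2.2 (hser p.1 p.2).2 m hm
    · refine ⟨fun κ m u => ?_, fun κ => ?_, fun κ m hm => ?_⟩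
      · simp [hσ, hN, Set.piecewise_eq_of_notMem _ _ _ hω]
      · simp [hσ, Set.piecewise_eq_of_notMem _ _ _ hω]
      · simp [hσ, Set.piecewise_eq_of_notMem _ _ _ hω] at hm
  have hR : ∀ n κ, clockSpeed sys.init f n κ ≤ 1 + ∑ j, sys.servers j := by
    rintro n (i | p)
    · simp [clockSpeed]
    · have h1 : f (population sys.init n) p.1 p.2 ≤ sys.servers p.2 :=
        (Finset.single_le_sum (f := fun i => f (population sys.init n) i p.2)
          (fun _ _ => Nat.zero_le _) (Finset.mem_univ p.1)).trans (hcol _ _)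
      have h2 : sys.servers p.2 ≤ ∑ j, sys.servers j :=
        Finset.single_le_sum (f := sys.servers) (fun _ _ => Nat.zero_le _) (Finset.mem_univ p.2)
      simp only [clockSpeed]; omega
  obtain ⟨C, hCm, hCpath, hCcont, hCeq, hCinv⟩ := exists_timeChanged_count hR hσm hclock
    (p := fun n => ∀ i, ∑ j, n (Sum.inr (i, j)) ≤ sys.init i + n (Sum.inl i)) (by simp)
    (fun n n' hn hstep => population_step hrow hn hstep)
  have hXcont : ∀ ω t, ContinuousWithinAt (fun s => population sys.init (C s ω)) (Set.Ici t) t :=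
    fun ω t => (continuous_of_discreteTopology
      (f := population sys.init)).continuousAt.comp_continuousWithinAt (hCcont ω t)
  have hXm : ∀ t, Measurable fun ω => population sys.init (C t ω) := fun t =>
    (measurable_of_countable (population sys.init)).comp (hCm t)
  refine ⟨fun t ω => population sys.init (C t ω),
    fun i t ω => population sys.init (C t ω) i - ∑ j, f (population sys.init (C t ω)) i j,
    fun j t ω => sys.servers j - ∑ i, f (population sys.init (C t ω)) i j, ?_,
    fun ω => (measurable_of_countable (population sys.init)).comp (hCpath ω), hXcont⟩
  refine ⟨fun i j ω t => ?_, fun i t => ?_, fun i t => ?_, fun j t => ?_,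
    fun i j h t ω => hmu _ i j h, ?_, fun i t ω => Nat.sub_add_cancel (hrow _ i),
    fun j t ω => Nat.sub_add_cancel (hcol _ j), fun i j t => ?_⟩
  · exact (continuous_of_discreteTopology
      (f := fun x => f x i j)).continuousAt.comp_continuousWithinAt (hXcont ω t)
  · exact (measurable_pi_apply i).comp (hXm t)
  · exact (measurable_of_countable fun x : I → ℕ => x i - ∑ j, f x i j).comp (hXm t)
  · exact (measurable_of_countable fun x : I → ℕ => sys.servers j - ∑ i, f x i j).comp (hXm t)
  · filter_upwards [hGae] with ω hω i t
    have hA : C t ω (Sum.inl i) = arrivals U sys.lam i t ω := by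
      rw [hCeq]
      have : busyTime (fun s => clockSpeed sys.init f (C s ω) (Sum.inl i)) t = t := busyTime_one t
      rw [this]
      simp only [hN, Set.piecewise_eq_of_mem _ _ _ hω]
    have hSC : ∀ j, C t ω (Sum.inr (i, j))
        = S i j (busyTime (fun s => f (population sys.init (C s ω)) i j) t) ω := fun j => by
      rw [hCeq]
      simp only [hN, Set.piecewise_eq_of_mem _ _ _ hω]
      rfl
    have hinv := hCinv ω t i
    simp only [population]
    rw [Nat.cast_sub hinv, Nat.cast_add, hA, Nat.cast_sum]
    congr 1
    exact Finset.sum_congr rfl fun j _ => by rw [hSC j]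
  · refine (measurable_of_countable fun x : I → ℕ => f x i j).comp ?_
    refine @measurable_pi_lambda _ _ _ (history _ _ t) _ _ fun i => ?_
    refine Measurable.of_comap_le ?_
    exact le_iSup_of_le t (le_iSup_of_le le_rfl (le_iSup_of_le i le_sup_left))

end Existence

/-! ### Uniform fluctuation bounds -/

section Fluctuations

variable {I J Ω : Type*}

/-- The primitive processes stay within a distance of about `a` from their means, for arrivals up
to time `T` and services up to the maximal amount of work that can be done until time `T`. -/
def IsRegularPath (sys : System I J) (U : I → ℕ → Ω → ℝ) (S : I → J → ℝ≥0 → Ω → ℕ) (T : ℝ≥0)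
    (a : ℝ) (ω : Ω) : Prop :=
  (∀ i, ∀ t ≤ T, |(arrivals U sys.lam i t ω : ℝ) - sys.lam i * t| ≤ a + 1) ∧
  ∀ i j, ∀ u : ℝ≥0, (u : ℝ) ≤ sys.servers j * T →
    |(S i j u ω : ℝ) - sys.mu i j * u| ≤ a + sys.mu i j

variable [MeasurableSpace Ω] [Fintype I] [Fintype J] {P : Measure Ω} [IsProbabilityMeasure P]

/-- The number of summands is of order at most `R * y ^ 2` and the permitted deviation is `R * y`,
so each maximal inequality contributes order `1 / R`, uniformly in the system; the union bound runs
over finitely many processes. -/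
lemma exists_measure_not_isRegularPath_le {U : I → ℕ → Ω → ℝ} (hU : IsRenewalInput U P)
    (F : Fluid I J) (ξ : I → J → ℝ) {c : ℝ} (hc : 0 ≤ c) (T : ℝ≥0) :
    ∃ V, 0 ≤ V ∧ ∀ (R y : ℝ) (sys : System I J) (S : I → J → ℝ≥0 → Ω → ℕ), 1 ≤ R → 1 ≤ y →
      IsClose F ξ c y sys → (∀ i j, IsPoissonProcess (S i j) (sys.mu i j).toNNReal P) →
      P {ω | ¬ IsRegularPath sys U S T (R * y) ω} ≤ ENNReal.ofReal (V / R) := by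
  set V₁ : I → ℝ := fun i => ((F.lam i + c) * T + 2) * variance (U i 0) P with hV₁
  set V₂ : I → J → ℝ := fun i j => ((F.nu j + c) * T + 2) * (F.mu i j + c) with hV₂
  have hV₁0 : ∀ i, 0 ≤ V₁ i := fun i => by
    have := (F.lam_pos i).le
    have := variance_nonneg (U i 0) P
    positivity
  have hV₂0 : ∀ i j, 0 ≤ V₂ i j := fun i j => by
    have := (F.nu_pos j).le
    have := F.mu_nonneg i j
    positivity
  refine ⟨∑ i, V₁ i + ∑ i, ∑ j, V₂ i j, add_nonneg (Finset.sum_nonneg fun i _ => hV₁0 i)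
    (Finset.sum_nonneg fun i _ => Finset.sum_nonneg fun j _ => hV₂0 i j), ?_⟩
  intro R y sys S hR hy hs hS
  have hR0 : 0 < R := by linarith
  have hy0 : 0 < y := by linarith
  have hT0 : (0 : ℝ) ≤ T := T.2
  have hy2 : 1 ≤ y ^ 2 := one_le_pow₀ hy
  have hyy2 : y ≤ y ^ 2 := by nlinarith
  set A : I → Set Ω := fun i => {ω | ¬ ∀ t : ℝ≥0, sys.lam i * t + R * y
    ≤ ⌈sys.lam i * T + R * y⌉₊ → |(arrivals U sys.lam i t ω : ℝ) - sys.lam i * t| ≤ R * y + 1}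
  set B : I → J → Set Ω := fun i j => {ω | ¬ ∀ u : ℝ≥0, (u : ℝ) + 1 ≤
    ((⌈sys.servers j * (T : ℝ)⌉₊ + 1 : ℕ) : ℝ) →
      |(S i j u ω : ℝ) - ((sys.mu i j).toNNReal : ℝ) * u| ≤ R * y + ((sys.mu i j).toNNReal : ℝ)}
  have hsub : {ω | ¬ IsRegularPath sys U S T (R * y) ω} ⊆ (⋃ i, A i) ∪ ⋃ i, ⋃ j, B i j := by
    intro ω hω
    by_contra hcon
    simp only [Set.mem_union, Set.mem_iUnion, not_or, not_exists] at hcon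
    refine hω ⟨fun i t ht => ?_, fun i j u hu => ?_⟩
    · have h1 := not_not.1 (hcon.1 i) t
      refine h1 (le_trans ?_ (Nat.le_ceil _))
      have : (t : ℝ) ≤ T := by exact_mod_cast ht
      have := (sys.lam_pos i).le
      gcongr
    · have h1 := not_not.1 (hcon.2 i j) u
      rw [Real.coe_toNNReal _ (sys.mu_nonneg i j)] at h1
      refine h1 ?_
      push_cast
      have := Nat.le_ceil (sys.servers j * (T : ℝ))
      linarith
  have hA : ∀ i, P (A i) ≤ ENNReal.ofReal (V₁ i / R) := fun i => by
    refine (hU.fluctuation_le i (sys.lam_pos i) _ (by positivity)).trans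
      (ENNReal.ofReal_le_ofReal ?_)
    have hvar := variance_nonneg (U i 0) P
    have hlam := (abs_le.1 (hs.lam i)).2
    have hlam0 := (F.lam_pos i).le
    have hL : (⌈sys.lam i * T + R * y⌉₊ : ℝ) ≤ ((F.lam i + c) * T + 2) * (R * y ^ 2) := by
      have h1 : (⌈sys.lam i * T + R * y⌉₊ : ℝ) ≤ sys.lam i * T + R * y + 1 :=
        (Nat.ceil_lt_add_one (by have := (sys.lam_pos i).le; positivity)).le
      have h2 : sys.lam i ≤ (F.lam i + c) * y ^ 2 := by nlinarith
      have h3 : (F.lam i + c) * y ^ 2 ≤ (F.lam i + c) * (R * y ^ 2) := by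
        gcongr; exact le_mul_of_one_le_left (by positivity) hR
      have h4 : sys.lam i * T ≤ (F.lam i + c) * (R * y ^ 2) * T := by
        have := h2.trans h3; gcongr
      have h5 : R * y ≤ R * y ^ 2 := by gcongr
      have h6 : 1 ≤ R * y ^ 2 := one_le_mul_of_one_le_of_one_le hR hy2
      linarith
    rw [div_le_div_iff₀ (by positivity) hR0]
    calc _ ≤ ((F.lam i + c) * T + 2) * (R * y ^ 2) * variance (U i 0) P * R := by gcongr
      _ = _ := by rw [hV₁]; ring
  have hB : ∀ i j, P (B i j) ≤ ENNReal.ofReal (V₂ i j / R) := fun i j => by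
    refine ((hS i j).fluctuation_le _ (by positivity)).trans (ENNReal.ofReal_le_ofReal ?_)
    rw [Real.coe_toNNReal _ (sys.mu_nonneg i j)]
    have hν := (F.nu_pos j).le
    have hmu0 := F.mu_nonneg i j
    have hmu : sys.mu i j ≤ F.mu i j + c := by
      have h1 := (le_mul_of_one_le_right (abs_nonneg _) hy).trans (hs.mu i j)
      linarith [(abs_le.1 h1).2]
    have hL : ((⌈sys.servers j * (T : ℝ)⌉₊ + 1 : ℕ) : ℝ) ≤ ((F.nu j + c) * T + 2) * y ^ 2 := by
      have h1 : (⌈sys.servers j * (T : ℝ)⌉₊ : ℝ) ≤ sys.servers j * T + 1 :=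
        (Nat.ceil_lt_add_one (by positivity)).le
      have h2 : (sys.servers j : ℝ) ≤ (F.nu j + c) * y ^ 2 := by
        have := (abs_le.1 (hs.servers j)).2
        nlinarith
      have h4 : (sys.servers j : ℝ) * T ≤ (F.nu j + c) * y ^ 2 * T := by gcongr
      push_cast
      linarith
    rw [div_le_div_iff₀ (by positivity) hR0]
    have hRR : R ≤ R ^ 2 := by nlinarith
    calc _ ≤ ((F.nu j + c) * T + 2) * y ^ 2 * (F.mu i j + c) * R ^ 2 := by
          have := sys.mu_nonneg i j
          gcongr
      _ = _ := by rw [hV₂]; ring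
  refine (measure_mono hsub).trans ((measure_union_le _ _).trans ?_)
  have h1 : P (⋃ i, A i) ≤ ENNReal.ofReal ((∑ i, V₁ i) / R) := by
    refine (measure_iUnion_fintype_le _ _).trans ((Finset.sum_le_sum fun i _ => hA i).trans ?_)
    rw [← ENNReal.ofReal_sum_of_nonneg fun i _ => div_nonneg (hV₁0 i) hR0.le, Finset.sum_div]
  have h2 : P (⋃ i, ⋃ j, B i j) ≤ ENNReal.ofReal ((∑ i, ∑ j, V₂ i j) / R) := by
    refine (measure_iUnion_fintype_le _ _).trans ((Finset.sum_le_sum fun i _ =>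
      (measure_iUnion_fintype_le _ _).trans (Finset.sum_le_sum fun j _ => hB i j)).trans ?_)
    simp_rw [← ENNReal.ofReal_sum_of_nonneg fun j _ => div_nonneg (hV₂0 _ j) hR0.le,
      ← Finset.sum_div]
    rw [← ENNReal.ofReal_sum_of_nonneg fun i _ =>
      div_nonneg (Finset.sum_nonneg fun j _ => hV₂0 i j) hR0.le, ← Finset.sum_div]
  refine (add_le_add h1 h2).trans (le_of_eq ?_)
  rw [← ENNReal.ofReal_add (div_nonneg (Finset.sum_nonneg fun i _ => hV₁0 i) hR0.le)
    (div_nonneg (Finset.sum_nonneg fun i _ => Finset.sum_nonneg fun j _ => hV₂0 i j) hR0.le),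
    add_div]

end Fluctuations

/-! ### Application of the path estimate to the queueing system -/

section Bounds

variable {I J Ω : Type*} [MeasurableSpace Ω] [Fintype I] [Fintype J] {P : Measure Ω}

lemma busyTime_coe (ψ : ℝ≥0 → ℕ) (t : ℝ≥0) :
    (busyTime ψ t : ℝ) = ∫ s in (0 : ℝ)..t, (ψ s.toNNReal : ℝ) :=
  Real.coe_toNNReal _ (intervalIntegral.integral_nonneg t.2 fun _ _ => Nat.cast_nonneg _)

/-- On regular paths, a feedback which serves all customers or drains the system leads to short
queueing times and small deviations. -/
lemma exists_feedback_bound {F : Fluid I J} {ξ : I → J → ℝ} (hcrit : F.IsCritical ξ)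
    {c C δ : ℝ} (hc : 0 ≤ c) (hC : 0 ≤ C) (hδ : 0 < δ) (η : ℝ) (T : ℝ≥0) :
    ∃ M, 0 < M ∧ ∀ (R y n : ℝ) (sys : System I J) (U : I → ℕ → Ω → ℝ)
      (S : I → J → ℝ≥0 → Ω → ℕ) (f : (I → ℕ) → I → J → ℕ) (X : ℝ≥0 → Ω → I → ℕ)
      (Y : I → ℝ≥0 → Ω → ℕ) (Z : J → ℝ≥0 → Ω → ℕ), 1 ≤ R → 1 ≤ y → y ^ 2 = n →
      M * R * y ≤ η * n → IsClose F ξ c y sys →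
      (∀ x : I → ℕ, ∑ i, |(x i : ℝ) - n * F.mass ξ i| ≤ η * n →
        (∑ i, x i ≤ ∑ j, sys.servers j → (∀ i, ∑ j, f x i j = x i) ∧
          ∀ i, |sys.lam i - ∑ j, sys.mu i j * f x i j|
            ≤ C * (∑ i, |(x i : ℝ) - n * F.mass ξ i| + y)) ∧
        (∑ j, sys.servers j < ∑ i, x i →
          (∀ i, |sys.lam i - ∑ j, sys.mu i j * f x i j| ≤ C * n) ∧
          ∑ i, (sys.lam i - ∑ j, sys.mu i j * f x i j) ≤ -δ * n)) →
      IsSCP sys P (arrivals U sys.lam) S (fun i j t ω => f (X t ω) i j) (fun i t ω => X t ω i) Y Z →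
      (∀ ω, Measurable fun t => X t ω) →
      (∀ ω t, ContinuousWithinAt (fun s => X s ω) (Set.Ici t) t) →
      ∀ᵐ ω ∂P, IsRegularPath sys U S T (R * y) ω →
        queueTime Y T ω ≤ ENNReal.ofReal (M * R / y) ∧
        supDeviation (fun i t ω => X t ω i) sys.init T ω ≤ ENNReal.ofReal (M * R * y) := by
  obtain ⟨K, hK0, hK⟩ := path_estimate I hC hδ T.2
  set nI : ℝ := (Fintype.card I : ℝ) with hnI
  set nJ : ℝ := (Fintype.card J : ℝ) with hnJ
  have hnI0 : 0 ≤ nI := Nat.cast_nonneg _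
  have hnJ0 : 0 ≤ nJ := Nat.cast_nonneg _
  set μs := ∑ i, ∑ j, F.mu i j with hμs
  have hμs0 : 0 ≤ μs := Finset.sum_nonneg fun i _ => Finset.sum_nonneg fun j _ => F.mu_nonneg i j
  -- This collects, in units of `R * y`, the arrival noise with its additive one, the noise of the
  -- services, and the initial error including the mismatch in the numbers of servers.
  set M₀ : ℝ := 2 + nJ + μs + nJ * c + (nI + nJ) * c with hM₀
  have hM₀0 : 0 < M₀ := by positivity
  -- The additional `M₀` pays for passing from the fluid state `n * F.mass ξ` to the actual initial
  -- condition.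
  refine ⟨(K + 1) * M₀, by positivity, ?_⟩
  intro R y n sys U S f X Y Z hR hy hyn hMn hs hf hscp hXm hXcont
  filter_upwards [hscp.balance] with ω hbal hreg
  have hy0 : 0 < y := by linarith
  have hR0 : 0 < R := by linarith
  have hn0 : 0 < n := by rw [← hyn]; positivity
  have hRy : 1 ≤ R * y := one_le_mul_of_one_le_of_one_le hR hy
  have hyRy : y ≤ R * y := le_mul_of_one_le_left hy0.le hR
  set E := M₀ * (R * y) with hE
  have hE0 : 0 ≤ E := by positivity
  have hyE : y ≤ E := by
    refine hyRy.trans (le_mul_of_one_le_left (by positivity) ?_)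
    rw [hM₀]
    have : 0 ≤ nJ * c := by positivity
    have : 0 ≤ (nI + nJ) * c := by positivity
    linarith
  set m : ℝ := ∑ j, (sys.servers j : ℝ) with hm
  set O : Set ℝ := {s | ∑ j, sys.servers j < ∑ i, X s.toNNReal ω i} with hO
  set D : I → ℝ → ℝ := fun i s => sys.lam i - ∑ j, sys.mu i j * (f (X s.toNNReal ω) i j : ℝ) with hD
  set xs : I → ℝ := fun i => n * F.mass ξ i with hxs
  set x : I → ℝ → ℝ := fun i s => (X s.toNNReal ω i : ℝ) with hx
  set e : I → ℝ → ℝ := fun i t => x i t - sys.init i - ∫ s in (0 : ℝ)..t, D i s with he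
  have hfle : ∀ z i j, (f z i j : ℝ) ≤ sys.servers j ∨ ∀ t, X t ω ≠ z := fun z i j => by
    by_cases hz : ∃ t, X t ω = z
    · obtain ⟨t, rfl⟩ := hz
      left
      have h1 := hscp.stations j t ω
      have h2 : f (X t ω) i j ≤ ∑ i, f (X t ω) i j :=
        Finset.single_le_sum (f := fun i => f (X t ω) i j) (fun _ _ => Nat.zero_le _)
          (Finset.mem_univ i)
      exact_mod_cast (by omega : f (X t ω) i j ≤ sys.servers j)
    · right
      push Not at hz
      exact hz
  have hfX : ∀ t i j, (f (X t ω) i j : ℝ) ≤ sys.servers j := fun t i j =>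
    (hfle (X t ω) i j).resolve_right fun h => h t rfl
  have hψint : ∀ i j a b, IntervalIntegrable (fun s : ℝ => (f (X s.toNNReal ω) i j : ℝ))
      volume a b := fun i j a b => by
    rw [intervalIntegrable_iff]
    refine Measure.integrableOn_of_bounded (M := sys.servers j) (by simp) ?_ ?_
    · exact ((measurable_of_countable fun z : I → ℕ => (f z i j : ℝ)).comp
        ((hXm ω).comp measurable_real_toNNReal)).aestronglyMeasurable
    · refine Eventually.of_forall fun s => ?_
      rw [Real.norm_eq_abs, Nat.abs_cast]
      exact hfX _ i j
  have hsumint : ∀ i a b, IntervalIntegrable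
      (fun s : ℝ => ∑ j, sys.mu i j * (f (X s.toNNReal ω) i j : ℝ)) volume a b := fun i a b => by
    have h := IntervalIntegrable.sum Finset.univ
      (fun j (_ : j ∈ Finset.univ) => (hψint i j a b).const_mul (sys.mu i j))
    rwa [show (∑ j, fun s : ℝ => sys.mu i j * (f (X s.toNNReal ω) i j : ℝ))
      = fun s : ℝ => ∑ j, sys.mu i j * (f (X s.toNNReal ω) i j : ℝ) from
        funext fun s => by simp] at h
  have hDint : ∀ i a b, IntervalIntegrable (D i) volume a b := fun i a b =>
    intervalIntegrable_const.sub (hsumint i a b)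
  have hDI : ∀ i (t : ℝ≥0), ∫ s in (0 : ℝ)..t, D i s
      = sys.lam i * t - ∑ j, sys.mu i j * (busyTime (fun s => f (X s ω) i j) t : ℝ) := by
    intro i t
    simp only [hD]
    rw [intervalIntegral.integral_sub intervalIntegrable_const (hsumint i 0 t),
      intervalIntegral.integral_const, intervalIntegral.integral_finsetSum
        fun j _ => (hψint i j 0 t).const_mul (sys.mu i j)]
    simp_rw [intervalIntegral.integral_const_mul, busyTime_coe]
    simp [mul_comm]
  have hbusy : ∀ i j (t : ℝ≥0), t ≤ T →
      (busyTime (fun s => f (X s ω) i j) t : ℝ) ≤ sys.servers j * T := by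
    intro i j t ht
    rw [busyTime_coe]
    have h1 : ∫ s in (0 : ℝ)..t, (f (X s.toNNReal ω) i j : ℝ)
        ≤ ∫ s in (0 : ℝ)..t, (sys.servers j : ℝ) :=
      intervalIntegral.integral_mono_on t.2 (hψint i j 0 t) intervalIntegrable_const
        fun s _ => hfX _ i j
    rw [intervalIntegral.integral_const, smul_eq_mul, sub_zero, mul_comm] at h1
    have : (t : ℝ) ≤ T := by exact_mod_cast ht
    exact h1.trans (by gcongr)
  have hmu : ∀ i j, sys.mu i j ≤ F.mu i j + c := fun i j => by
    have h1 := (le_mul_of_one_le_right (abs_nonneg _) hy).trans (hs.mu i j)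
    linarith [(abs_le.1 h1).2]
  have hbalR : ∀ i (t : ℝ≥0), (X t ω i : ℝ) = sys.init i + arrivals U sys.lam i t ω
      - ∑ j, (S i j (busyTime (fun s => f (X s ω) i j) t) ω : ℝ) := fun i t => by
    exact_mod_cast congrArg (Int.cast : ℤ → ℝ) (hbal i t)
  have hebound : ∀ i, ∀ t ∈ Set.Icc (0 : ℝ) T, |e i t| ≤ E := by
    intro i t ht
    lift t to ℝ≥0 using ht.1
    have htT : t ≤ T := by exact_mod_cast ht.2
    -- The remainder `e` consists of the centred arrivals minus the centred service completions, the
    -- latter evaluated at the busy times.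
    have heq : e i t = (arrivals U sys.lam i t ω - sys.lam i * t)
        - ∑ j, ((S i j (busyTime (fun s => f (X s ω) i j) t) ω : ℝ)
          - sys.mu i j * busyTime (fun s => f (X s ω) i j) t) := by
      simp only [he, hx, Real.toNNReal_coe]
      rw [hDI, hbalR, Finset.sum_sub_distrib]
      ring
    rw [heq]
    have h1 := hreg.1 i t htT
    have h2 : |∑ j, ((S i j (busyTime (fun s => f (X s ω) i j) t) ω : ℝ)
          - sys.mu i j * busyTime (fun s => f (X s ω) i j) t)| ≤ nJ * (R * y) + (μs + nJ * c) := by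
      refine (Finset.abs_sum_le_sum_abs _ _).trans ((Finset.sum_le_sum fun j _ =>
        (hreg.2 i j _ (hbusy i j t htT)).trans (add_le_add le_rfl (hmu i j))).trans ?_)
      rw [Finset.sum_add_distrib, Finset.sum_add_distrib]
      simp only [Finset.sum_const, Finset.card_univ, nsmul_eq_mul, ← hnJ]
      have : ∑ j, F.mu i j ≤ μs := Finset.single_le_sum (f := fun i => ∑ j, F.mu i j)
        (fun i _ => Finset.sum_nonneg fun j _ => F.mu_nonneg i j) (Finset.mem_univ i)
      linarith
    refine (abs_sub _ _).trans ((add_le_add h1 h2).trans ?_)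
    have h3 : μs + nJ * c ≤ (μs + nJ * c) * (R * y) :=
      le_mul_of_one_le_right (by positivity) hRy
    have h4 : 0 ≤ (nI + nJ) * c * (R * y) := by positivity
    rw [hE, hM₀]
    linarith
  have hinit : ∑ i, |(sys.init i : ℝ) - xs i| ≤ nI * (c * y) := by
    refine (Finset.sum_le_sum (g := fun _ => c * y) fun i _ => ?_).trans (by simp [hnI])
    have := hs.init i
    rwa [hyn] at this
  have hcE : (nI + nJ) * (c * y) ≤ E := by
    have h1 : (nI + nJ) * (c * y) ≤ (nI + nJ) * c * (R * y) := by
      rw [← mul_assoc]; gcongr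
    have h2 : 0 ≤ (2 + nJ + μs + nJ * c) * (R * y) := by positivity
    rw [hE, hM₀, add_mul]
    linarith
  have hnJc : 0 ≤ nJ * (c * y) := by positivity
  have hinit' : ∑ i, (sys.init i : ℝ) - m ≤ E := by
    have h1 : ∑ i, (sys.init i : ℝ) ≤ ∑ i, (xs i + |(sys.init i : ℝ) - xs i|) :=
      Finset.sum_le_sum fun i _ => by linarith [le_abs_self ((sys.init i : ℝ) - xs i)]
    have h2 : ∑ j, (n * F.nu j - c * y) ≤ m := Finset.sum_le_sum fun j _ => by
      have := (abs_le.1 (hs.servers j)).1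
      rw [hyn] at this
      linarith
    rw [Finset.sum_add_distrib] at h1
    simp only [hxs] at h1 hinit
    rw [← Finset.mul_sum, Fluid.sum_mass hcrit] at h1
    rw [Finset.sum_sub_distrib, ← Finset.mul_sum] at h2
    simp only [Finset.sum_const, Finset.card_univ, nsmul_eq_mul, ← hnJ] at h2
    linarith
  have hhint : IntervalIntegrable (fun t => ∑ i, |x i t - xs i|) volume 0 T := by
    rw [intervalIntegrable_iff, Set.uIoc_of_le (NNReal.coe_nonneg T)]
    refine Measure.integrableOn_of_bounded
      (M := ∑ i, ((sys.init i : ℝ) + (sys.lam i * T + (R * y + 1)) + |xs i|)) (by simp) ?_ ?_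
    · exact ((measurable_of_countable fun z : I → ℕ => ∑ i, |(z i : ℝ) - xs i|).comp
        ((hXm ω).comp measurable_real_toNNReal)).aestronglyMeasurable
    · refine (ae_restrict_iff' measurableSet_Ioc).2 (Eventually.of_forall fun s hs' => ?_)
      rw [Real.norm_eq_abs, abs_of_nonneg (Finset.sum_nonneg fun _ _ => abs_nonneg _)]
      refine Finset.sum_le_sum fun i _ => (abs_sub _ _).trans (add_le_add ?_ le_rfl)
      have hsT : s.toNNReal ≤ T := Real.toNNReal_le_iff_le_coe.2 hs'.2
      have h1 := (abs_le.1 (hreg.1 i _ hsT)).2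
      have h2 : sys.lam i * (s.toNNReal : ℝ) ≤ sys.lam i * T := by
        have := (sys.lam_pos i).le
        have : (s.toNNReal : ℝ) ≤ T := by exact_mod_cast hsT
        gcongr
      have h3 : 0 ≤ ∑ j, (S i j (busyTime (fun r => f (X r ω) i j) s.toNNReal) ω : ℝ) :=
        Finset.sum_nonneg fun _ _ => Nat.cast_nonneg _
      simp only [hx]
      rw [Nat.abs_cast, hbalR]
      linarith
  have hright : ∀ t ∈ Set.Ico (0 : ℝ) T, ∑ i, |x i t - xs i| ≤ η * n →
      ∀ᶠ s in 𝓝[>] t, ∑ i, |x i s - xs i| ≤ η * n := by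
    intro t ht hle
    have h1 : ∀ᶠ s in 𝓝[≥] t.toNNReal, X s ω = X t.toNNReal ω := by
      have := (hXcont ω t.toNNReal).eventually
        (show ∀ᶠ k in 𝓝 (X t.toNNReal ω), k = X t.toNNReal ω by simp)
      exact this
    have h2 : Tendsto Real.toNNReal (𝓝[>] t) (𝓝[≥] t.toNNReal) := by
      refine tendsto_nhdsWithin_iff.2 ⟨(continuous_real_toNNReal.tendsto t).mono_left
        nhdsWithin_le_nhds, ?_⟩
      filter_upwards [self_mem_nhdsWithin] with s hs'
      exact Real.toNNReal_le_toNNReal (le_of_lt hs')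
    filter_upwards [h2.eventually h1] with s hs'
    simp only [hx, hs']
    exact hle
  have hKE : K * E ≤ η * n := by
    refine le_trans ?_ hMn
    rw [hE]
    have : 0 ≤ M₀ * (R * y) := by positivity
    linarith
  have hest := hK x e D (fun i => (sys.init i : ℝ)) xs m E n (η * n) O hE0 hn0
    (measurableSet_lt measurable_const ((measurable_of_countable fun z : I → ℕ => ∑ i, z i).comp
      ((hXm ω).comp measurable_real_toNNReal))) hKE (by linarith) hinit' hebound
    (fun i t _ => by simp only [he]; ring) (fun i => hDint i 0 T) hhint hright
    (fun t ht hle htO i => by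
      refine ((hf (X t.toNNReal ω) hle).1 (not_lt.1 htO)).2 i |>.trans ?_
      gcongr)
    (fun t ht hle htO => (hf (X t.toNNReal ω) hle).2 htO)
    (fun t ht htO => by
      simp only [hm, hx]
      exact_mod_cast (le_of_lt htO))
  obtain ⟨hdev, htime⟩ := hest
  constructor
  · refine le_trans (measure_mono ?_) (htime.trans (ENNReal.ofReal_le_ofReal ?_))
    -- The path stays where the feedback is controlled. Outside `O` all customers are then in
    -- service, so a nonempty queue forces overload.
    · rintro s ⟨hs', hpos⟩
      refine ⟨?_, hs'⟩
      by_contra hsO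
      have h1 := ((hf (X s.toNNReal ω) ((hdev s hs').trans hKE)).1 (not_lt.1 hsO)).1
      refine hpos.ne' (Finset.sum_eq_zero fun i _ => ?_)
      have h2 := hscp.customers i s.toNNReal ω
      rw [h1 i] at h2
      omega
    · rw [hE, ← hyn, div_le_div_iff₀ (by positivity) hy0]
      have : 0 ≤ M₀ * R * y ^ 2 := by positivity
      nlinarith
  · refine iSup₂_le fun t ht => ENNReal.ofReal_le_ofReal ?_
    have h1 := hdev t ⟨t.2, by exact_mod_cast ht⟩
    have h2 : ∑ i, |(X t ω i : ℝ) - sys.init i|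
        ≤ ∑ i, (|x i t - xs i| + |(sys.init i : ℝ) - xs i|) :=
      Finset.sum_le_sum fun i _ => by
        simp only [hx, Real.toNNReal_coe]
        rw [abs_sub_comm (sys.init i : ℝ)]
        exact abs_sub_le _ _ _
    rw [Finset.sum_add_distrib] at h2
    have h3 : (K + 1) * M₀ * R * y = K * E + E := by rw [hE]; ring
    rw [h3]
    linarith

end Bounds

/-! ### Convergence in probability and the theorem -/

/-- `R` is chosen first, to make the exceptional probability small uniformly in `n`; then `n` is
taken large enough for `a R n` to drop below `ε`. -/
lemma tendstoZeroInProb_of_ae_le {Ω : Type*} [MeasurableSpace Ω] {P : Measure Ω}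
    {f : ℕ+ → Ω → ℝ≥0∞} (V : ℝ) (bad : ℝ → ℕ+ → Set Ω)
    (hV : ∀ R, 1 ≤ R → ∀ n, P (bad R n) ≤ ENNReal.ofReal (V / R)) (a : ℝ → ℕ+ → ℝ)
    (ha : ∀ R, Tendsto (a R) atTop (𝓝 0))
    (hf : ∀ R, 1 ≤ R → ∀ᶠ n in atTop, ∀ᵐ ω ∂P, ω ∉ bad R n → f n ω ≤ ENNReal.ofReal (a R n)) :
    TendstoZeroInProb P f := by
  intro ε hε
  rw [ENNReal.tendsto_nhds_zero]
  intro κ hκ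
  have hlim : Tendsto (fun R : ℝ => ENNReal.ofReal (V / R)) atTop (𝓝 0) := by
    simpa using ENNReal.tendsto_ofReal (tendsto_const_nhds.div_atTop tendsto_id (a := V))
  obtain ⟨R, hR, hR1⟩ := ((ENNReal.tendsto_nhds_zero.1 hlim κ hκ).and
    (eventually_ge_atTop 1)).exists
  filter_upwards [hf R hR1, (ha R).eventually_lt_const hε] with n hn han
  refine le_trans (measure_mono_ae ?_) ((hV R hR1 n).trans hR)
  filter_upwards [hn] with ω hω hε'
  by_contra hbad
  exact absurd (hε'.trans (hω hbad)) (not_le.2 ((ENNReal.ofReal_lt_ofReal_iff hε).2 han))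

lemma tendsto_rpow_neg_mul_sqrt {ϱ : ℝ} (hϱ : 1 / 2 < ϱ) (b : ℝ) :
    Tendsto (fun n : ℕ+ => (n : ℝ) ^ (-ϱ) * (b * √(n : ℝ))) atTop (𝓝 0) := by
  have hn : Tendsto (fun n : ℕ+ => (n : ℝ)) atTop atTop :=
    tendsto_natCast_atTop_atTop.comp tendsto_PNat_val_atTop_atTop
  have h := ((tendsto_rpow_neg_atTop (sub_pos.2 hϱ)).comp hn).const_mul b
  rw [mul_zero] at h
  refine h.congr fun n => ?_
  have h0 : (0 : ℝ) < n := by exact_mod_cast n.pos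
  rw [Function.comp_apply, Real.sqrt_eq_rpow, neg_sub, sub_eq_add_neg, Real.rpow_add h0]
  ring

end ManyServer

theorem theorem1 {I J Ω : Type*} [Fintype I] [Fintype J] [MeasurableSpace Ω]
    (P : Measure Ω) [IsProbabilityMeasure P]
    (F : ManyServer.Fluid I J) (sys : ℕ+ → ManyServer.System I J)
    (hact : ∀ n i j, 0 < (sys n).mu i j ↔ 0 < F.mu i j)
    (U : I → ℕ → Ω → ℝ) (hU : ManyServer.IsRenewalInput U P)
    (S : ℕ+ → I → J → ℝ≥0 → Ω → ℕ)
    (hS : ∀ n, ManyServer.IsServiceInput (S n) (sys n).mu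
      (ManyServer.arrivals U (sys n).lam) P)
    (ξ : I → J → ℝ) (hcrit : F.IsCritical ξ) (htree : (F.basicGraph ξ).IsTree)
    (hsecond : ManyServer.SecondOrder F ξ sys) (hsub : F.ThroughputSuboptimal ξ) :
    ∃ (Ψ : ℕ+ → I → J → ℝ≥0 → Ω → ℕ) (X Y : ℕ+ → I → ℝ≥0 → Ω → ℕ)
      (Z : ℕ+ → J → ℝ≥0 → Ω → ℕ),
      (∀ n, ManyServer.IsSCP (sys n) P (ManyServer.arrivals U (sys n).lam) (S n)
        (Ψ n) (X n) (Y n) (Z n)) ∧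
      ∀ T : ℝ≥0, 0 < T →
        ManyServer.TendstoZeroInProb P (fun n => ManyServer.queueTime (Y n) T) ∧
        ∀ ϱ : ℝ, 1 / 2 < ϱ →
          ManyServer.TendstoZeroInProb P
            (fun n ω => ENNReal.ofReal ((n : ℝ) ^ (-ϱ)) *
              ManyServer.supDeviation (X n) (sys n).init T ω) := by
  have hconn := htree.connected
  have := hcrit.nonempty_stations hconn
  have := hcrit.nonempty_classes hconn
  obtain ⟨c, hc, hclose⟩ := hsecond.isClose
  obtain ⟨C, δ, η, hC, hδ, hη, f, hfmu, hfrow, hfcol, hf⟩ :=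
    hcrit.exists_feedback hconn hsub hc sys hact hclose
  choose X Y Z hscp hXm hXcont using fun n => ManyServer.exists_isSCP_of_feedback P (sys n) hU
    (fun i j => (hS n).poisson i j) (hfmu n) (hfrow n) (hfcol n)
  -- The policies are fixed before `T` and `ϱ` are introduced; only the constants `V` and `M` below
  -- depend on `T`.
  refine ⟨fun n i j t ω => f n (X n t ω) i j, fun n i t ω => X n t ω i, Y, Z, hscp, fun T _ => ?_⟩
  obtain ⟨V, -, hV⟩ := ManyServer.exists_measure_not_isRegularPath_le hU F ξ hc T
  obtain ⟨M, hM, hbound⟩ := ManyServer.exists_feedback_bound (P := P) hcrit hc hC hδ η T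
  have hy : ∀ n : ℕ+, 1 ≤ √(n : ℝ) := fun n => Real.one_le_sqrt.2 (by exact_mod_cast n.pos)
  have hlim : Tendsto (fun n : ℕ+ => √(n : ℝ)) atTop atTop :=
    Real.tendsto_sqrt_atTop.comp (tendsto_natCast_atTop_atTop.comp tendsto_PNat_val_atTop_atTop)
  have hbad : ∀ R, 1 ≤ R → ∀ n : ℕ+,
      P {ω | ¬ ManyServer.IsRegularPath (sys n) U (S n) T (R * √(n : ℝ)) ω}
        ≤ ENNReal.ofReal (V / R) := fun R hR n =>
    hV R _ (sys n) (S n) hR (hy n) (hclose n) (hS n).poisson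
  have hgood : ∀ R, 1 ≤ R → ∀ᶠ n : ℕ+ in atTop, ∀ᵐ ω ∂P,
      ManyServer.IsRegularPath (sys n) U (S n) T (R * √(n : ℝ)) ω →
        ManyServer.queueTime (Y n) T ω ≤ ENNReal.ofReal (M * R / √(n : ℝ)) ∧
        ManyServer.supDeviation (fun i t ω => X n t ω i) (sys n).init T ω
          ≤ ENNReal.ofReal (M * R * √(n : ℝ)) := fun R hR => by
    -- For fixed `R` and large `n`, the deviation `M * R * √n` fits into the neighbourhood of radius
    -- `η * n` where the feedback is controlled.
    filter_upwards [hf, hlim.eventually_ge_atTop (M * R / η)] with n hfn hn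
    have hsq : √(n : ℝ) ^ 2 = n := Real.sq_sqrt (Nat.cast_nonneg _)
    refine hbound R _ n (sys n) U (S n) (f n) (X n) (Y n) (Z n) hR (hy n) hsq ?_ (hclose n) hfn
      (hscp n) (hXm n) (hXcont n)
    rw [div_le_iff₀ hη] at hn
    calc M * R * √(n : ℝ) ≤ √(n : ℝ) * η * √(n : ℝ) := by gcongr
      _ = η * √(n : ℝ) ^ 2 := by ring
      _ = η * n := by rw [hsq]
  refine ⟨ManyServer.tendstoZeroInProb_of_ae_le V
    (fun R n => {ω | ¬ ManyServer.IsRegularPath (sys n) U (S n) T (R * √(n : ℝ)) ω}) hbad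
    (fun R n => M * R / √(n : ℝ)) (fun R => tendsto_const_nhds.div_atTop hlim) fun R hR => ?_,
    fun ϱ hϱ => ManyServer.tendstoZeroInProb_of_ae_le V
    (fun R n => {ω | ¬ ManyServer.IsRegularPath (sys n) U (S n) T (R * √(n : ℝ)) ω}) hbad
    (fun R n => (n : ℝ) ^ (-ϱ) * (M * R * √(n : ℝ)))
    (fun R => ManyServer.tendsto_rpow_neg_mul_sqrt hϱ (M * R)) fun R hR => ?_⟩
  · filter_upwards [hgood R hR] with n hn
    filter_upwards [hn] with ω hω hreg
    exact (hω (not_not.1 hreg)).1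
  · filter_upwards [hgood R hR] with n hn
    filter_upwards [hn] with ω hω hreg
    rw [ENNReal.ofReal_mul (by positivity)]
    gcongr
    exact (hω (not_not.1 hreg)).2
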